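/- Let $p\in\mathbb N$ and let $D=\operatorname{diag}\{d_1,\dots,d_p\}$ be a real diagonal matrix with $d_k<0$ for all $k$ (i.e. $D<0$); put $|D|=\operatorname{diag}\{|d_1|,\dots,|d_p|\}$. Let $\varphi$ be a rational $p\times p$ matrix function (with complex coefficients) such that $$\lim_{z\to\infty}\varphi(z)=\tfrac i2|D|,\qquad \Im\varphi(z):=\tfrac1{2i}\big(\varphi(z)-\varphi(z)^*\big)\ge 0\quad (z\in\mathbb C_+).$$ (1) There are an integer $n\ge 1$, $n\times p$ matrices $\Psi_1(0)$, $\Psi_2$ and an $n\times n$ matrix $\gamma$ such that $$\varphi(z)=\tfrac i2|D|+\Psi_1(0)^*(\gamma-zI_n)^{-1}\Psi_2,\qquad \gamma-\gamma^*=i\big(\Psi_1(0)-\Psi_2\big)D^{-1}\big(\Psi_1(0)-\Psi_2\big)^*. \tag{R}$$ (2) Whenever $\Psi_1(0),\Psi_2,\gamma$ satisfy (R), $\varphi$ is the (unique) Weyl function of the canonical system determined by the parameter matrices $$\alpha=\gamma+i\Psi_2\Lambda_2(0)^*,\qquad \Lambda_1(0)=\tfrac12\big(\Psi_1(0)+\Psi_2\big),\qquad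 \Lambda_2(0)=\big(\Psi_1(0)-\Psi_2\big)D^{-1}.$$ Here the following terminology is used. Let $$J=\begin{bmatrix}0&I_p\\ I_p&0\end{bmatrix},\qquad H_0=\begin{bmatrix}D/2\\ I_p\end{bmatrix}\begin{bmatrix}D/2& I_p\end{bmatrix}.$$ The canonical system determined by $\alpha$ and $\Lambda(0)=[\Lambda_1(0)\ \ \Lambda_2(0)]$, where $\alpha-\alpha^*=i\Lambda(0)J\Lambda(0)^*$ is required, is the system $\frac{d}{dx}w(x,z)=izJH(x)w(x,z)$, $x\ge0$, with $H(x)=v_0(x)^*H_0v_0(x)$, where $$\Lambda'=-i\alpha\Lambda JH_0,\quad \Lambda(0)=[\Lambda_1(0)\ \ \Lambda_2(0)];\qquad \Sigma'=\Psi_1\Psi_1^*,\quad \Sigma(0)=I_n,\quad \Psi_1(x)=\Lambda(x)\begin{bmatrix}I_p\\ D/2\end{bmatrix};$$ $$v_0'=-q_0v_0,\quad v_0(0)=I_{2p},\qquad q_0=J\Lambda^*\Sigma^{-1}\Lambda JH_0-JH_0J\Lambda^*\Sigma^{-1}\Lambda .$$ A Weyl function of the system is a holomorphic $p\times p$ matrix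 function $\psi$ on $\mathbb C_+$ with $$\int_0^\infty \begin{bmatrix}I_p& i\psi(z)^*\end{bmatrix}w(x,z)^*H(x)w(x,z)\begin{bmatrix}I_p\\ -i\psi(z)\end{bmatrix}dx<\infty\qquad(z\in\mathbb C_+),$$ where $w$ is the fundamental solution of the system normalized by $w(0,z)=I_{2p}$. -/

import Mathlib

open Matrix Filter Topology MeasureTheory
open scoped ComplexOrder

noncomputable section

namespace CanonicalSystem

/-- The signature matrix `J = [0 I; I 0]` of size `2p`. -/
def sigJ (p : ℕ) : Matrix (Fin p ⊕ Fin p) (Fin p ⊕ Fin p) ℂ :=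
  fromBlocks 0 1 1 0

/-- The real diagonal matrix `D = diag(d₁, …, d_p)`. -/
def D {p : ℕ} (d : Fin p → ℝ) : Matrix (Fin p) (Fin p) ℂ :=
  diagonal fun i => (d i : ℂ)

/-- `|D| = diag(|d₁|, …, |d_p|)`. -/
def absD {p : ℕ} (d : Fin p → ℝ) : Matrix (Fin p) (Fin p) ℂ :=
  diagonal fun i => ((|d i| : ℝ) : ℂ)

/-- The constant Hamiltonian `H₀ = [D/2; I] [D/2  I]` of the initial system. -/
def H₀ {p : ℕ} (d : Fin p → ℝ) : Matrix (Fin p ⊕ Fin p) (Fin p ⊕ Fin p) ℂ :=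
  fromRows ((1 / 2 : ℂ) • D d) 1 * fromCols ((1 / 2 : ℂ) • D d) 1

/-- `F` has (entrywise) derivative `F'` at the point `x` of the half-line `[0, ∞)`;
the derivative is one-sided at `x = 0`. -/
def HasMatDerivAt {m k : Type*} (F : ℝ → Matrix m k ℂ) (F' : Matrix m k ℂ) (x : ℝ) : Prop :=
  ∀ i j, HasDerivWithinAt (fun t => F t i j) (F' i j) (Set.Ici 0) x

/-- `q₀ = J Λ* Σ⁻¹ Λ J H₀ - J H₀ J Λ* Σ⁻¹ Λ`, where `S` stands for `Σ`. -/
def q₀ {p n : ℕ} (d : Fin p → ℝ) (Λ : Matrix (Fin n) (Fin p ⊕ Fin p) ℂ)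
    (S : Matrix (Fin n) (Fin n) ℂ) : Matrix (Fin p ⊕ Fin p) (Fin p ⊕ Fin p) ℂ :=
  sigJ p * Λᴴ * S⁻¹ * Λ * sigJ p * H₀ d - sigJ p * H₀ d * sigJ p * Λᴴ * S⁻¹ * Λ

/-- `H` is (on `[0, ∞)`) the Hamiltonian of the canonical system determined by the parameter
matrices `α` and `Λ(0) = [Λ₁  Λ₂]`, with the normalization `v₀(0) = I`.  The parameter matrices
have to satisfy `α - α* = i Λ(0) J Λ(0)*`. -/
def IsDeterminedBy {p n : ℕ} (d : Fin p → ℝ) (α : Matrix (Fin n) (Fin n) ℂ)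
    (Λ₁ Λ₂ : Matrix (Fin n) (Fin p) ℂ)
    (H : ℝ → Matrix (Fin p ⊕ Fin p) (Fin p ⊕ Fin p) ℂ) : Prop :=
  α - αᴴ = Complex.I • (fromCols Λ₁ Λ₂ * sigJ p * (fromCols Λ₁ Λ₂)ᴴ) ∧
  ∃ (Λ : ℝ → Matrix (Fin n) (Fin p ⊕ Fin p) ℂ) (Ψ₁ : ℝ → Matrix (Fin n) (Fin p) ℂ)
    (S : ℝ → Matrix (Fin n) (Fin n) ℂ)
    (v₀ : ℝ → Matrix (Fin p ⊕ Fin p) (Fin p ⊕ Fin p) ℂ),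
    Λ 0 = fromCols Λ₁ Λ₂ ∧
    (∀ x, 0 ≤ x → HasMatDerivAt Λ (-Complex.I • (α * Λ x * sigJ p * H₀ d)) x) ∧
    (∀ x, 0 ≤ x → Ψ₁ x = Λ x * fromRows 1 ((1 / 2 : ℂ) • D d)) ∧
    S 0 = 1 ∧
    (∀ x, 0 ≤ x → HasMatDerivAt S (Ψ₁ x * (Ψ₁ x)ᴴ) x) ∧
    v₀ 0 = 1 ∧
    (∀ x, 0 ≤ x → HasMatDerivAt v₀ (-(q₀ d (Λ x) (S x) * v₀ x)) x) ∧
    ∀ x, 0 ≤ x → H x = (v₀ x)ᴴ * H₀ d * v₀ x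

/-- `w` is the fundamental solution of the canonical system `dw/dx = i z J H(x) w`, `x ≥ 0`,
normalized by `w(0, z) = I`. (All Hamiltonians considered are continuous on `[0, ∞)`, so that
solutions are understood in the classical sense.) -/
def IsFundamentalSolution {p : ℕ} (H : ℝ → Matrix (Fin p ⊕ Fin p) (Fin p ⊕ Fin p) ℂ)
    (w : ℝ → ℂ → Matrix (Fin p ⊕ Fin p) (Fin p ⊕ Fin p) ℂ) : Prop :=
  ∀ z : ℂ, w 0 z = 1 ∧
    ∀ x, 0 ≤ x → HasMatDerivAt (fun t => w t z) ((Complex.I * z) • (sigJ p * H x * w x z)) x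

/-- `φ` is a Weyl function of the canonical system with Hamiltonian `H`: it is holomorphic in the
open upper half-plane, and for each `z` there the matrix integral
`∫₀^∞ [I  iφ(z)*] w(x,z)* H(x) w(x,z) [I; -iφ(z)] dx` converges. -/
def IsWeylFunction {p : ℕ} (H : ℝ → Matrix (Fin p ⊕ Fin p) (Fin p ⊕ Fin p) ℂ)
    (φ : ℂ → Matrix (Fin p) (Fin p) ℂ) : Prop :=
  (∀ i j, DifferentiableOn ℂ (fun z => φ z i j) {z : ℂ | 0 < z.im}) ∧
  ∃ w : ℝ → ℂ → Matrix (Fin p ⊕ Fin p) (Fin p ⊕ Fin p) ℂ, IsFundamentalSolution H w ∧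
    ∀ z : ℂ, 0 < z.im → ∀ i j, IntegrableOn (fun x : ℝ =>
      (fromCols (1 : Matrix (Fin p) (Fin p) ℂ) (Complex.I • (φ z)ᴴ) * (w x z)ᴴ * H x * w x z *
        fromRows (1 : Matrix (Fin p) (Fin p) ℂ) (-Complex.I • φ z)) i j) (Set.Ioi 0) volume

/-- The value of a rational matrix function at `z` (meaningful if `z` is not a pole). -/
def evalAt {p : ℕ} (φ : Matrix (Fin p) (Fin p) (RatFunc ℂ)) (z : ℂ) :
    Matrix (Fin p) (Fin p) ℂ :=
  Matrix.of fun i j => (φ i j).eval (RingHom.id ℂ) z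

/-- `z` is a pole of (an entry of) the rational matrix function `φ`. -/
def IsPole {p : ℕ} (φ : Matrix (Fin p) (Fin p) (RatFunc ℂ)) (z : ℂ) : Prop :=
  ∃ i j, (φ i j).denom.eval z = 0

/-- `Im A = (A - A*) / (2i)`. -/
def imPart {p : ℕ} (A : Matrix (Fin p) (Fin p) ℂ) : Matrix (Fin p) (Fin p) ℂ :=
  (1 / (2 * Complex.I)) • (A - Aᴴ)

/-- `φ(z) = (i/2)|D| + Ψ₁* (γ - z I)⁻¹ Ψ₂` as rational functions, i.e. for every `z` that is not
an eigenvalue of `γ`, together with the identity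
`γ - γ* = i (Ψ₁ - Ψ₂) D⁻¹ (Ψ₁ - Ψ₂)*`. -/
def IsRealization {p n : ℕ} (d : Fin p → ℝ) (φ : Matrix (Fin p) (Fin p) (RatFunc ℂ))
    (Ψ₁ Ψ₂ : Matrix (Fin n) (Fin p) ℂ) (γ : Matrix (Fin n) (Fin n) ℂ) : Prop :=
  (∀ z : ℂ, (γ - z • (1 : Matrix (Fin n) (Fin n) ℂ)).det ≠ 0 →
    ¬ IsPole φ z ∧
    evalAt φ z = (Complex.I / 2) • absD d +
      Ψ₁ᴴ * (γ - z • (1 : Matrix (Fin n) (Fin n) ℂ))⁻¹ * Ψ₂) ∧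
  γ - γᴴ = Complex.I • ((Ψ₁ - Ψ₂) * (D d)⁻¹ * (Ψ₁ - Ψ₂)ᴴ)

end CanonicalSystem

end

/-! Existence in (1) is a positive real lemma. The open mapping theorem, applied to quadratic forms
of φ, excludes poles in the upper half-plane (`not_isPole_of_im_nonneg`), so there φ = (i/2)|D| +
C(A - z)⁻¹B, and (A, B) may be taken reachable. The Cayley substitution z = i(1 - l)/(1 + l) turns
this into a discrete-time system; Im φ ≥ 0 says that trajectories from 0 absorb nonnegative total
supply (`totalSupply_nonneg`). By reachability the storage available from every state is finite, and
value iteration converges to some X ≥ 0 whose dissipation defect is K*K with only p rows in K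
(`exists_storage`). As |D| is invertible, this low rank gives the Riccati equation i(XA - A*X) = (C*
- XB)|D|⁻¹(C - B*X) rather than an inequality (`riccati_of_storage`). Conjugation of A by √X, with a
generalized inverse in place of an inverse, produces γ, Ψ₁, Ψ₂ (`exists_dissipative_realization`).

For (2), put N = [I; -D/2], so H₀N = 0 and constants NC solve the system with Hamiltonian H₀. The
identity αS - Sα* = iΛJΛ* carries them to explicit solutions v₀⁻¹(NC - iJΛ*S⁻¹Q) of the transformed
system whenever αQ = zQ + Λ(0)NC (`TransformData.deriv_solution`). With Q = (γ - z)⁻¹Ψ₂ and C = I +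
iΛ₂(0)*Q the initial value is exactly [I; -iφ(z)] (`realization_solution`), and the Weyl integrand
is minus the derivative of Q*S⁻¹Q ≥ 0, hence integrable.

For uniqueness, two Weyl functions give a space of solutions f with square integrable H-norm. On it
f*Jf decreases, and since D < 0 it has an integrable lower bound, so f(0)*Jf(0) ≥ 0
(`TransformData.pairing_nonneg`). Moving along the difference of the two Weyl columns makes this
form affine in a real parameter, which forces the two functions to agree
(`eq_of_forall_pairing_nonneg`). -/

namespace CanonicalSystem

/-! ### Quadratic forms of complex matrices -/

section LinearAlgebra

variable {m n k l : Type*} [Fintype m] [Fintype n] [Fintype k] [Fintype l]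

/-- Polarization of the sesquilinear form of a complex matrix. -/
theorem four_mul_sesq (M : Matrix n n ℂ) (v w : n → ℂ) :
    4 * (star v ⬝ᵥ M *ᵥ w) =
      star (v + w) ⬝ᵥ M *ᵥ (v + w) - star (v - w) ⬝ᵥ M *ᵥ (v - w)
      - Complex.I * (star (v + Complex.I • w) ⬝ᵥ M *ᵥ (v + Complex.I • w))
      + Complex.I * (star (v - Complex.I • w) ⬝ᵥ M *ᵥ (v - Complex.I • w)) := by
  simp only [star_add, star_sub, star_smul, mulVec_add, mulVec_sub, mulVec_smul, dotProduct_add,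
    dotProduct_sub, add_dotProduct, sub_dotProduct, smul_dotProduct, dotProduct_smul,
    smul_eq_mul, Complex.star_def, Complex.conj_I]
  linear_combination (2 * (star v ⬝ᵥ M *ᵥ w) - 2 * (star w ⬝ᵥ M *ᵥ v)) * Complex.I_mul_I

theorem entry_eq_sesq [DecidableEq n] (M : Matrix n n ℂ) (i j : n) :
    M i j = star (Pi.single i (1 : ℂ)) ⬝ᵥ M *ᵥ (Pi.single j 1) := by
  simp

theorem star_quadForm {M : Matrix n n ℂ} (v : n → ℂ) :
    star (star v ⬝ᵥ M *ᵥ v) = star v ⬝ᵥ Mᴴ *ᵥ v := by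
  rw [star_dotProduct, star_star, star_mulVec, ← dotProduct_mulVec]

theorem ofReal_re_quadForm {M : Matrix n n ℂ} (hM : M.IsHermitian) (v : n → ℂ) :
    (((star v ⬝ᵥ M *ᵥ v).re : ℝ) : ℂ) = star v ⬝ᵥ M *ᵥ v := by
  apply Complex.conj_eq_iff_re.mp
  rw [← Complex.star_def, star_quadForm, hM.eq]

theorem posSemidef_of_re_nonneg {M : Matrix n n ℂ} (hM : M.IsHermitian)
    (h : ∀ v, 0 ≤ (star v ⬝ᵥ M *ᵥ v).re) : M.PosSemidef := by
  rw [posSemidef_iff_dotProduct_mulVec]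
  refine ⟨hM, fun v => ?_⟩
  rw [← ofReal_re_quadForm hM]
  exact_mod_cast h v

theorem quadForm_conjTranspose_mul_self (K : Matrix k n ℂ) (v : n → ℂ) :
    star v ⬝ᵥ (Kᴴ * K) *ᵥ v = ((∑ i, ‖(K *ᵥ v) i‖ ^ 2 : ℝ) : ℂ) := by
  rw [← mulVec_mulVec, dotProduct_mulVec, ← star_mulVec]
  push_cast
  refine Finset.sum_congr rfl fun i _ => ?_
  simp [← Complex.conj_mul']

theorem mulVec_eq_zero_of_quadForm_re_eq_zero {K : Matrix k n ℂ} {v : n → ℂ}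
    (h : (star v ⬝ᵥ (Kᴴ * K) *ᵥ v).re = 0) : K *ᵥ v = 0 := by
  rw [quadForm_conjTranspose_mul_self, Complex.ofReal_re,
    Finset.sum_eq_zero_iff_of_nonneg (fun _ _ => by positivity)] at h
  ext i
  simpa using h i (Finset.mem_univ i)

/-- Hermitian square root of a positive semidefinite matrix, with a generalized inverse. -/
theorem exists_sqrt_pinv [DecidableEq n] {X : Matrix n n ℂ} (hX : X.PosSemidef) :
    ∃ T S : Matrix n n ℂ, Tᴴ = T ∧ Sᴴ = S ∧ T * T = X ∧ T * S = S * T ∧ T * S * T = T ∧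
      S * T * S = S := by
  have hspec := hX.1.spectral_theorem
  set U := hX.1.eigenvectorUnitary
  set e := hX.1.eigenvalues
  have hU : (star (U : Matrix n n ℂ)) * (U : Matrix n n ℂ) = 1 := by simp
  have he : ∀ i, 0 ≤ e i := hX.eigenvalues_nonneg
  -- Functional calculus in an eigenbasis: `c` is multiplicative, so each required identity becomes
  -- a scalar one. The convention 0⁻¹ = 0 makes (√e)⁻¹ the generalized inverse on the kernel as
  -- well.
  let c : (n → ℝ) → Matrix n n ℂ := fun f =>
    (U : Matrix n n ℂ) * diagonal (fun i => (f i : ℂ)) * star (U : Matrix n n ℂ)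
  have hc : ∀ f g, c f * c g = c (fun i => f i * g i) := by
    intro f g
    calc c f * c g = (U : Matrix n n ℂ) * diagonal (fun i => (f i : ℂ)) *
          (star (U : Matrix n n ℂ) * (U : Matrix n n ℂ)) * diagonal (fun i => (g i : ℂ)) *
          star (U : Matrix n n ℂ) := by simp only [c, Matrix.mul_assoc]
      _ = _ := by
        rw [hU, Matrix.mul_one, Matrix.mul_assoc (U : Matrix n n ℂ), diagonal_mul_diagonal]
        simp [c]
  have hs : ∀ f, (c f)ᴴ = c f := by
    intro f
    simp only [c, conjTranspose_mul, star_eq_conjTranspose, conjTranspose_conjTranspose,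
      diagonal_conjTranspose, Matrix.mul_assoc]
    congr 3
    ext i
    simp
  have hXc : c e = X := by
    rw [hspec, Unitary.conjStarAlgAut_apply]
    rfl
  refine ⟨c fun i => √(e i), c fun i => (√(e i))⁻¹, hs _, hs _, ?_, ?_, ?_, ?_⟩
  · rw [hc, ← hXc]
    congr 1
    ext i
    exact Real.mul_self_sqrt (he i)
  · rw [hc, hc]
    congr 1
    ext i
    ring
  · rw [hc, hc]
    congr 1
    ext i
    rcases eq_or_ne (√(e i)) 0 with h | h
    · simp [h]
    · field_simp
  · rw [hc, hc]
    congr 1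
    ext i
    rcases eq_or_ne (√(e i)) 0 with h | h
    · simp [h]
    · field_simp

theorem sumElim_quadForm [DecidableEq n] [DecidableEq k] (A : Matrix n n ℂ) (B : Matrix n k ℂ)
    (D : Matrix k k ℂ) (v : n → ℂ) (u : k → ℂ) :
    (star (Sum.elim v u) ⬝ᵥ fromBlocks A B Bᴴ D *ᵥ Sum.elim v u).re =
      (star v ⬝ᵥ A *ᵥ v).re + 2 * (star v ⬝ᵥ B *ᵥ u).re + (star u ⬝ᵥ D *ᵥ u).re := by
  have h : star (Sum.elim v u) = Sum.elim (star v) (star u) := by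
    ext i; cases i <;> rfl
  have h2 : (star u ⬝ᵥ Bᴴ *ᵥ v).re = (star v ⬝ᵥ B *ᵥ u).re := by
    have : star u ⬝ᵥ Bᴴ *ᵥ v = star (star v ⬝ᵥ B *ᵥ u) := by
      rw [← star_dotProduct_star, star_star, star_mulVec, ← dotProduct_mulVec,
        dotProduct_comm]
    rw [this]; simp
  rw [fromBlocks_mulVec, h, sumElim_dotProduct_sumElim]
  simp only [Sum.elim_comp_inl, Sum.elim_comp_inr, dotProduct_add, Complex.add_re, h2]
  ring

theorem eq_zero_of_linear_bounded {a b : ℝ} (h : ∀ t : ℝ, -b ≤ t * a) : a = 0 := by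
  by_contra ha
  have := h (-(b + 1) / a)
  rw [div_mul_cancel₀ _ ha] at this
  linarith

/-- Partial minimization of a Hermitian form which is bounded below on the fibres. -/
theorem exists_partial_min [DecidableEq n] [DecidableEq k] {Q : Matrix (n ⊕ k) (n ⊕ k) ℂ}
    (hQ : Q.IsHermitian)
    (hb : ∀ v : n → ℂ, ∃ b : ℝ, ∀ u : k → ℂ,
      -b ≤ (star (Sum.elim v u) ⬝ᵥ Q *ᵥ Sum.elim v u).re) :
    ∃ (Y : Matrix n n ℂ) (K : Matrix k (n ⊕ k) ℂ), Y.IsHermitian ∧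
      Q + fromBlocks Y 0 0 0 = Kᴴ * K ∧ ∀ v : n → ℂ, ∃ u : k → ℂ, K *ᵥ Sum.elim v u = 0 := by
  obtain ⟨A, B, B', D, rfl⟩ : ∃ A B B' D, Q = fromBlocks A B B' D :=
    ⟨_, _, _, _, (fromBlocks_toBlocks Q).symm⟩
  rw [IsHermitian, fromBlocks_conjTranspose, fromBlocks_inj] at hQ
  obtain ⟨hA, -, hB, hD⟩ := hQ
  subst hB
  simp only [sumElim_quadForm] at hb
  -- On the fibre over 0 the form is t² times the value of D at u. If that value were negative, a t
  -- with t² times it equal to -(b' + 1) would violate the bound.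
  have hD0 : D.PosSemidef := by
    refine posSemidef_of_re_nonneg hD fun u => ?_
    obtain ⟨b, hb⟩ := hb 0
    by_contra! hneg
    have h1 : ∀ t : ℝ, -b ≤ t ^ 2 * (star u ⬝ᵥ D *ᵥ u).re := by
      intro t
      have := hb ((t : ℂ) • u)
      simp only [star_zero, zero_dotProduct, star_smul, mulVec_smul, smul_dotProduct,
        dotProduct_smul, Complex.star_def, Complex.conj_ofReal, smul_eq_mul] at this
      simp only [Complex.re_ofReal_mul, Complex.zero_re] at this
      nlinarith
    obtain ⟨b', hb'⟩ : ∃ b', b ≤ b' ∧ 0 ≤ b' := ⟨max b 0, le_max_left _ _, le_max_right _ _⟩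
    have h2 := h1 (√((b' + 1) / (-(star u ⬝ᵥ D *ᵥ u).re)))
    have hc : 0 < -(star u ⬝ᵥ D *ᵥ u).re := by linarith
    rw [Real.sq_sqrt (div_nonneg (by linarith) hc.le)] at h2
    have : (b' + 1) / (-(star u ⬝ᵥ D *ᵥ u).re) * (star u ⬝ᵥ D *ᵥ u).re = -(b' + 1) := by
      field_simp [hneg.ne]
    linarith
  -- Along a direction in the kernel of D the form is affine in t; being bounded below it has no
  -- linear term, and testing against v = Bu gives Bu = 0.
  have hker : ∀ u, D *ᵥ u = 0 → B *ᵥ u = 0 := by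
    intro u hu
    have key : ∀ v : n → ℂ, (star v ⬝ᵥ B *ᵥ u).re = 0 := by
      intro v
      obtain ⟨b, hb⟩ := hb v
      apply eq_zero_of_linear_bounded (b := (b + (star v ⬝ᵥ A *ᵥ v).re) / 2)
      intro t
      have := hb ((t : ℂ) • u)
      simp only [mulVec_smul, hu, smul_zero, dotProduct_zero, dotProduct_smul, smul_eq_mul,
        Complex.re_ofReal_mul, Complex.zero_re] at this
      linarith
    have h0 := key (B *ᵥ u)
    have : (star u ⬝ᵥ (Bᴴ * B) *ᵥ u).re = 0 := by
      rw [← mulVec_mulVec, dotProduct_mulVec, ← star_mulVec]; exact h0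
    exact mulVec_eq_zero_of_quadForm_re_eq_zero this
  obtain ⟨T, S, hT, hS, hTT, hTS, hTST, hSTS⟩ := exists_sqrt_pinv hD0
  have hBP : B * (S * T) = B := by
    have h1 : B * (1 - S * T) = 0 := by
      rw [← Matrix.mulVec_injective.eq_iff]
      ext1 u
      rw [← mulVec_mulVec, hker, zero_mulVec]
      rw [mulVec_mulVec, ← hTT, Matrix.mul_sub, Matrix.mul_one, Matrix.mul_assoc T T, ← Matrix.mul_assoc T S,
        hTST, sub_self, zero_mulVec]
    rw [Matrix.mul_sub, Matrix.mul_one, sub_eq_zero] at h1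
    exact h1.symm
  have hPB : T * (S * Bᴴ) = Bᴴ := by
    have := congrArg conjTranspose hBP
    rw [conjTranspose_mul, conjTranspose_mul, hT, hS] at this
    rw [← Matrix.mul_assoc]; exact this
  -- Completing the square: adding Y makes the Schur complement of D vanish, so the form factors
  -- through `k` rows only. The minimizer over v is -D⁺B*v with D⁺ = S * S.
  refine ⟨(S * Bᴴ)ᴴ * (S * Bᴴ) - A, fromCols (S * Bᴴ) T, ?_, ?_, ?_⟩
  · exact (isHermitian_conjTranspose_mul_self _).sub hA
  · rw [conjTranspose_fromCols_eq_fromRows_conjTranspose, fromRows_mul_fromCols, fromBlocks_add]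
    congr 1
    · abel
    · rw [conjTranspose_mul, conjTranspose_conjTranspose, hS, add_zero, Matrix.mul_assoc, hBP]
    · rw [hT, hPB, add_zero]
    · rw [hT, hTT, add_zero]
  · intro v
    refine ⟨-((S * S * Bᴴ) *ᵥ v), ?_⟩
    rw [fromCols_mulVec_sumElim, mulVec_neg, mulVec_mulVec]
    rw [← Matrix.mul_assoc, ← Matrix.mul_assoc, hTS, hSTS, add_neg_cancel]

/-- By polarization each entry is a fixed combination of four values of the quadratic form. -/
theorem tendsto_of_tendsto_quadForm [DecidableEq n] {X : ℕ → Matrix n n ℂ}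
    (h : ∀ v, ∃ c, Tendsto (fun j => star v ⬝ᵥ X j *ᵥ v) atTop (𝓝 c)) :
    ∃ Y, Tendsto X atTop (𝓝 Y) := by
  choose q hq using h
  have : ∀ i j, ∃ c, Tendsto (fun r => X r i j) atTop (𝓝 c) := by
    intro i j
    · have h4 : ∀ r, X r i j = (1 / 4 : ℂ) * (4 * (star (Pi.single i (1 : ℂ)) ⬝ᵥ X r *ᵥ (Pi.single j 1))) := by
        intro r
        rw [← entry_eq_sesq]; ring
      simp only [h4, four_mul_sesq]
      exact ⟨_, ((((hq _).sub (hq _)).sub ((hq _).const_mul _)).add ((hq _).const_mul _)).const_mul _⟩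
  choose c hc using this
  exact ⟨Matrix.of c, tendsto_pi_nhds.2 fun i => tendsto_pi_nhds.2 fun j => hc i j⟩

theorem continuous_quadForm (v : n → ℂ) :
    Continuous fun X : Matrix n n ℂ => star v ⬝ᵥ X *ᵥ v := by fun_prop

/-- A monotone sequence of Hermitian matrices which is bounded (as forms) converges. -/
theorem exists_tendsto_of_monotone_bounded [DecidableEq n] {X : ℕ → Matrix n n ℂ}
    (hX : ∀ j, (X j).IsHermitian)
    (hmono : ∀ v, Monotone fun j => (star v ⬝ᵥ X j *ᵥ v).re)
    (hbdd : ∀ v, ∃ b, ∀ j, (star v ⬝ᵥ X j *ᵥ v).re ≤ b) :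
    ∃ Y, Tendsto X atTop (𝓝 Y) := by
  apply tendsto_of_tendsto_quadForm
  intro v
  obtain ⟨b, hb⟩ := hbdd v
  have := tendsto_atTop_ciSup (hmono v) ⟨b, by rintro _ ⟨j, rfl⟩; exact hb j⟩
  refine ⟨_, (Complex.continuous_ofReal.tendsto _ |>.comp this).congr fun j => ?_⟩
  exact ofReal_re_quadForm (hX j) v

end LinearAlgebra

/-! ### The discretized system and its storage function -/

section Storage

variable {n k : Type*} [Fintype n] [Fintype k] [DecidableEq n]

/-- The state `m` with `(1 + iA) m - i B u = x`. -/
noncomputable def midState (A : Matrix n n ℂ) (B : Matrix n k ℂ) (x : n → ℂ) (u : k → ℂ) : n → ℂ :=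
  (1 + Complex.I • A)⁻¹ *ᵥ (x + Complex.I • B *ᵥ u)

/-- One step of the Cayley discretization of the system with the matrices `A`, `B`. -/
noncomputable def nextState (A : Matrix n n ℂ) (B : Matrix n k ℂ) (x : n → ℂ) (u : k → ℂ) : n → ℂ :=
  (2 : ℂ) • midState A B x u - x

/-- The supply rate `4 Im u* (C m + D u)`. -/
noncomputable def supply (A : Matrix n n ℂ) (B : Matrix n k ℂ) (C : Matrix k n ℂ) (D : Matrix k k ℂ)
    (x : n → ℂ) (u : k → ℂ) : ℝ :=
  4 * (star u ⬝ᵥ (C *ᵥ midState A B x u + D *ᵥ u)).im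

/-- The trajectory of the discretized system. -/
noncomputable def traj (A : Matrix n n ℂ) (B : Matrix n k ℂ) (x : n → ℂ) (u : ℕ → k → ℂ) : ℕ → n → ℂ
  | 0 => x
  | j + 1 => nextState A B (traj A B x u j) (u j)

/-- The input sequence which starts with `v` and goes on with `u`. -/
def consInput {k : Type*} (v : k → ℂ) (u : ℕ → k → ℂ) : ℕ → k → ℂ
  | 0 => v
  | j + 1 => u j

/-- The supply accumulated along a trajectory. -/
noncomputable def totalSupply (A : Matrix n n ℂ) (B : Matrix n k ℂ) (C : Matrix k n ℂ)
    (D : Matrix k k ℂ) (x : n → ℂ) (u : ℕ → k → ℂ) (N : ℕ) : ℝ :=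
  ∑ j ∈ Finset.range N, supply A B C D (traj A B x u j) (u j)

/-- There is no proper `A`-invariant subspace which contains the range of `B`. -/
def Reachable (A : Matrix n n ℂ) (B : Matrix n k ℂ) : Prop :=
  ∀ W : Submodule ℂ (n → ℂ), (∀ u, B *ᵥ u ∈ W) → (∀ x ∈ W, A *ᵥ x ∈ W) → W = ⊤

variable {A : Matrix n n ℂ} {B : Matrix n k ℂ} {C : Matrix k n ℂ} {D : Matrix k k ℂ}

theorem midState_add (x x' : n → ℂ) (u u' : k → ℂ) :
    midState A B (x + x') (u + u') = midState A B x u + midState A B x' u' := by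
  simp only [midState, mulVec_add, smul_add]
  abel

theorem midState_smul (c : ℂ) (x : n → ℂ) (u : k → ℂ) :
    midState A B (c • x) (c • u) = c • midState A B x u := by
  simp only [midState, mulVec_add, mulVec_smul, smul_add, smul_comm c]

theorem nextState_add (x x' : n → ℂ) (u u' : k → ℂ) :
    nextState A B (x + x') (u + u') = nextState A B x u + nextState A B x' u' := by
  simp only [nextState, midState_add, smul_add]
  abel

theorem nextState_smul (c : ℂ) (x : n → ℂ) (u : k → ℂ) :
    nextState A B (c • x) (c • u) = c • nextState A B x u := by
  simp only [nextState, midState_smul, smul_sub, smul_comm c]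

theorem traj_add (x x' : n → ℂ) (u u' : ℕ → k → ℂ) (j : ℕ) :
    traj A B (x + x') (u + u') j = traj A B x u j + traj A B x' u' j := by
  induction j with
  | zero => rfl
  | succ j ih => simp only [traj, ih, Pi.add_apply, nextState_add]

theorem traj_smul (c : ℂ) (x : n → ℂ) (u : ℕ → k → ℂ) (j : ℕ) :
    traj A B (c • x) (c • u) j = c • traj A B x u j := by
  induction j with
  | zero => rfl
  | succ j ih => simp only [traj, ih, Pi.smul_apply, nextState_smul]

theorem supply_smul (c : ℂ) (x : n → ℂ) (u : k → ℂ) :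
    supply A B C D (c • x) (c • u) = ‖c‖ ^ 2 * supply A B C D x u := by
  simp only [supply, midState_smul, mulVec_smul, ← smul_add, star_smul, smul_dotProduct,
    dotProduct_smul, smul_eq_mul, ← mul_assoc, Complex.star_def, Complex.mul_conj']
  rw [← Complex.ofReal_pow, Complex.im_ofReal_mul]
  ring

theorem supply_parallelogram (x x' : n → ℂ) (u u' : k → ℂ) :
    supply A B C D (x + x') (u + u') + supply A B C D (x - x') (u - u') =
      2 * supply A B C D x u + 2 * supply A B C D x' u' := by
  have h : ∀ x x' u u', midState A B (x - x') (u - u') = midState A B x u - midState A B x' u' := by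
    intro x x' u u'
    have := midState_add (A := A) (B := B) (x - x') x' (u - u') u'
    rw [sub_add_cancel, sub_add_cancel] at this
    rw [this, add_sub_cancel_right]
  simp only [supply, midState_add, h, mulVec_add, mulVec_sub, star_add, star_sub, dotProduct_add,
    dotProduct_sub, add_dotProduct, sub_dotProduct, Complex.add_im, Complex.sub_im]
  ring

theorem supply_zero_right (x : n → ℂ) : supply A B C D x 0 = 0 := by simp [supply]

theorem totalSupply_smul (c : ℂ) (x : n → ℂ) (u : ℕ → k → ℂ) (N : ℕ) :
    totalSupply A B C D (c • x) (c • u) N = ‖c‖ ^ 2 * totalSupply A B C D x u N := by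
  simp only [totalSupply, traj_smul, Pi.smul_apply, supply_smul, Finset.mul_sum]

theorem traj_sub (x x' : n → ℂ) (u u' : ℕ → k → ℂ) (j : ℕ) :
    traj A B (x - x') (u - u') j = traj A B x u j - traj A B x' u' j := by
  have := traj_add (A := A) (B := B) (x - x') x' (u - u') u' j
  rw [sub_add_cancel, sub_add_cancel] at this
  rw [this, add_sub_cancel_right]

/-- The total supply is quadratic in the pair (state, input sequence), because trajectories depend
linearly on it. This law makes the states of finite storage closed under addition. -/
theorem totalSupply_parallelogram (x x' : n → ℂ) (u u' : ℕ → k → ℂ) (N : ℕ) :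
    totalSupply A B C D (x + x') (u + u') N + totalSupply A B C D (x - x') (u - u') N =
      2 * totalSupply A B C D x u N + 2 * totalSupply A B C D x' u' N := by
  simp only [totalSupply, traj_add, traj_sub, Pi.add_apply, Pi.sub_apply, ← Finset.sum_add_distrib,
    supply_parallelogram, Finset.mul_sum]

theorem totalSupply_zero_right (x : n → ℂ) (N : ℕ) : totalSupply A B C D x 0 N = 0 := by
  simp [totalSupply, supply_zero_right]

theorem traj_cons (x : n → ℂ) (v : k → ℂ) (u : ℕ → k → ℂ) (j : ℕ) :
    traj A B x (consInput v u) (j + 1) = traj A B (nextState A B x v) u j := by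
  induction j with
  | zero => rfl
  | succ j ih => rw [traj, ih]; rfl

theorem totalSupply_cons (x : n → ℂ) (v : k → ℂ) (u : ℕ → k → ℂ) (N : ℕ) :
    totalSupply A B C D x (consInput v u) (N + 1) =
      supply A B C D x v + totalSupply A B C D (nextState A B x v) u N := by
  rw [totalSupply, Finset.sum_range_succ', add_comm]
  simp only [traj_cons]
  rfl

variable (A B C D) in
/-- The states for which the available storage is finite. -/
def finiteStorage (hpos : ∀ u N, 0 ≤ totalSupply A B C D 0 u N) : Submodule ℂ (n → ℂ) where
  carrier := {x | ∃ b : ℝ, ∀ u N, -b ≤ totalSupply A B C D x u N}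
  zero_mem' := ⟨0, fun u N => by simpa using hpos u N⟩
  add_mem' := by
    rintro x y ⟨b, hb⟩ ⟨c, hc⟩
    refine ⟨2 * b + 2 * c, fun u N => ?_⟩
    -- Feeding u/2 to both states leaves the difference x - y with zero input, hence zero supply.
    -- The supply from x + y under u is then twice the sum of the two supplies under u/2.
    have := totalSupply_parallelogram (A := A) (B := B) (C := C) (D := D) x y
      ((1 / 2 : ℂ) • u) ((1 / 2 : ℂ) • u) N
    rw [← add_smul, sub_self, totalSupply_zero_right] at this
    norm_num at this
    have h1 := hb ((1 / 2 : ℂ) • u) N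
    have h2 := hc ((1 / 2 : ℂ) • u) N
    norm_num at h1 h2
    linarith
  smul_mem' := by
    rintro c x ⟨b, hb⟩
    rcases eq_or_ne c 0 with rfl | hc
    · exact ⟨0, fun u N => by simpa using hpos u N⟩
    · refine ⟨‖c‖ ^ 2 * b, fun u N => ?_⟩
      have : u = c • (c⁻¹ • u) := by rw [smul_smul, mul_inv_cancel₀ hc, one_smul]
      rw [this, totalSupply_smul]
      have := hb (c⁻¹ • u) N
      nlinarith [sq_nonneg ‖c‖]

/-- Prepending an input changes the supply by a constant, so these states are stable under every
step, and under `midState`, which is the average of x and x⁺. The subspace is therefore invariant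
under the resolvent of A, hence under A, and it contains the range of B. -/
theorem finiteStorage_eq_top (hA : IsUnit (1 + Complex.I • A).det) (hr : Reachable A B)
    (hpos : ∀ u N, 0 ≤ totalSupply A B C D 0 u N) : finiteStorage A B C D hpos = ⊤ := by
  set G := finiteStorage A B C D hpos
  have hnext : ∀ x ∈ G, ∀ v, nextState A B x v ∈ G := by
    rintro x ⟨b, hb⟩ v
    refine ⟨b + supply A B C D x v, fun u N => ?_⟩
    have := hb (consInput v u) (N + 1)
    rw [totalSupply_cons] at this
    linarith
  have hmid : ∀ x ∈ G, ∀ v, midState A B x v ∈ G := by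
    intro x hx v
    have h := G.smul_mem (1 / 2 : ℂ) (G.add_mem (hnext x hx v) hx)
    rw [nextState, sub_add_cancel, smul_smul] at h
    norm_num at h
    exact h
  set R := (1 + Complex.I • A)⁻¹
  have hRG : ∀ x ∈ G, R *ᵥ x ∈ G := by
    intro x hx
    have := hmid x hx 0
    simpa [midState] using this
  -- An injective endomorphism of the finite-dimensional space G is onto, so invariance under R
  -- passes to its inverse.
  have hinv : ∀ x ∈ G, (1 + Complex.I • A) *ᵥ x ∈ G := by
    have hinj : Function.Injective ((Matrix.toLin' R).restrict hRG) := by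
      intro x y hxy
      have h1 : R *ᵥ x.1 = R *ᵥ y.1 := congrArg Subtype.val hxy
      have h2 := congrArg ((1 + Complex.I • A) *ᵥ ·) h1
      simp only [mulVec_mulVec, R, Matrix.mul_nonsing_inv _ hA, one_mulVec] at h2
      exact Subtype.ext h2
    have hsurj := LinearMap.injective_iff_surjective.1 hinj
    intro x hx
    obtain ⟨y, hy⟩ := hsurj ⟨x, hx⟩
    have h1 : R *ᵥ y.1 = x := congrArg Subtype.val hy
    rw [← h1, mulVec_mulVec, Matrix.mul_nonsing_inv _ hA, one_mulVec]
    exact y.2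
  apply hr
  · intro u
    have h1 := hinv _ (hmid 0 G.zero_mem u)
    rw [midState, mulVec_mulVec, Matrix.mul_nonsing_inv _ hA, one_mulVec, zero_add] at h1
    have := G.smul_mem (-Complex.I) h1
    rwa [smul_smul, neg_mul, Complex.I_mul_I, neg_neg, one_smul] at this
  · intro x hx
    have h1 := G.smul_mem (-Complex.I) (G.sub_mem (hinv x hx) hx)
    rwa [add_mulVec, one_mulVec, add_sub_cancel_left, smul_mulVec, smul_smul, neg_mul,
      Complex.I_mul_I, neg_neg, one_smul] at h1

/-! ### Matrix form of the discretized step and of its supply rate -/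

variable (A B C D) in
/-- The matrix of the linear map `(x, u) ↦ m`. -/
noncomputable def midMatrix [DecidableEq k] : Matrix n (n ⊕ k) ℂ :=
  fromCols (1 + Complex.I • A)⁻¹ (Complex.I • ((1 + Complex.I • A)⁻¹ * B))

variable (A B) in
/-- The matrix of the linear map `(x, u) ↦ x⁺`. -/
noncomputable def nextMatrix [DecidableEq k] : Matrix n (n ⊕ k) ℂ :=
  (2 : ℂ) • midMatrix A B - fromCols 1 0

variable (A B C D) in
/-- The Hermitian matrix of the supply rate. -/
noncomputable def supplyMatrix [DecidableEq k] : Matrix (n ⊕ k) (n ⊕ k) ℂ :=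
  (-(2 * Complex.I)) • ((fromCols 0 1 : Matrix k (n ⊕ k) ℂ)ᴴ * (C * midMatrix A B + fromCols 0 D) -
    (C * midMatrix A B + fromCols 0 D)ᴴ * (fromCols 0 1 : Matrix k (n ⊕ k) ℂ))

variable [DecidableEq k]

theorem midMatrix_mulVec (x : n → ℂ) (u : k → ℂ) :
    midMatrix A B *ᵥ Sum.elim x u = midState A B x u := by
  rw [midMatrix, fromCols_mulVec_sumElim, midState, mulVec_add, smul_mulVec, mulVec_smul,
    mulVec_mulVec]

theorem nextMatrix_mulVec (x : n → ℂ) (u : k → ℂ) :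
    nextMatrix A B *ᵥ Sum.elim x u = nextState A B x u := by
  rw [nextMatrix, sub_mulVec, smul_mulVec, midMatrix_mulVec, fromCols_mulVec_sumElim, nextState]
  simp

theorem quadForm_conjTranspose_mul_mul {m l : Type*} [Fintype m] [Fintype l] (E F : Matrix m l ℂ)
    (X : Matrix m m ℂ) (v : l → ℂ) :
    star v ⬝ᵥ (Eᴴ * X * F) *ᵥ v = star (E *ᵥ v) ⬝ᵥ X *ᵥ (F *ᵥ v) := by
  rw [star_mulVec, ← mulVec_mulVec, ← mulVec_mulVec, ← dotProduct_mulVec]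

theorem supplyMatrix_isHermitian : (supplyMatrix A B C D).IsHermitian := by
  rw [IsHermitian, supplyMatrix]
  simp only [conjTranspose_smul, conjTranspose_sub, conjTranspose_mul, conjTranspose_conjTranspose]
  have : star (-(2 * Complex.I)) = 2 * Complex.I := by simp
  rw [this, neg_smul, ← smul_neg, neg_sub]

theorem re_quadForm_supplyMatrix (x : n → ℂ) (u : k → ℂ) :
    (star (Sum.elim x u) ⬝ᵥ supplyMatrix A B C D *ᵥ Sum.elim x u).re = supply A B C D x u := by
  have h0 : ∀ E F : Matrix k (n ⊕ k) ℂ, star (Sum.elim x u) ⬝ᵥ (Eᴴ * F) *ᵥ Sum.elim x u =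
      star (E *ᵥ Sum.elim x u) ⬝ᵥ (F *ᵥ Sum.elim x u) := by
    intro E F
    have := quadForm_conjTranspose_mul_mul E F 1 (Sum.elim x u)
    simpa using this
  have hU : (fromCols 0 1 : Matrix k (n ⊕ k) ℂ) *ᵥ Sum.elim x u = u := by
    rw [fromCols_mulVec_sumElim]; simp
  have hY : (C * midMatrix A B + fromCols 0 D) *ᵥ Sum.elim x u =
      C *ᵥ midState A B x u + D *ᵥ u := by
    rw [add_mulVec, ← mulVec_mulVec, midMatrix_mulVec, fromCols_mulVec_sumElim]; simp
  rw [supplyMatrix, smul_mulVec, sub_mulVec, dotProduct_smul, dotProduct_sub, h0, h0, hU, hY,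
    supply]
  set y := C *ᵥ midState A B x u + D *ᵥ u
  have : star y ⬝ᵥ u = star (star u ⬝ᵥ y) := by rw [← star_dotProduct_star, star_star]
  rw [this]
  simp
  ring

omit [Fintype k] [DecidableEq k] in
theorem fromBlocks_eq_compress (Y : Matrix n n ℂ) :
    (fromBlocks Y 0 0 0 : Matrix (n ⊕ k) (n ⊕ k) ℂ) =
      (fromCols 1 0 : Matrix n (n ⊕ k) ℂ)ᴴ * Y * (fromCols 1 0 : Matrix n (n ⊕ k) ℂ) := by
  rw [conjTranspose_fromCols_eq_fromRows_conjTranspose, fromRows_mul, fromRows_mul_fromCols]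
  simp

/-- The Bellman functional: minimizing the first two terms over u makes Y the storage with one step
more to go than X. For Y = X it is the defect in the dissipation inequality. -/
theorem re_quadForm_step (X Y : Matrix n n ℂ) (x : n → ℂ) (u : k → ℂ) :
    (star (Sum.elim x u) ⬝ᵥ (supplyMatrix A B C D - (nextMatrix A B)ᴴ * X * nextMatrix A B +
      fromBlocks Y 0 0 0) *ᵥ Sum.elim x u).re =
      supply A B C D x u - (star (nextState A B x u) ⬝ᵥ X *ᵥ nextState A B x u).re +
        (star x ⬝ᵥ Y *ᵥ x).re := by
  rw [fromBlocks_eq_compress, add_mulVec, sub_mulVec, dotProduct_add, dotProduct_sub,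
    Complex.add_re, Complex.sub_re, re_quadForm_supplyMatrix, quadForm_conjTranspose_mul_mul,
    quadForm_conjTranspose_mul_mul, nextMatrix_mulVec, fromCols_mulVec_sumElim]
  simp

/-- A bounded sequence of matrices has a convergent subsequence. -/
theorem exists_subseq_tendsto_of_bounded {m l : Type*} [Fintype m] [Fintype l]
    {K : ℕ → Matrix m l ℂ} (h : ∀ i j, ∃ b : ℝ, ∀ r, ‖K r i j‖ ≤ b) :
    ∃ (L : Matrix m l ℂ) (s : ℕ → ℕ), StrictMono s ∧ Tendsto (K ∘ s) atTop (𝓝 L) := by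
  choose b hb using h
  have hc : IsCompact (Set.univ.pi fun i => Set.univ.pi fun j =>
      Metric.closedBall (0 : ℂ) (b i j)) :=
    isCompact_univ_pi fun i => isCompact_univ_pi fun j => isCompact_closedBall _ _
  obtain ⟨L, -, s, hs, hL⟩ := hc.tendsto_subseq (x := fun r i j => K r i j)
    (fun r i _ j _ => by simpa using hb i j r)
  exact ⟨L, s, hs, hL⟩

/-- A positive storage matrix satisfying the dissipation identity with at most `k` output rows. -/
theorem exists_storage (hA : IsUnit (1 + Complex.I • A).det) (hr : Reachable A B)
    (hpos : ∀ u N, 0 ≤ totalSupply A B C D 0 u N) :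
    ∃ (X : Matrix n n ℂ) (K : Matrix k (n ⊕ k) ℂ), X.PosSemidef ∧
      supplyMatrix A B C D - (nextMatrix A B)ᴴ * X * nextMatrix A B + fromBlocks X 0 0 0 =
        Kᴴ * K := by
  have hfin : ∀ x, ∃ b : ℝ, ∀ u N, -b ≤ totalSupply A B C D x u N := by
    intro x
    have : x ∈ finiteStorage A B C D hpos := by rw [finiteStorage_eq_top hA hr]; trivial
    exact this
  -- Invariant of the value iteration: the cost -x*Xx is attained by an actual finite trajectory.
  -- With `hfin` this bounds every iterate from above, and bounds the next minimization from below.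
  let P : Matrix n n ℂ → Prop := fun X => X.IsHermitian ∧
    ∀ x, ∃ u N, -(star x ⬝ᵥ X *ᵥ x).re = totalSupply A B C D x u N
  have hstep : ∀ X : {X // P X}, ∃ (Y : {Y // P Y}) (K : Matrix k (n ⊕ k) ℂ),
      supplyMatrix A B C D - (nextMatrix A B)ᴴ * X.1 * nextMatrix A B + fromBlocks Y.1 0 0 0 =
        Kᴴ * K ∧ ∀ x, ∃ u, K *ᵥ Sum.elim x u = 0 := by
    rintro ⟨X, hX, hXc⟩
    have hcost : ∀ x u, ∃ v N, supply A B C D x u -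
        (star (nextState A B x u) ⬝ᵥ X *ᵥ nextState A B x u).re = totalSupply A B C D x v N := by
      intro x u
      obtain ⟨v, N, h⟩ := hXc (nextState A B x u)
      exact ⟨_, N + 1, by rw [totalSupply_cons x u v N, ← h]; ring⟩
    obtain ⟨Y, K, hY, hK, hmin⟩ := exists_partial_min
      (Q := supplyMatrix A B C D - (nextMatrix A B)ᴴ * X * nextMatrix A B)
      (supplyMatrix_isHermitian.sub (isHermitian_conjTranspose_mul_mul _ hX)) (by
        intro x
        obtain ⟨b, hb⟩ := hfin x
        refine ⟨b, fun u => ?_⟩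
        have h0 := re_quadForm_step (A := A) (B := B) (C := C) (D := D) X 0 x u
        rw [fromBlocks_zero, add_zero] at h0
        rw [h0]
        obtain ⟨v, N, h⟩ := hcost x u
        simpa [h] using hb v N)
    refine ⟨⟨Y, hY, fun x => ?_⟩, K, hK, hmin⟩
    obtain ⟨u, hu⟩ := hmin x
    obtain ⟨v, N, h⟩ := hcost x u
    refine ⟨v, N, ?_⟩
    rw [← h]
    have h0 := re_quadForm_step (A := A) (B := B) (C := C) (D := D) X Y x u
    rw [hK, quadForm_conjTranspose_mul_self, hu] at h0
    simp at h0
    linarith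
  choose f K hK hmin using hstep
  have hP0 : P 0 := ⟨isHermitian_zero, fun x => ⟨0, 0, by simp [totalSupply]⟩⟩
  let s : ℕ → {X // P X} := fun j => f^[j] ⟨0, hP0⟩
  have hs : ∀ j, s (j + 1) = f (s j) := fun j => Function.iterate_succ_apply' f j _
  let q : ℕ → (n → ℂ) → ℝ := fun j x => (star x ⬝ᵥ (s j).1 *ᵥ x).re
  have hq0 : ∀ x, q 0 x = 0 := fun x => by simp [q, s]
  -- With `hqeq` below this is Bellman's equation: q (j + 1) x is the maximum over u of q j (x⁺)
  -- minus the supply.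
  have hqle : ∀ j x u, q j (nextState A B x u) - supply A B C D x u ≤ q (j + 1) x := by
    intro j x u
    have h0 := re_quadForm_step (A := A) (B := B) (C := C) (D := D) (s j).1 (f (s j)).1 x u
    rw [hK, quadForm_conjTranspose_mul_self, Complex.ofReal_re, ← hs] at h0
    have : 0 ≤ ∑ i, ‖(K (s j) *ᵥ Sum.elim x u) i‖ ^ 2 := by positivity
    simp only [q]
    linarith
  have hqeq : ∀ j x, ∃ u, q j (nextState A B x u) - supply A B C D x u = q (j + 1) x := by
    intro j x
    obtain ⟨u, hu⟩ := hmin (s j) x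
    refine ⟨u, ?_⟩
    have h0 := re_quadForm_step (A := A) (B := B) (C := C) (D := D) (s j).1 (f (s j)).1 x u
    rw [hK, quadForm_conjTranspose_mul_self, Complex.ofReal_re, ← hs, hu] at h0
    simp at h0
    simp only [q]
    linarith
  have hmono : ∀ x, Monotone fun j => q j x := by
    have : ∀ j x, q j x ≤ q (j + 1) x := by
      intro j
      induction j with
      | zero =>
        intro x
        -- The zero input is free, so the first iterate is nonnegative; Bellman's equation
        -- propagates the inequality to all later ones.
        have := hqle 0 x 0
        rw [supply_zero_right, hq0] at this
        rw [hq0]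
        linarith
      | succ j ih =>
        intro x
        obtain ⟨u, hu⟩ := hqeq j x
        have h1 := hqle (j + 1) x u
        have h2 := ih (nextState A B x u)
        linarith
    exact fun x => monotone_nat_of_le_succ fun j => this j x
  obtain ⟨X, hX⟩ := exists_tendsto_of_monotone_bounded (X := fun j => (s j).1)
    (fun j => (s j).2.1) hmono (by
      intro x
      obtain ⟨b, hb⟩ := hfin x
      refine ⟨b, fun j => ?_⟩
      obtain ⟨u, N, h⟩ := (s j).2.2 x
      have := hb u N
      rw [← h] at this
      linarith)
  have hXpsd : X.PosSemidef := by
    refine posSemidef_of_re_nonneg ?_ fun x => ?_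
    · have h1 : Tendsto (fun j => (s j).1ᴴ) atTop (𝓝 Xᴴ) :=
        (continuous_id.matrix_conjTranspose.tendsto X).comp hX
      refine tendsto_nhds_unique h1 (hX.congr fun j => ((s j).2.1).symm)
    · have h1 : Tendsto (fun j => q j x) atTop (𝓝 (star x ⬝ᵥ X *ᵥ x).re) :=
        ((Complex.continuous_re.comp (continuous_quadForm x)).tendsto X).comp hX
      refine ge_of_tendsto h1 (Eventually.of_forall fun j => ?_)
      rw [← hq0 x]
      exact hmono x (Nat.zero_le j)
  let Φ : Matrix n n ℂ × Matrix n n ℂ → Matrix (n ⊕ k) (n ⊕ k) ℂ := fun Z =>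
    supplyMatrix A B C D - (nextMatrix A B)ᴴ * Z.1 * nextMatrix A B + fromBlocks Z.2 0 0 0
  have hΦ : Continuous Φ := by
    have : Continuous fun Z : Matrix n n ℂ × Matrix n n ℂ =>
        (fromBlocks Z.2 0 0 0 : Matrix (n ⊕ k) (n ⊕ k) ℂ) :=
      continuous_snd.matrix_fromBlocks continuous_const continuous_const continuous_const
    fun_prop
  have hlim : Tendsto (fun j => (K (s j))ᴴ * K (s j)) atTop (𝓝 (Φ (X, X))) := by
    have h1 : Tendsto (fun j => ((s j).1, (s (j + 1)).1)) atTop (𝓝 (X, X)) :=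
      hX.prodMk_nhds (hX.comp (tendsto_add_atTop_nat 1))
    refine ((hΦ.tendsto _).comp h1).congr fun j => ?_
    rw [← hK, ← hs]
    rfl
  -- Only K*K is known to converge; K is determined by it only up to a unitary. Its diagonal bounds
  -- the columns of K, so a subsequence converges, and the limit still has `k` rows.
  obtain ⟨L, t, ht, hL⟩ := exists_subseq_tendsto_of_bounded (K := fun j => K (s j)) (by
    intro i j
    have h1 : Tendsto (fun r => ((K (s r))ᴴ * K (s r)) j j) atTop (𝓝 (Φ (X, X) j j)) :=
      (tendsto_pi_nhds.1 (tendsto_pi_nhds.1 hlim j)) j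
    obtain ⟨b, hb⟩ := h1.norm.bddAbove_range
    refine ⟨√b, fun r => Real.le_sqrt_of_sq_le ?_⟩
    have h2 : ‖((K (s r))ᴴ * K (s r)) j j‖ ≤ b := hb ⟨r, rfl⟩
    refine le_trans ?_ h2
    have h3 : ((K (s r))ᴴ * K (s r)) j j = ((∑ i, ‖K (s r) i j‖ ^ 2 : ℝ) : ℂ) := by
      simp [mul_apply, Complex.conj_mul']
    rw [h3, Complex.norm_real, Real.norm_of_nonneg (by positivity)]
    exact Finset.single_le_sum (f := fun i => ‖K (s r) i j‖ ^ 2) (fun _ _ => by positivity)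
      (Finset.mem_univ i))
  refine ⟨X, L, hXpsd, ?_⟩
  have h1 : Tendsto (fun r => (K (s (t r)))ᴴ * K (s (t r))) atTop (𝓝 (Lᴴ * L)) := by
    have : Continuous fun K : Matrix k (n ⊕ k) ℂ => Kᴴ * K := by fun_prop
    exact (this.tendsto L).comp hL
  exact tendsto_nhds_unique (hlim.comp ht.tendsto_atTop) h1

end Storage

/-! ### From the storage matrix to the Riccati equation and a dissipative state matrix -/

section Riccati

variable {n k : Type*} [Fintype n] [Fintype k] [DecidableEq n] [DecidableEq k]
  {A : Matrix n n ℂ} {B : Matrix n k ℂ} {C : Matrix k n ℂ}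

theorem congr_conjTranspose_mul_mul {l m : Type*} [Fintype l] [Fintype m] {o : Type*} [Fintype o]
    (G : Matrix l o ℂ) (E F : Matrix m l ℂ)
    (X : Matrix m m ℂ) : Gᴴ * (Eᴴ * X * F) * G = (E * G)ᴴ * X * (F * G) := by
  simp only [conjTranspose_mul, Matrix.mul_assoc]

/-- In the coordinates (m, u) the defect has blocks 2i(XA - A*X), 2i(C* - XB) and 2Δ. It factors
through a K = [K₁ K₂] whose block K₂ is square and invertible, so the Schur complement of 2Δ is
zero, which is the Riccati equation. -/
theorem riccati_of_storage (hA : IsUnit (1 + Complex.I • A).det) {Δ : Matrix k k ℂ}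
    (hΔ : Δᴴ = Δ) (hΔu : IsUnit Δ.det) {X : Matrix n n ℂ} {K : Matrix k (n ⊕ k) ℂ}
    (hK : supplyMatrix A B C ((Complex.I / 2) • Δ) - (nextMatrix A B)ᴴ * X * nextMatrix A B +
      fromBlocks X 0 0 0 = Kᴴ * K) :
    Complex.I • (X * A - Aᴴ * X) = (Cᴴ - X * B) * Δ⁻¹ * (C - Bᴴ * X) := by
  -- Change of variables from (m, u) to (x, u), where x = (1 + iA)m - iBu; it removes the resolvent
  -- from all blocks, and x⁺ becomes (1 - iA)m + iBu.
  let G : Matrix (n ⊕ k) (n ⊕ k) ℂ :=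
    fromBlocks (1 + Complex.I • A) (-(Complex.I • B)) 0 1
  have hmid : midMatrix A B * G = fromCols 1 0 := by
    rw [midMatrix, fromCols_mul_fromBlocks, nonsing_inv_mul _ hA]
    simp
  have hone : (fromCols 1 0 : Matrix n (n ⊕ k) ℂ) * G =
      fromCols (1 + Complex.I • A) (-(Complex.I • B)) := by
    rw [fromCols_mul_fromBlocks]
    simp
  have hin : (fromCols 0 1 : Matrix k (n ⊕ k) ℂ) * G = fromCols 0 1 := by
    rw [fromCols_mul_fromBlocks]
    simp
  have hnext : nextMatrix A B * G = fromCols (1 - Complex.I • A) (Complex.I • B) := by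
    rw [nextMatrix, Matrix.sub_mul, Matrix.smul_mul, hmid, hone]
    ext i j
    rcases j with j | j
    · simp; ring
    · simp
  have hout : (C * midMatrix A B + fromCols 0 ((Complex.I / 2) • Δ)) * G =
      fromCols C ((Complex.I / 2) • Δ) := by
    rw [Matrix.add_mul, Matrix.mul_assoc, hmid, fromCols_mul_fromBlocks, mul_fromCols]
    ext i j
    rcases j with j | j <;> simp
  obtain ⟨K₁, K₂, hKG⟩ : ∃ K₁ K₂, K * G = fromCols K₁ K₂ :=
    ⟨_, _, (fromCols_toCols (K * G)).symm⟩
  have h := congrArg (fun M => Gᴴ * M * G) hK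
  simp only [Matrix.mul_add, Matrix.add_mul, Matrix.mul_sub, Matrix.sub_mul] at h
  have e1 : Gᴴ * (Kᴴ * K) * G = fromBlocks (K₁ᴴ * K₁) (K₁ᴴ * K₂) (K₂ᴴ * K₁) (K₂ᴴ * K₂) := by
    have := congr_conjTranspose_mul_mul G K K 1
    simp only [Matrix.mul_one] at this
    rw [this, hKG, conjTranspose_fromCols_eq_fromRows_conjTranspose, fromRows_mul_fromCols]
  have e2 : Gᴴ * ((nextMatrix A B)ᴴ * X * nextMatrix A B) * G =
      fromBlocks ((1 - Complex.I • A)ᴴ * X * (1 - Complex.I • A))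
        ((1 - Complex.I • A)ᴴ * X * (Complex.I • B)) ((Complex.I • B)ᴴ * X * (1 - Complex.I • A))
        ((Complex.I • B)ᴴ * X * (Complex.I • B)) := by
    rw [congr_conjTranspose_mul_mul, hnext, conjTranspose_fromCols_eq_fromRows_conjTranspose,
      fromRows_mul, fromRows_mul_fromCols]
  have e3 : Gᴴ * fromBlocks X 0 0 0 * G =
      fromBlocks ((1 + Complex.I • A)ᴴ * X * (1 + Complex.I • A))
        ((1 + Complex.I • A)ᴴ * X * (-(Complex.I • B)))
        ((-(Complex.I • B))ᴴ * X * (1 + Complex.I • A))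
        ((-(Complex.I • B))ᴴ * X * (-(Complex.I • B))) := by
    rw [fromBlocks_eq_compress, congr_conjTranspose_mul_mul, hone,
      conjTranspose_fromCols_eq_fromRows_conjTranspose, fromRows_mul, fromRows_mul_fromCols]
  have e4 : Gᴴ * supplyMatrix A B C ((Complex.I / 2) • Δ) * G =
      fromBlocks 0 ((2 * Complex.I) • Cᴴ) (-(2 * Complex.I) • C) ((2 : ℂ) • Δ) := by
    have a1 := congr_conjTranspose_mul_mul G (fromCols 0 1 : Matrix k (n ⊕ k) ℂ)
      (C * midMatrix A B + fromCols 0 ((Complex.I / 2) • Δ)) 1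
    have a2 := congr_conjTranspose_mul_mul G
      (C * midMatrix A B + fromCols 0 ((Complex.I / 2) • Δ)) (fromCols 0 1 : Matrix k (n ⊕ k) ℂ) 1
    rw [Matrix.mul_one] at a1 a2
    rw [hin, hout, Matrix.mul_one] at a1 a2
    rw [supplyMatrix, Matrix.mul_smul, Matrix.smul_mul, Matrix.mul_sub, Matrix.sub_mul, a1, a2,
      conjTranspose_fromCols_eq_fromRows_conjTranspose,
      conjTranspose_fromCols_eq_fromRows_conjTranspose, fromRows_mul_fromCols,
      fromRows_mul_fromCols, conjTranspose_smul, hΔ]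
    ext i j
    rcases i with i | i <;> rcases j with j | j <;> simp
    linear_combination (-2 * Δ i j) * Complex.I_mul_I
  rw [e1, e2, e3, e4, sub_eq_add_neg, fromBlocks_neg, fromBlocks_add, fromBlocks_add,
    fromBlocks_inj] at h
  obtain ⟨h11, h12, h21, h22⟩ := h
  have I2 : Complex.I * Complex.I = -1 := Complex.I_mul_I
  simp only [conjTranspose_sub, conjTranspose_add, conjTranspose_one, conjTranspose_smul,
    Matrix.mul_add, Matrix.add_mul, Matrix.mul_sub, Matrix.sub_mul, Matrix.smul_mul,
    Matrix.mul_smul, Matrix.one_mul, Matrix.mul_one, smul_smul, conjTranspose_neg, Matrix.mul_neg,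
    Matrix.neg_mul, Complex.star_def, Complex.conj_I, smul_add, smul_sub] at h11 h12 h21 h22
  have k11 : K₁ᴴ * K₁ = (2 * Complex.I) • (X * A - Aᴴ * X) := by
    rw [← h11]; module
  have k12 : K₁ᴴ * K₂ = (2 * Complex.I) • (Cᴴ - X * B) := by
    rw [← h12]; module
  have k21 : K₂ᴴ * K₁ = (-(2 * Complex.I)) • (C - Bᴴ * X) := by
    rw [← h21]; module
  have k22 : K₂ᴴ * K₂ = (2 : ℂ) • Δ := by
    rw [← h22]; module
  -- Here the number of rows of K matters: K₂ is square with invertible Gram matrix 2Δ, so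
  -- K₂(K₂*K₂)⁻¹K₂* is the identity and not merely a projection.
  have hK2 : IsUnit K₂.det := by
    have h3 : IsUnit (K₂ᴴ * K₂).det := by
      rw [k22, det_smul]
      exact (IsUnit.mk0 _ (by positivity)).mul hΔu
    rw [det_mul] at h3
    exact isUnit_of_mul_isUnit_right h3
  have hK2' : IsUnit K₂ᴴ.det := by
    rw [det_conjTranspose]
    exact hK2.star
  have hinv : K₂ * ((1 / 2 : ℂ) • Δ⁻¹) * K₂ᴴ = 1 := by
    have h4 : (1 / 2 : ℂ) • Δ⁻¹ = K₂⁻¹ * (K₂ᴴ)⁻¹ := by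
      rw [← Matrix.mul_inv_rev, k22]
      symm
      apply inv_eq_left_inv
      rw [Matrix.smul_mul, Matrix.mul_smul, smul_smul, nonsing_inv_mul _ hΔu]
      norm_num
    rw [h4, Matrix.mul_assoc, Matrix.mul_assoc, nonsing_inv_mul _ hK2', Matrix.mul_one,
      mul_nonsing_inv _ hK2]
  have h5 : K₁ᴴ * K₁ = (K₁ᴴ * K₂) * ((1 / 2 : ℂ) • Δ⁻¹) * (K₂ᴴ * K₁) := by
    calc K₁ᴴ * K₁ = K₁ᴴ * (K₂ * ((1 / 2 : ℂ) • Δ⁻¹) * K₂ᴴ) * K₁ := by rw [hinv, Matrix.mul_one]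
      _ = _ := by simp only [Matrix.mul_assoc]
  rw [k11, k12, k21, Matrix.smul_mul, Matrix.smul_mul, Matrix.mul_smul, Matrix.mul_smul,
    Matrix.smul_mul, smul_smul, smul_smul] at h5
  have h8 : (2 : ℂ) • (Complex.I • (X * A - Aᴴ * X)) =
      (2 : ℂ) • ((Cᴴ - X * B) * Δ⁻¹ * (C - Bᴴ * X)) := by
    rw [smul_smul, h5]
    congr 1
    linear_combination (-2) * I2
  exact smul_right_injective _ (two_ne_zero) h8

/-- A positive semidefinite solution of the Riccati equation yields a realization with a
dissipative state matrix. -/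
theorem exists_dissipative_realization {X : Matrix n n ℂ} (hX : X.PosSemidef) {E : Matrix k k ℂ}
    (hE : IsUnit E.det)
    (hR : Complex.I • (X * A - Aᴴ * X) = (Cᴴ - X * B) * (Eᴴ * E) * (C - Bᴴ * X)) :
    ∃ (Ψ₁ Ψ₂ : Matrix n k ℂ) (γ : Matrix n n ℂ),
      γ - γᴴ = -(Complex.I • ((Ψ₁ - Ψ₂) * (Eᴴ * E) * (Ψ₁ - Ψ₂)ᴴ)) ∧
      ∀ (z : ℂ) (Z : Matrix n k ℂ), (A - z • (1 : Matrix n n ℂ)) * Z = B →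
        ∃ Z' : Matrix n k ℂ, (γ - z • (1 : Matrix n n ℂ)) * Z' = Ψ₂ ∧ Ψ₁ᴴ * Z' = C * Z := by
  obtain ⟨T, S, hT, hS, hTT, hTS, hTST, hSTS⟩ := exists_sqrt_pinv hX
  have hSTT : S * X = T := by rw [← hTT, ← Matrix.mul_assoc, ← hTS, hTST]
  have hTTS : X * S = T := by rw [← hTT, Matrix.mul_assoc, hTS, ← Matrix.mul_assoc, hTST]
  have hXH : Xᴴ = X := hX.1
  -- N projects onto the kernel of X. The next facts show that C kills this kernel and that A maps
  -- it into itself, so the realization descends to the quotient by it.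
  obtain ⟨N, hNdef⟩ : ∃ N, N = 1 - S * T := ⟨_, rfl⟩
  have hXN : X * N = 0 := by
    rw [hNdef, Matrix.mul_sub, Matrix.mul_one, ← Matrix.mul_assoc, hTTS, hTT, sub_self]
  have hNX : Nᴴ * X = 0 := by rw [← hXH, ← conjTranspose_mul, hXN, conjTranspose_zero]
  -- Compressing the Riccati equation by N kills its left side and leaves (ECN)*(ECN) on the right.
  have hCN : C * N = 0 := by
    have h1 : Nᴴ * (Complex.I • (X * A - Aᴴ * X)) * N = 0 := by
      rw [Matrix.mul_smul, Matrix.mul_sub, ← Matrix.mul_assoc, hNX, Matrix.smul_mul,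
        Matrix.sub_mul, Matrix.zero_mul, Matrix.zero_mul, Matrix.mul_assoc, Matrix.mul_assoc, hXN]
      simp
    rw [hR] at h1
    have h2 : (E * (C * N))ᴴ * (E * (C * N)) = 0 := by
      rw [← h1]
      have a1 : (C - Bᴴ * X) * N = C * N := by
        rw [Matrix.sub_mul, Matrix.mul_assoc, hXN, Matrix.mul_zero, sub_zero]
      have a2 : Nᴴ * (Cᴴ - X * B) = (C * N)ᴴ := by
        rw [Matrix.mul_sub, ← Matrix.mul_assoc, hNX, Matrix.zero_mul, sub_zero, conjTranspose_mul]
      calc _ = (C * N)ᴴ * (Eᴴ * E) * (C * N) := by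
            simp only [conjTranspose_mul, Matrix.mul_assoc]
        _ = _ := by rw [← a2, ← a1]; simp only [Matrix.mul_assoc]
    rw [conjTranspose_mul_self_eq_zero] at h2
    have h3 := congrArg (E⁻¹ * ·) h2
    simpa [← Matrix.mul_assoc, nonsing_inv_mul _ hE] using h3
  have hTAN : T * A * N = 0 := by
    have h1 := congrArg (· * N) hR
    simp only [Matrix.smul_mul, Matrix.sub_mul, Matrix.mul_assoc, hXN, hCN, Matrix.mul_zero,
      sub_zero] at h1
    have h2 : X * (A * N) = 0 := by simpa using h1
    rw [← hSTT, Matrix.mul_assoc, Matrix.mul_assoc, h2, Matrix.mul_zero]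
  -- The state √X·x replaces x, with S as generalized inverse of T = √X; multiplying the Riccati
  -- equation by S on both sides gives the identity for γ - γ*.
  refine ⟨S * Cᴴ, T * B, T * A * S, ?_, ?_⟩
  · have h1 : T * A * S - (T * A * S)ᴴ = S * (X * A - Aᴴ * X) * S := by
      rw [conjTranspose_mul, conjTranspose_mul, hS, hT, Matrix.mul_sub, Matrix.sub_mul,
        ← Matrix.mul_assoc S X, hSTT]
      simp only [Matrix.mul_assoc]
      rw [hTTS]
    have h2 : S * Cᴴ - T * B = S * (Cᴴ - X * B) := by
      rw [Matrix.mul_sub, ← Matrix.mul_assoc, hSTT]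
    have h3 : (S * Cᴴ - T * B)ᴴ = (C - Bᴴ * X) * S := by
      rw [h2, conjTranspose_mul, conjTranspose_sub, conjTranspose_mul, conjTranspose_conjTranspose,
        hXH, hS]
    have h4 : S * (Complex.I • (X * A - Aᴴ * X)) * S =
        (S * Cᴴ - T * B) * (Eᴴ * E) * (S * Cᴴ - T * B)ᴴ := by
      rw [hR, h3, h2]
      simp only [Matrix.mul_assoc]
    rw [h1, ← h4, Matrix.mul_smul, Matrix.smul_mul, smul_smul, Complex.I_mul_I, neg_one_smul,
      neg_neg]
  · intro z Z hZ
    have hN : ∀ M : Matrix n k ℂ, S * (T * M) = M - N * M := by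
      intro M
      rw [hNdef, Matrix.sub_mul, Matrix.one_mul, Matrix.mul_assoc, sub_sub_cancel]
    refine ⟨T * Z, ?_, ?_⟩
    · rw [← hZ, Matrix.sub_mul, Matrix.sub_mul, Matrix.mul_sub, Matrix.mul_assoc (T * A), hN,
        Matrix.mul_sub, ← Matrix.mul_assoc (T * A) N, hTAN]
      simp [Matrix.mul_assoc]
    · rw [conjTranspose_mul, conjTranspose_conjTranspose, hS, Matrix.mul_assoc, hN, Matrix.mul_sub,
        ← Matrix.mul_assoc, hCN]
      simp

end Riccati

/-! ### Holomorphic matrix functions -/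

section Differentiable

variable {n : Type*} [Fintype n] [DecidableEq n] {𝕜 : Type*} [NontriviallyNormedField 𝕜]
  [NormedAlgebra 𝕜 ℂ]

theorem differentiableOn_det {s : Set 𝕜} {M : 𝕜 → Matrix n n ℂ}
    (h : ∀ i j, DifferentiableOn 𝕜 (fun z => M z i j) s) :
    DifferentiableOn 𝕜 (fun z => (M z).det) s := by
  simp only [det_apply']
  exact DifferentiableOn.fun_sum fun σ _ =>
    (DifferentiableOn.fun_finsetProd fun i _ => h _ _).const_mul _

/-- Cramer's rule. The field is left general because the lemma serves both resolvents in a complex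
variable and inverses along the real half-line. -/
theorem differentiableOn_inv_apply {s : Set 𝕜} {M : 𝕜 → Matrix n n ℂ}
    (h : ∀ i j, DifferentiableOn 𝕜 (fun z => M z i j) s) (hM : ∀ z ∈ s, (M z).det ≠ 0) (i j : n) :
    DifferentiableOn 𝕜 (fun z => (M z)⁻¹ i j) s := by
  simp only [inv_def, Matrix.smul_apply, smul_eq_mul, Ring.inverse_eq_inv', adjugate_apply]
  refine ((differentiableOn_det h).inv hM).mul (differentiableOn_det fun a b => ?_)
  simp only [updateRow_apply]
  split_ifs
  · exact differentiableOn_const _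
  · exact h a b

end Differentiable

/-! ### Passivity of the discretized system -/

section Passivity

open Complex Metric Real

/-- The conjugate of the mean value property of z ^ i at the centre. -/
theorem circleAverage_conj_pow {r : ℝ} {i : ℕ} (hi : i ≠ 0) :
    circleAverage (fun z : ℂ => (starRingEnd ℂ z) ^ i) 0 r = 0 := by
  have h1 : circleAverage (fun z : ℂ => z ^ i) 0 r = 0 := by
    rw [DiffContOnCl.circleAverage]
    · simp [hi]
    · exact (differentiable_id.pow i).diffContOnCl
  have h2 := (Complex.conjCLE : ℂ →L[ℝ] ℂ).circleAverage_comp_comm (f := fun z : ℂ => z ^ i)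
    (c := 0) (R := r) (ContinuousOn.circleIntegrable' (by fun_prop))
  rw [h1] at h2
  simpa [Function.comp_def] using h2

/-- The `j`-th Taylor coefficient as a mean value over a circle. -/
theorem circleAverage_conj_pow_mul {r : ℝ} (hr : 0 < r) (j : ℕ) (a : ℕ → ℂ) {f g : ℂ → ℂ}
    (hg : DifferentiableOn ℂ g (closedBall 0 r))
    (hf : ∀ z ∈ sphere (0 : ℂ) r, f z = ∑ i ∈ Finset.range (j + 1), z ^ i * a i + z ^ (j + 1) * g z) :
    circleAverage (fun z : ℂ => (starRingEnd ℂ z) ^ j * f z) 0 r = (r : ℂ) ^ (2 * j) * a j := by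
  have hsph : sphere (0 : ℂ) |r| = sphere 0 r := by rw [abs_of_pos hr]
  have hzz : ∀ z ∈ sphere (0 : ℂ) r, ∀ i : ℕ, (starRingEnd ℂ z) ^ i * z ^ i = (r : ℂ) ^ (2 * i) := by
    intro z hz i
    rw [← mul_pow, Complex.conj_mul', pow_mul]
    simp only [mem_sphere_zero_iff_norm] at hz
    rw [hz]
  have hcg : ContinuousOn g (sphere (0 : ℂ) |r|) := by
    rw [hsph]; exact hg.continuousOn.mono sphere_subset_closedBall
  -- On the circle, powers below j turn into positive powers of the conjugate, which average to
  -- zero. What remains is holomorphic with value a j at the centre.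
  have e1 : circleAverage (fun z : ℂ => (starRingEnd ℂ z) ^ j * f z) 0 r =
      circleAverage (fun z : ℂ => ∑ i ∈ Finset.range j,
        ((r : ℂ) ^ (2 * i) * a i) • (starRingEnd ℂ z) ^ (j - i) +
        (r : ℂ) ^ (2 * j) • (a j + z * g z)) 0 r := by
    apply circleAverage_congr_sphere
    intro z hz
    rw [hsph] at hz
    simp only [smul_eq_mul]
    rw [hf z hz, Finset.sum_range_succ, mul_add, mul_add, Finset.mul_sum, mul_add, ← hzz z hz j,
      add_assoc]
    congr 1
    · refine Finset.sum_congr rfl fun i hi => ?_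
      rw [Finset.mem_range] at hi
      rw [← hzz z hz i]
      nth_rewrite 1 [show j = (j - i) + i by omega]
      rw [pow_add]
      ring
    · ring
  rw [e1, circleAverage_fun_add, circleAverage_fun_sum, circleAverage_fun_smul]
  · have hm : circleAverage (fun z : ℂ => a j + z * g z) 0 r = a j := by
      rw [DiffContOnCl.circleAverage]
      · simp
      · rw [abs_of_pos hr]
        refine DifferentiableOn.diffContOnCl ?_
        rw [closure_ball _ hr.ne']
        exact (differentiableOn_const _).add (differentiableOn_id.mul hg)
    rw [hm, Finset.sum_eq_zero, zero_add, smul_eq_mul]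
    intro i hi
    rw [Finset.mem_range] at hi
    rw [circleAverage_fun_smul, circleAverage_conj_pow (by omega), smul_zero]
  · intro i _
    refine ContinuousOn.circleIntegrable' (ContinuousOn.fun_const_smul ?_ _)
    exact (Complex.continuous_conj.pow _).continuousOn
  · refine ContinuousOn.circleIntegrable' ?_
    refine continuousOn_finsetSum _ fun i _ => ContinuousOn.fun_const_smul ?_ _
    exact (Complex.continuous_conj.pow _).continuousOn
  · refine ContinuousOn.circleIntegrable' (ContinuousOn.fun_const_smul ?_ _)
    exact continuousOn_const.add (continuousOn_id.mul hcg)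

variable {n k : Type*} [Fintype n] [Fintype k] [DecidableEq n]
  {A : Matrix n n ℂ} {B : Matrix n k ℂ} {C : Matrix k n ℂ} {D : Matrix k k ℂ}

/-- The generating function of the states of a trajectory starting from zero. -/
theorem mulVec_sum_midState (hA : IsUnit (1 + Complex.I • A).det) (u : ℕ → k → ℂ) (N : ℕ) (l : ℂ) :
    ((1 + l) • A - (I * (1 - l)) • (1 : Matrix n n ℂ)) *ᵥ
        (∑ j ∈ Finset.range N, l ^ j • midState A B (traj A B 0 u j) (u j)) =
      (1 + l) • B *ᵥ (∑ j ∈ Finset.range N, l ^ j • u j) + (I * l ^ N) • traj A B 0 u N := by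
  induction N with
  | zero => simp [traj]
  | succ N ih =>
    rw [Finset.sum_range_succ, mulVec_add, ih, Finset.sum_range_succ, mulVec_add, traj, nextState]
    set m := midState A B (traj A B 0 u N) (u N)
    have hx : traj A B 0 u N = m + I • A *ᵥ m - I • B *ᵥ u N := by
      have : (1 + Complex.I • A) *ᵥ m = traj A B 0 u N + I • B *ᵥ u N := by
        simp only [m]
        rw [midState, mulVec_mulVec, mul_nonsing_inv _ hA, one_mulVec]
      rw [add_mulVec, one_mulVec, smul_mulVec] at this
      rw [this, add_sub_cancel_right]
    rw [hx]
    simp only [sub_mulVec, smul_mulVec, one_mulVec, mulVec_smul]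
    ext i
    simp only [Pi.add_apply, Pi.sub_apply, Pi.smul_apply, smul_eq_mul, pow_succ]
    linear_combination (l ^ N * ((A *ᵥ m) i - (B *ᵥ u N) i + l * ((A *ᵥ m) i - (B *ᵥ u N) i))) * I_mul_I

/-- The imaginary part equals (1 - |l|²)/|1 + l|². -/
theorem im_cayley_pos {l : ℂ} (hl : ‖l‖ < 1) : 0 < (I * (1 - l) / (1 + l)).im := by
  have h1 : 1 + l ≠ 0 := by
    intro h
    have : l = -1 := by linear_combination h
    simp [this] at hl
  have h2 : I * (1 - l) / (1 + l) = (I * (1 - l) * starRingEnd ℂ (1 + l)) / (normSq (1 + l) : ℝ) := by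
    rw [div_eq_div_iff h1 (by simpa using h1), mul_assoc, ← Complex.mul_conj (1 + l)]
    ring
  rw [h2, div_ofReal_im]
  refine div_pos ?_ (normSq_pos.2 h1)
  have h3 : ‖l‖ ^ 2 < 1 := by nlinarith [norm_nonneg l]
  rw [← normSq_eq_norm_sq, normSq_apply] at h3
  simp
  nlinarith

/-- A Parseval argument. If û(l) is the generating polynomial of the inputs, the transfer function
at the Cayley image of l, applied to û(l), has the outputs y j as its first N Taylor coefficients.
Averaging its pairing with û(l) over |l| = r gives the sum of r^(2j) u_j* y_j, whose imaginary part
is nonnegative; then r tends to 1. -/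
theorem totalSupply_nonneg
    (hA : ∀ z : ℂ, 0 < z.im → (A - z • (1 : Matrix n n ℂ)).det ≠ 0)
    (hIm : ∀ z : ℂ, 0 < z.im → ∀ u,
      0 ≤ (star u ⬝ᵥ ((C * (A - z • (1 : Matrix n n ℂ))⁻¹ * B + D) *ᵥ u)).im)
    (u : ℕ → k → ℂ) (N : ℕ) : 0 ≤ totalSupply A B C D 0 u N := by
  have hA1 : IsUnit (1 + Complex.I • A).det := by
    have h1 := hA I (by simp)
    have h2 : 1 + Complex.I • A = I • (A - I • (1 : Matrix n n ℂ)) := by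
      rw [smul_sub, smul_smul, I_mul_I]; module
    rw [h2, det_smul]
    exact (IsUnit.mk0 _ (mul_ne_zero (pow_ne_zero _ I_ne_zero) h1))
  let y : ℕ → k → ℂ := fun j => C *ᵥ midState A B (traj A B 0 u j) (u j) + D *ᵥ u j
  let M : ℂ → Matrix n n ℂ := fun l => (1 + l) • A - (I * (1 - l)) • (1 : Matrix n n ℂ)
  have hone : ∀ l : ℂ, ‖l‖ < 1 → 1 + l ≠ 0 := by
    intro l hl h
    have : l = -1 := by linear_combination h
    simp [this] at hl
  have hMA : ∀ l : ℂ, ‖l‖ < 1 →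
      M l = (1 + l) • (A - (I * (1 - l) / (1 + l)) • (1 : Matrix n n ℂ)) := by
    intro l hl
    simp only [M]
    rw [smul_sub, smul_smul, mul_div_cancel₀ _ (hone l hl)]
  have hM : ∀ l : ℂ, ‖l‖ < 1 → (M l).det ≠ 0 := by
    intro l hl
    rw [hMA l hl, det_smul]
    exact mul_ne_zero (pow_ne_zero _ (hone l hl)) (hA _ (im_cayley_pos hl))
  let û : ℂ → k → ℂ := fun l => ∑ j ∈ Finset.range N, l ^ j • u j
  let g : ℂ → k → ℂ := fun l => I • C *ᵥ ((M l)⁻¹ *ᵥ traj A B 0 u N)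
  let F : ℂ → k → ℂ := fun l =>
    (C * (A - (I * (1 - l) / (1 + l)) • (1 : Matrix n n ℂ))⁻¹ * B + D) *ᵥ û l
  -- The state left over at time N contributes only from order l ^ N on. As û has degree below N,
  -- this tail never meets û in the averages.
  have hF : ∀ l : ℂ, ‖l‖ < 1 →
      F l = ∑ j ∈ Finset.range N, l ^ j • y j - l ^ N • g l := by
    intro l hl
    have h1 := congrArg ((M l)⁻¹ *ᵥ ·) (mulVec_sum_midState (B := B) hA1 u N l)
    simp only [mulVec_mulVec] at h1
    rw [nonsing_inv_mul _ (hM l hl).isUnit, one_mulVec, mulVec_add] at h1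
    have h2 : (A - (I * (1 - l) / (1 + l)) • (1 : Matrix n n ℂ))⁻¹ = (1 + l) • (M l)⁻¹ := by
      apply inv_eq_left_inv
      rw [Matrix.smul_mul, ← Matrix.mul_smul, ← hMA l hl, nonsing_inv_mul _ (hM l hl).isUnit]
    simp only [F, h2, y, g, smul_add, Finset.sum_add_distrib]
    have h3 : ∑ j ∈ Finset.range N, l ^ j • C *ᵥ midState A B (traj A B 0 u j) (u j) =
        C *ᵥ ∑ j ∈ Finset.range N, l ^ j • midState A B (traj A B 0 u j) (u j) := by
      rw [mulVec_sum]; simp only [mulVec_smul]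
    have h4 : ∑ j ∈ Finset.range N, l ^ j • D *ᵥ u j = D *ᵥ û l := by
      simp only [û]
      rw [mulVec_sum]; simp only [mulVec_smul]
    rw [h3, h4, h1]
    simp only [mulVec_add, mulVec_smul, add_mulVec, Matrix.mul_smul, Matrix.smul_mul, smul_mulVec,
      mulVec_mulVec, ← Matrix.mul_assoc]
    ext i
    simp only [û, Pi.add_apply, Pi.sub_apply, Pi.smul_apply, smul_eq_mul]
    ring
  have hg : ∀ (v : k → ℂ), DifferentiableOn ℂ (fun l => v ⬝ᵥ g l) (ball 0 1) := by
    intro v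
    have h1 : ∀ i j, DifferentiableOn ℂ (fun l => (M l)⁻¹ i j) (ball 0 1) := by
      refine differentiableOn_inv_apply (fun i j => ?_) (fun l hl => hM l (by simpa using hl))
      have : ∀ l, M l i j = (1 + l) * A i j - I * (1 - l) * (1 : Matrix n n ℂ) i j := by
        intro l; simp [M]
      simp only [this]
      fun_prop
    have h2 : ∀ l, v ⬝ᵥ g l =
        I * ∑ i, (v ᵥ* C) i * ∑ j, (M l)⁻¹ i j * traj A B 0 u N j := by
      intro l
      simp only [g]
      rw [dotProduct_smul, dotProduct_mulVec, smul_eq_mul]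
      rfl
    simp only [h2]
    exact (DifferentiableOn.fun_sum fun i _ => (DifferentiableOn.fun_sum fun j _ =>
      (h1 i j).mul_const _).const_mul _).const_mul _
  have key : ∀ r : ℝ, 0 < r → r < 1 →
      0 ≤ (∑ j ∈ Finset.range N, (r : ℂ) ^ (2 * j) * (star (u j) ⬝ᵥ y j)).im := by
    intro r hr hr1
    have hsub : closedBall (0 : ℂ) r ⊆ ball 0 1 := closedBall_subset_ball hr1
    have hsph : ∀ l ∈ sphere (0 : ℂ) r, ‖l‖ < 1 := fun l hl => by
      rw [mem_sphere_zero_iff_norm] at hl; rwa [hl]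
    have havg : ∀ j ∈ Finset.range N,
        circleAverage (fun l : ℂ => (starRingEnd ℂ l) ^ j * (star (u j) ⬝ᵥ F l)) 0 r =
          (r : ℂ) ^ (2 * j) * (star (u j) ⬝ᵥ y j) := by
      intro j hj
      rw [Finset.mem_range] at hj
      refine circleAverage_conj_pow_mul hr j (fun i => star (u j) ⬝ᵥ y i)
        (g := fun l => ∑ i ∈ Finset.range (N - (j + 1)), l ^ i * (star (u j) ⬝ᵥ y (j + 1 + i)) -
          l ^ (N - (j + 1)) * (star (u j) ⬝ᵥ g l)) ?_ ?_
      · have := (hg (star (u j))).mono hsub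
        fun_prop
      · intro l hl
        rw [hF l (hsph l hl), dotProduct_sub, dotProduct_sum, mul_sub, Finset.mul_sum]
        have hN : N = j + 1 + (N - (j + 1)) := by omega
        simp only [dotProduct_smul, smul_eq_mul]
        conv_lhs => rw [hN]
        rw [Finset.sum_range_add, pow_add l (j + 1) (N - (j + 1))]
        simp only [pow_add]
        rw [← add_sub_assoc]
        congr 1
        · congr 1
          exact Finset.sum_congr rfl fun i _ => by ring
        · ring_nf
    have hcont : ∀ j, ContinuousOn (fun l : ℂ => (starRingEnd ℂ l) ^ j * (star (u j) ⬝ᵥ F l))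
        (sphere 0 |r|) := by
      intro j
      rw [abs_of_pos hr]
      refine (Complex.continuous_conj.pow _).continuousOn.mul ?_
      refine ContinuousOn.congr (f := fun l => star (u j) ⬝ᵥ (∑ i ∈ Finset.range N, l ^ i • y i) -
        l ^ N * (star (u j) ⬝ᵥ g l)) ?_ ?_
      · have := ((hg (star (u j))).mono (sphere_subset_closedBall.trans hsub)).continuousOn
        have h2 : Continuous fun l : ℂ => star (u j) ⬝ᵥ (∑ i ∈ Finset.range N, l ^ i • y i) := by
          fun_prop
        exact h2.continuousOn.sub ((continuous_pow N).continuousOn.mul this)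
      · intro l hl
        simp only []
        rw [hF l (hsph l hl), dotProduct_sub, dotProduct_smul, smul_eq_mul]
    rw [← Finset.sum_congr rfl havg, ← circleAverage_fun_sum
      (fun j _ => ContinuousOn.circleIntegrable' (hcont j))]
    have h5 := Complex.imCLM.circleAverage_comp_comm
      (f := fun l : ℂ => ∑ j ∈ Finset.range N, (starRingEnd ℂ l) ^ j * (star (u j) ⬝ᵥ F l))
      (c := 0) (R := r) (ContinuousOn.circleIntegrable'
        (continuousOn_finsetSum _ fun j _ => hcont j))
    rw [← imCLM_apply, ← h5]
    refine circleAverage_nonneg_of_nonneg fun l hl => ?_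
    rw [abs_of_pos hr] at hl
    have h6 : ∑ j ∈ Finset.range N, (starRingEnd ℂ l) ^ j * (star (u j) ⬝ᵥ F l) =
        star (û l) ⬝ᵥ F l := by
      simp only [û, star_sum, sum_dotProduct, star_smul, smul_dotProduct, smul_eq_mul, star_pow]
      rfl
    simp only [Function.comp, h6]
    exact hIm _ (im_cayley_pos (hsph l hl)) _
  -- The sign hypothesis covers |l| < 1 only; the supply itself is the value at r = 1.
  have hlim : Tendsto (fun r : ℝ =>
      (∑ j ∈ Finset.range N, (r : ℂ) ^ (2 * j) * (star (u j) ⬝ᵥ y j)).im) (𝓝[<] 1)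
      (𝓝 (∑ j ∈ Finset.range N, ((1 : ℝ) : ℂ) ^ (2 * j) * (star (u j) ⬝ᵥ y j)).im) := by
    have : Continuous fun r : ℝ =>
      (∑ j ∈ Finset.range N, (r : ℂ) ^ (2 * j) * (star (u j) ⬝ᵥ y j)).im := by fun_prop
    exact (this.tendsto 1).mono_left nhdsWithin_le_nhds
  have h0 := ge_of_tendsto hlim (b := 0) (by
    filter_upwards [Ioo_mem_nhdsLT (show (0 : ℝ) < 1 by norm_num)] with r hr
    exact key r hr.1 hr.2)
  simp only [totalSupply, supply, ← Finset.mul_sum]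
  simp only [ofReal_one, one_pow, one_mul, im_sum] at h0
  exact mul_nonneg (by norm_num) h0

end Passivity

/-! ### State space realizations of rational functions -/

section StateSpace

open Polynomial

/-- `f z = c* (A - z)⁻¹ b` in the upper half-plane, and `f` vanishes at infinity. -/
def StateRealizable (f : ℂ → ℂ) : Prop :=
  Tendsto f (cocompact ℂ) (𝓝 0) ∧
  ∃ (m : ℕ) (A : Matrix (Fin m) (Fin m) ℂ) (b c : Fin m → ℂ), ∀ z : ℂ, 0 < z.im →
    (A - z • (1 : Matrix (Fin m) (Fin m) ℂ)).det ≠ 0 ∧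
    ∃ x, (A - z • (1 : Matrix (Fin m) (Fin m) ℂ)) *ᵥ x = b ∧ c ⬝ᵥ x = f z

theorem StateRealizable.of_fintype {f : ℂ → ℂ} (hf : Tendsto f (cocompact ℂ) (𝓝 0))
    {ι : Type*} [Fintype ι] [DecidableEq ι] (A : Matrix ι ι ℂ) (b c : ι → ℂ)
    (h : ∀ z : ℂ, 0 < z.im → (A - z • (1 : Matrix ι ι ℂ)).det ≠ 0 ∧
      ∃ x, (A - z • (1 : Matrix ι ι ℂ)) *ᵥ x = b ∧ c ⬝ᵥ x = f z) : StateRealizable f := by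
  let e := Fintype.equivFin ι
  refine ⟨hf, Fintype.card ι, A.reindex e e, b ∘ e.symm, c ∘ e.symm, fun z hz => ?_⟩
  obtain ⟨h1, x, hx, hc⟩ := h z hz
  have h2 : A.reindex e e - z • (1 : Matrix _ _ ℂ) = (A - z • (1 : Matrix ι ι ℂ)).reindex e e := by
    ext i j
    simp [one_apply]
  refine ⟨by rwa [h2, det_reindex_self], x ∘ e.symm, ?_, ?_⟩
  · rw [h2, ← hx, reindex_apply, submatrix_mulVec_equiv]
    simp [Function.comp_assoc]
  · rw [← hc]
    simp only [dotProduct, Function.comp]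
    exact Equiv.sum_comp e.symm fun i => c i * x i

theorem tendsto_inv_sub_cocompact (a : ℂ) :
    Tendsto (fun z : ℂ => (z - a)⁻¹) (cocompact ℂ) (𝓝 0) := by
  have h1 : Tendsto (fun z : ℂ => z - a) (cocompact ℂ) (cocompact ℂ) :=
    (Homeomorph.subRight a).isClosedEmbedding.tendsto_cocompact
  have h2 : Tendsto (fun z : ℂ => z⁻¹) (cocompact ℂ) (𝓝 0) := by
    rw [← Metric.cobounded_eq_cocompact]; exact tendsto_inv₀_cobounded
  exact h2.comp h1

theorem StateRealizable.zero : StateRealizable 0 :=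
  StateRealizable.of_fintype tendsto_const_nhds (ι := Fin 0) 0 0 0
    (fun z _ => ⟨by simp, 0, by simp, by simp⟩)

theorem StateRealizable.const_div {a : ℂ} (ha : a.im ≤ 0) (s : ℂ) :
    StateRealizable fun z => s * (z - a)⁻¹ := by
  refine StateRealizable.of_fintype (by simpa using (tendsto_inv_sub_cocompact a).const_mul s)
    (ι := Unit) (of fun _ _ => a) (fun _ => -1) (fun _ => s) fun z hz => ?_
  have hza : z - a ≠ 0 := fun h => by
    have : z = a := by linear_combination h
    rw [this] at hz; linarith
  refine ⟨?_, fun _ => (z - a)⁻¹, ?_, ?_⟩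
  · simp only [det_unique, Matrix.sub_apply, Matrix.smul_apply, one_apply_eq, smul_eq_mul, mul_one,
      of_apply]
    exact fun h => hza (by linear_combination -h)
  · ext i
    simp [mulVec, dotProduct]
    field_simp
    ring
  · simp [dotProduct]

/-- Parallel connection: direct sum of the two state spaces. -/
theorem StateRealizable.add {f g : ℂ → ℂ} (hf : StateRealizable f) (hg : StateRealizable g) :
    StateRealizable fun z => f z + g z := by
  obtain ⟨hf0, m, A, b, c, hA⟩ := hf
  obtain ⟨hg0, m', A', b', c', hA'⟩ := hg
  refine StateRealizable.of_fintype (by simpa using hf0.add hg0) (fromBlocks A 0 0 A')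
    (Sum.elim b b') (Sum.elim c c') fun z hz => ?_
  obtain ⟨h1, x, hx, hc⟩ := hA z hz
  obtain ⟨h1', x', hx', hc'⟩ := hA' z hz
  have h2 : fromBlocks A 0 0 A' - z • (1 : Matrix _ _ ℂ) =
      fromBlocks (A - z • (1 : Matrix _ _ ℂ)) 0 0 (A' - z • (1 : Matrix _ _ ℂ)) := by
    rw [← fromBlocks_one, fromBlocks_smul, sub_eq_add_neg, fromBlocks_neg, fromBlocks_add]
    simp [sub_eq_add_neg]
  refine ⟨?_, Sum.elim x x', ?_, ?_⟩
  · rw [h2, det_fromBlocks_zero₂₁]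
    exact mul_ne_zero h1 h1'
  · rw [h2, fromBlocks_mulVec]
    simp [hx, hx']
  · rw [sumElim_dotProduct_sumElim, hc, hc']

/-- Cascade connection: the output of f drives one extra state with eigenvalue a. -/
theorem StateRealizable.mul_inv_sub {f : ℂ → ℂ} (hf : StateRealizable f) {a : ℂ} (ha : a.im ≤ 0) :
    StateRealizable fun z => f z * (z - a)⁻¹ := by
  obtain ⟨hf0, m, A, b, c, hA⟩ := hf
  refine StateRealizable.of_fintype (by simpa using hf0.mul (tendsto_inv_sub_cocompact a))
    (fromBlocks A 0 (replicateRow Unit c) (of fun _ _ => a))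
    (Sum.elim b 0) (Sum.elim 0 1) fun z hz => ?_
  obtain ⟨h1, x, hx, hc⟩ := hA z hz
  have hza : z - a ≠ 0 := fun h => by
    have : z = a := by linear_combination h
    rw [this] at hz; linarith
  have h2 : fromBlocks A 0 (replicateRow Unit c) (of fun _ _ => a) -
      z • (1 : Matrix (Fin m ⊕ Unit) (Fin m ⊕ Unit) ℂ) =
      fromBlocks (A - z • (1 : Matrix _ _ ℂ)) 0 (replicateRow Unit c)
        (of fun _ _ => a - z) := by
    rw [← fromBlocks_one, fromBlocks_smul, sub_eq_add_neg, fromBlocks_neg, fromBlocks_add]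
    congr 1
    · simp
    · simp
    · ext; simp [sub_eq_add_neg]
  refine ⟨?_, Sum.elim x (fun _ => f z * (z - a)⁻¹), ?_, ?_⟩
  · rw [h2, det_fromBlocks_zero₁₂]
    refine mul_ne_zero h1 ?_
    simp only [det_unique, of_apply]
    exact fun h => hza (by linear_combination -h)
  · rw [h2, fromBlocks_mulVec]
    ext i
    rcases i with i | i
    · simp [hx]
    · have : (replicateRow Unit c *ᵥ x) i = f z := hc
      simp [this]
      simp [mulVec, dotProduct]
      field_simp
      ring
  · rw [sumElim_dotProduct_sumElim]
    simp [dotProduct]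

/-- Induction on the degree of q = (X - a)q₁. Division by q₁ leaves a constant quotient s, and P/q =
(P % q₁)/q₁ · 1/(z - a) + s/(z - a), a cascade plus a first-order term. -/
theorem stateRealizable_div (n : ℕ) : ∀ (q P : ℂ[X]), q.natDegree = n → q ≠ 0 →
    (∀ a, q.eval a = 0 → a.im ≤ 0) → P.degree < q.degree →
    StateRealizable fun z => P.eval z / q.eval z := by
  induction n with
  | zero =>
    intro q P hn hq _ hP
    have : P = 0 := by
      rw [degree_eq_natDegree hq, hn] at hP
      exact degree_eq_bot.1 (Nat.WithBot.lt_zero_iff.1 (by simpa using hP))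
    simp only [this, eval_zero, zero_div]
    exact StateRealizable.zero
  | succ n ih =>
    intro q P hn hq hroot hP
    obtain ⟨a, ha⟩ := IsAlgClosed.exists_root q (by
      rw [degree_eq_natDegree hq, hn]; exact_mod_cast Nat.succ_ne_zero n)
    obtain ⟨q₁, rfl⟩ := dvd_iff_isRoot.2 ha
    have hq₁ : q₁ ≠ 0 := right_ne_zero_of_mul hq
    have hn₁ : q₁.natDegree = n := by
      rw [natDegree_mul (X_sub_C_ne_zero a) hq₁, natDegree_X_sub_C] at hn
      omega
    have ha' := hroot a ha
    have hroot₁ : ∀ b, q₁.eval b = 0 → b.im ≤ 0 := fun b hb => hroot b (by simp [hb])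
    have hPdeg : P.natDegree ≤ q₁.natDegree := by
      rcases eq_or_ne P 0 with rfl | hP0
      · simp
      · have := natDegree_lt_natDegree hP0 hP
        omega
    have hconst : P / q₁ = C ((P / q₁).coeff 0) := by
      apply eq_C_of_natDegree_eq_zero
      rcases lt_or_ge P.degree q₁.degree with hlt | hge
      · rw [(Polynomial.div_eq_zero_iff hq₁).2 hlt, natDegree_zero]
      · have h0 := degree_add_div hq₁ hge
        have hP0 : P ≠ 0 := fun h => by
          rw [h, degree_zero, le_bot_iff, degree_eq_bot] at hge
          exact hq₁ hge
        have hd0 : P / q₁ ≠ 0 := fun h => by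
          exact absurd hge (not_le.2 ((Polynomial.div_eq_zero_iff hq₁).1 h))
        rw [degree_eq_natDegree hq₁, degree_eq_natDegree hd0, degree_eq_natDegree hP0] at h0
        have h1 : q₁.natDegree + (P / q₁).natDegree = P.natDegree := by exact_mod_cast h0
        omega
    set s := (P / q₁).coeff 0
    have h1 := ((ih q₁ (P % q₁) hn₁ hq₁ hroot₁ (EuclideanDomain.mod_lt P hq₁)).mul_inv_sub ha').add
      (StateRealizable.const_div ha' s)
    have h2 : ∀ z, P.eval z = q₁.eval z * s + (P % q₁).eval z := by
      intro z
      have := congrArg (eval z) (EuclideanDomain.div_add_mod P q₁)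
      rw [hconst] at this
      simpa using this.symm
    refine ⟨?_, ?_⟩
    · refine h1.1.congr' ?_
      have hfin : ∀ᶠ z in cocompact ℂ, q₁.eval z ≠ 0 := by
        have h3 : {z | q₁.eval z = 0}.Finite := by
          convert q₁.roots.toFinset.finite_toSet using 1
          ext z; simp [hq₁]
        exact h3.isCompact.compl_mem_cocompact
      filter_upwards [hfin] with z hz
      rw [h2, eval_mul, eval_sub, eval_X, eval_C]
      rcases eq_or_ne (z - a) 0 with h0 | h0
      · simp [h0]
      · field_simp
        ring
    · obtain ⟨-, m, A, b, c, h⟩ := h1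
      refine ⟨m, A, b, c, fun z hz => ?_⟩
      obtain ⟨h3, x, h4, h5⟩ := h z hz
      refine ⟨h3, x, h4, h5.trans ?_⟩
      have hz0 : q₁.eval z ≠ 0 := fun h0 => by linarith [hroot₁ z h0]
      have hza : z - a ≠ 0 := fun h0 => by
        have : z = a := by linear_combination h0
        rw [this] at hz; linarith
      simp only [h2, eval_mul, eval_sub, eval_X, eval_C]
      field_simp
      ring

theorem eval_ne_zero_cocompact {q : ℂ[X]} (hq : q ≠ 0) : ∀ᶠ z in cocompact ℂ, q.eval z ≠ 0 := by
  have h3 : {z | q.eval z = 0}.Finite := by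
    convert q.roots.toFinset.finite_toSet using 1
    ext z; simp [hq]
  exact h3.isCompact.compl_mem_cocompact

/-- A rational function with a finite limit `L` at infinity is `L` plus a strictly proper one. -/
theorem exists_stateRealizable {f : RatFunc ℂ} {L : ℂ}
    (hL : Tendsto (f.eval (RingHom.id ℂ)) (cocompact ℂ) (𝓝 L))
    (hroot : ∀ a, f.denom.eval a = 0 → a.im ≤ 0) :
    ∃ h, StateRealizable h ∧ ∀ z : ℂ, 0 < z.im → f.eval (RingHom.id ℂ) z = L + h z := by
  have hq : f.denom ≠ 0 := f.denom_ne_zero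
  have h1 := stateRealizable_div _ f.denom (f.num % f.denom) rfl hq hroot
    (EuclideanDomain.mod_lt f.num hq)
  have h2 : ∀ z, f.denom.eval z ≠ 0 → f.eval (RingHom.id ℂ) z =
      (f.num / f.denom).eval z + (f.num % f.denom).eval z / f.denom.eval z := by
    intro z hz
    rw [RatFunc.eval, eval₂_id, eval₂_id]
    have := congrArg (eval z) (EuclideanDomain.div_add_mod f.num f.denom)
    rw [eval_add, eval_mul] at this
    rw [← this]
    field_simp
  have h3 : Tendsto (fun z => (f.num / f.denom).eval z) (cocompact ℂ) (𝓝 L) := by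
    have := hL.sub h1.1
    rw [sub_zero] at this
    refine this.congr' ?_
    filter_upwards [eval_ne_zero_cocompact hq] with z hz
    rw [h2 z hz, add_sub_cancel_right]
  -- The polynomial part has a finite limit at infinity, so it is a constant, and that constant is
  -- L.
  have h4 : ¬ 0 < (f.num / f.denom).degree := by
    intro hdeg
    have h5 := (f.num / f.denom).tendsto_norm_atTop hdeg (tendsto_norm_cocompact_atTop (E := ℂ))
    exact not_tendsto_nhds_of_tendsto_atTop h5 _ h3.norm
  rw [eq_C_of_degree_le_zero (not_lt.1 h4)] at h3 h2
  simp only [eval_C] at h3 h2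
  have h5 := tendsto_nhds_unique h3 tendsto_const_nhds
  refine ⟨_, h1, fun z hz => ?_⟩
  rw [h2 z fun h0 => by linarith [hroot z h0], h5]

/-- Assembling the realizations of the entries of a matrix function. -/
theorem exists_matrix_realization {p : ℕ} {F : ℂ → Matrix (Fin p) (Fin p) ℂ}
    (hF : ∀ i j, StateRealizable fun z => F z i j) :
    ∃ (ι : Type) (_ : Fintype ι) (_ : DecidableEq ι) (A : Matrix ι ι ℂ) (B : Matrix ι (Fin p) ℂ)
      (C : Matrix (Fin p) ι ℂ), ∀ z : ℂ, 0 < z.im →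
      (A - z • (1 : Matrix ι ι ℂ)).det ≠ 0 ∧
      ∃ Z : Matrix ι (Fin p) ℂ, (A - z • (1 : Matrix ι ι ℂ)) * Z = B ∧ F z = C * Z := by
  choose h0 m A b c h using hF
  -- Each entry (i, j) keeps its own block of states: input j drives the blocks of column j, and
  -- output i reads the blocks of row i.
  refine ⟨Σ ij : Fin p × Fin p, Fin (m ij.1 ij.2), inferInstance, inferInstance,
    blockDiagonal' fun ij => A ij.1 ij.2, of fun s j => if j = s.1.2 then b s.1.1 s.1.2 s.2 else 0,
    of fun i s => if i = s.1.1 then c s.1.1 s.1.2 s.2 else 0, fun z hz => ?_⟩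
  have h2 : (blockDiagonal' fun ij : Fin p × Fin p => A ij.1 ij.2) - z • (1 : Matrix _ _ ℂ) =
      blockDiagonal' fun ij : Fin p × Fin p => A ij.1 ij.2 - z • (1 : Matrix _ _ ℂ) := by
    rw [← blockDiagonal'_one, ← blockDiagonal'_smul, ← blockDiagonal'_sub]
    rfl
  choose hdet x hx hc using fun i j => h i j z hz
  refine ⟨?_, of fun s j => if j = s.1.2 then x s.1.1 s.1.2 s.2 else 0, ?_, ?_⟩
  · rw [h2]
    refine (isUnit_det_of_right_inverse
      (B := blockDiagonal' fun ij : Fin p × Fin p => (A ij.1 ij.2 - z • (1 : Matrix _ _ ℂ))⁻¹) ?_).ne_zero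
    rw [← blockDiagonal'_mul, ← blockDiagonal'_one]
    congr 1
    ext1 ij
    exact mul_nonsing_inv _ (hdet _ _).isUnit
  · rw [h2]
    ext ⟨⟨i, j⟩, s⟩ l
    rw [mul_apply, Fintype.sum_sigma, Finset.sum_eq_single (i, j)]
    · simp only [blockDiagonal'_apply_eq, of_apply]
      split_ifs with hl
      · rw [← hx i j]; rfl
      · simp
    · intro ij _ hij
      refine Finset.sum_eq_zero fun t _ => ?_
      rw [blockDiagonal'_apply_ne _ _ _ (Ne.symm hij), zero_mul]
    · simp
  · ext i l
    rw [mul_apply, Fintype.sum_sigma, Finset.sum_eq_single (i, l)]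
    · simp only [of_apply, if_true]
      exact (hc i l).symm
    · rintro ⟨i', j'⟩ _ hij
      refine Finset.sum_eq_zero fun t _ => ?_
      simp only [of_apply]
      split_ifs with h3 h4
      · exact absurd (by rw [h3, h4]) hij
      all_goals simp
    · simp

theorem exists_mul_eq_of_col {m n o : Type*} [Fintype n] {E : Matrix m n ℂ} {M : Matrix m o ℂ}
    (h : ∀ j, ∃ v, E *ᵥ v = M.col j) : ∃ M', E * M' = M := by
  choose f hf using h
  refine ⟨of fun i j => f j i, ?_⟩
  ext i j
  exact congrFun (hf j) i

/-- Restriction of a realization to its reachable subspace. -/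
theorem exists_reachable_realization {ι k : Type*} [Fintype ι] [DecidableEq ι] [Fintype k]
    [DecidableEq k] (A : Matrix ι ι ℂ) (B : Matrix ι k ℂ) (C : Matrix k ι ℂ) :
    ∃ (g : ℕ) (A' : Matrix (Fin g) (Fin g) ℂ) (B' : Matrix (Fin g) k ℂ) (C' : Matrix k (Fin g) ℂ),
      Reachable A' B' ∧ ∀ z : ℂ, (A - z • (1 : Matrix ι ι ℂ)).det ≠ 0 →
        (A' - z • (1 : Matrix (Fin g) (Fin g) ℂ)).det ≠ 0 ∧
        ∀ (Z : Matrix ι k ℂ) (Z' : Matrix (Fin g) k ℂ), (A - z • (1 : Matrix ι ι ℂ)) * Z = B →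
          (A' - z • (1 : Matrix (Fin g) (Fin g) ℂ)) * Z' = B' → C' * Z' = C * Z := by
  -- The smallest A-invariant subspace containing the range of B. The columns of E below form a
  -- basis of it, and A', B' are the coordinates of A and B there.
  let W : Submodule ℂ (ι → ℂ) :=
    sInf {V | (∀ u, B *ᵥ u ∈ V) ∧ ∀ x ∈ V, A *ᵥ x ∈ V}
  have hWB : ∀ u, B *ᵥ u ∈ W := fun u => Submodule.mem_sInf.2 fun V hV => hV.1 u
  have hWA : ∀ x ∈ W, A *ᵥ x ∈ W := fun x hx => Submodule.mem_sInf.2 fun V hV =>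
    hV.2 x (Submodule.mem_sInf.1 hx V hV)
  let bs := Module.finBasis ℂ W
  let E : Matrix ι (Fin (Module.finrank ℂ W)) ℂ := of fun i j => (bs j : ι → ℂ) i
  have hE : ∀ v, E *ᵥ v = ((∑ j, v j • bs j : W) : ι → ℂ) := by
    intro v
    ext i
    simp [E, mulVec, dotProduct, mul_comm]
  have hEW : ∀ v, E *ᵥ v ∈ W := fun v => by rw [hE]; exact Submodule.coe_mem _
  have hsurj : ∀ w ∈ W, ∃ v, E *ᵥ v = w := by
    intro w hw
    refine ⟨bs.repr ⟨w, hw⟩, ?_⟩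
    rw [hE, bs.sum_repr]
  have hinj : ∀ v, E *ᵥ v = 0 → v = 0 := by
    intro v hv
    rw [hE] at hv
    have h1 : (∑ j, v j • bs j : W) = 0 := Subtype.ext hv
    ext j
    exact Fintype.linearIndependent_iff.1 bs.linearIndependent v h1 j
  obtain ⟨A', hA'⟩ : ∃ A' : Matrix (Fin _) (Fin _) ℂ, E * A' = A * E := exists_mul_eq_of_col fun j => by
    obtain ⟨v, hv⟩ := hsurj _ (hWA _ (bs j).2)
    exact ⟨v, hv⟩
  obtain ⟨B', hB'⟩ : ∃ B' : Matrix (Fin _) k ℂ, E * B' = B := exists_mul_eq_of_col fun j => by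
    obtain ⟨v, hv⟩ := hsurj _ (hWB (Pi.single j 1))
    exact ⟨v, by rw [hv, mulVec_single_one]⟩
  refine ⟨_, A', B', C * E, ?_, ?_⟩
  · intro V hVB hVA
    -- The image of V under E is A-invariant and contains the range of B, so it contains W by
    -- minimality; injectivity of E then gives V = ⊤.
    have hle : W ≤ V.map (Matrix.mulVecLin E) := by
      refine sInf_le ⟨fun u => ⟨B' *ᵥ u, hVB u, ?_⟩, ?_⟩
      · simp [mulVec_mulVec, hB']
      · rintro _ ⟨v, hv, rfl⟩
        refine ⟨A' *ᵥ v, hVA v hv, ?_⟩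
        simp only [mulVecLin_apply, mulVec_mulVec, hA']
    rw [eq_top_iff]
    intro v _
    obtain ⟨v', hv', h⟩ := hle (hEW v)
    have : v - v' = 0 := hinj _ (by
      rw [mulVec_sub, sub_eq_zero]
      exact h.symm)
    rw [sub_eq_zero.1 this]
    exact hv'
  · intro z hz
    have hAE : E * (A' - z • (1 : Matrix _ _ ℂ)) = (A - z • (1 : Matrix ι ι ℂ)) * E := by
      rw [Matrix.mul_sub, Matrix.sub_mul, hA']
      simp
    refine ⟨?_, ?_⟩
    · intro hdet
      obtain ⟨v, hv0, hv⟩ := exists_mulVec_eq_zero_iff.2 hdet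
      apply hv0
      apply hinj
      have h1 : (A - z • (1 : Matrix ι ι ℂ)) *ᵥ (E *ᵥ v) = 0 := by
        rw [mulVec_mulVec, ← hAE, ← mulVec_mulVec, hv, mulVec_zero]
      by_contra h2
      exact hz (exists_mulVec_eq_zero_iff.1 ⟨_, h2, h1⟩)
    · intro Z Z' hZ hZ'
      have h1 : (A - z • (1 : Matrix ι ι ℂ)) * (E * Z') = (A - z • (1 : Matrix ι ι ℂ)) * Z := by
        rw [← Matrix.mul_assoc, ← hAE, Matrix.mul_assoc, hZ', hB', hZ]
      have h2 := congrArg ((A - z • (1 : Matrix ι ι ℂ))⁻¹ * ·) h1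
      simp only [← Matrix.mul_assoc, nonsing_inv_mul _ hz.isUnit, Matrix.one_mul] at h2
      rw [Matrix.mul_assoc, h2]

end StateSpace

/-! ### Absence of poles in the upper half-plane -/

section Poles

open Polynomial

theorem eval_ne_zero_nhdsNE {q : ℂ[X]} (hq : q ≠ 0) (z₀ : ℂ) : ∀ᶠ z in 𝓝[≠] z₀, q.eval z ≠ 0 := by
  have h3 : {z | q.eval z = 0}.Finite := by
    convert q.roots.toFinset.finite_toSet using 1
    ext z; simp [hq]
  have h4 : ({z | q.eval z = 0} \ {z₀})ᶜ ∈ 𝓝 z₀ :=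
    (h3.subset Set.sdiff_subset).isClosed.isOpen_compl.mem_nhds (by simp)
  filter_upwards [nhdsWithin_le_nhds h4, self_mem_nhdsWithin] with z hz hne h0
  exact hz ⟨h0, hne⟩

theorem num_eval_ne_zero {f : RatFunc ℂ} {z : ℂ} (h : f.denom.eval z = 0) : f.num.eval z ≠ 0 := by
  intro h0
  obtain ⟨a, b, hab⟩ := f.isCoprime_num_denom
  have := congrArg (eval z) hab
  simp [h, h0] at this

/-- A rational function whose imaginary part is nonnegative near `z₀` has no pole at `z₀`. -/
theorem denom_eval_ne_zero {f : RatFunc ℂ} {z₀ : ℂ}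
    (h : ∀ᶠ z in 𝓝[≠] z₀, 0 ≤ (f.eval (RingHom.id ℂ) z).im) : f.denom.eval z₀ ≠ 0 := by
  intro h0
  have hnum := num_eval_ne_zero h0
  -- The reciprocal of f is analytic at a pole and vanishes there without being constant, so it is
  -- open. It takes values ie with small e > 0, where f = -i/e has negative imaginary part.
  let g : ℂ → ℂ := fun z => f.denom.eval z / f.num.eval z
  have hg : AnalyticAt ℂ g z₀ :=
    (f.denom.differentiable.analyticAt z₀).div (f.num.differentiable.analyticAt z₀) hnum
  have hg0 : g z₀ = 0 := by simp [g, h0]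
  have hnum' : ∀ᶠ z in 𝓝 z₀, f.num.eval z ≠ 0 :=
    f.num.continuous.continuousAt.eventually_ne hnum
  rcases hg.eventually_constant_or_nhds_le_map_nhds with hc | hmap
  · have h1 : ∀ᶠ z in 𝓝[≠] z₀, False := by
      filter_upwards [nhdsWithin_le_nhds hc, nhdsWithin_le_nhds hnum',
        eval_ne_zero_nhdsNE f.denom_ne_zero z₀] with z h1 h2 h3
      rw [hg0] at h1
      exact div_ne_zero h3 h2 h1
    exact h1.exists.elim fun _ => False.elim
  · rw [hg0] at hmap
    have hU : g '' {z | f.num.eval z ≠ 0 ∧ (z ≠ z₀ → 0 ≤ (f.eval (RingHom.id ℂ) z).im)} ∈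
        𝓝 (0 : ℂ) := by
      apply hmap
      rw [mem_map]
      filter_upwards [hnum', eventually_nhdsWithin_iff.1 h] with z h1 h2
      exact ⟨z, ⟨h1, h2⟩, rfl⟩
    have ht : Tendsto (fun e : ℝ => (e : ℂ) * Complex.I) (𝓝[>] 0) (𝓝 0) := by
      have : Continuous fun e : ℝ => (e : ℂ) * Complex.I := by fun_prop
      simpa using (this.tendsto 0).mono_left nhdsWithin_le_nhds
    obtain ⟨e, ⟨z, ⟨hz1, hz2⟩, hz⟩, he⟩ := ((ht.eventually hU).and self_mem_nhdsWithin).exists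
    have he' : (0 : ℝ) < e := he
    have hne : z ≠ z₀ := by
      rintro rfl
      rw [hg0] at hz
      have := congrArg Complex.im hz
      simp at this
      linarith
    have h2 := hz2 hne
    have h3 : f.eval (RingHom.id ℂ) z = (g z)⁻¹ := by
      simp [g, RatFunc.eval, eval₂_id]
    rw [h3, hz] at h2
    simp [Complex.inv_im, Complex.normSq_apply] at h2
    linarith

/-- The rational functions which are regular at a given point form a subring. -/
def regularAt (z₀ : ℂ) : Subring (RatFunc ℂ) where
  carrier := {f | f.denom.eval z₀ ≠ 0}
  zero_mem' := by simp
  one_mem' := by simp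
  add_mem' := by
    intro f g hf hg h
    obtain ⟨r, hr⟩ := RatFunc.denom_add_dvd f g
    have := congrArg (eval z₀) hr
    rw [eval_mul, eval_mul, h, zero_mul] at this
    exact mul_ne_zero hf hg this
  mul_mem' := by
    intro f g hf hg h
    obtain ⟨r, hr⟩ := RatFunc.denom_mul_dvd f g
    have := congrArg (eval z₀) hr
    rw [eval_mul, eval_mul, h, zero_mul] at this
    exact mul_ne_zero hf hg this
  neg_mem' := by
    intro f hf h
    have h1 : (-f) = RatFunc.C (-1) * f := by simp
    obtain ⟨r, hr⟩ := RatFunc.denom_mul_dvd (RatFunc.C (-1)) f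
    rw [← h1] at hr
    have := congrArg (eval z₀) hr
    rw [eval_mul, eval_mul, h, zero_mul, RatFunc.denom_C, eval_one, one_mul] at this
    exact hf this

theorem C_mem_regularAt (z₀ c : ℂ) : RatFunc.C c ∈ regularAt z₀ := by
  change (RatFunc.C c).denom.eval z₀ ≠ 0
  simp

theorem re_quadForm_imPart {p : ℕ} (M : Matrix (Fin p) (Fin p) ℂ) (v : Fin p → ℂ) :
    (star v ⬝ᵥ imPart M *ᵥ v).re = (star v ⬝ᵥ M *ᵥ v).im := by
  rw [imPart, smul_mulVec, sub_mulVec, dotProduct_smul, dotProduct_sub, ← star_quadForm]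
  have : (1 / (2 * Complex.I) : ℂ) = -(Complex.I / 2) := by
    have := Complex.I_ne_zero
    field_simp
    rw [Complex.I_sq, neg_neg]
  rw [this]
  simp
  ring

theorem quadForm_single_add {p : ℕ} (M : Matrix (Fin p) (Fin p) ℂ) (i j : Fin p) (c : ℂ) :
    star (Pi.single i 1 + c • Pi.single j 1 : Fin p → ℂ) ⬝ᵥ
      M *ᵥ (Pi.single i 1 + c • Pi.single j 1) =
      M i i + c * M i j + star c * M j i + c * star c * M j j := by
  simp only [star_add, star_smul, mulVec_add, mulVec_smul, add_dotProduct, dotProduct_add,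
    smul_dotProduct, dotProduct_smul, ← entry_eq_sesq, smul_eq_mul]
  ring

variable {p : ℕ} {φ : Matrix (Fin p) (Fin p) (RatFunc ℂ)}

/-- Positivity gives scalar functions with nonnegative imaginary part only as quadratic forms of φ.
Taken at e_i + c e_j these are regular at z₀ for every c, and polarization within the subring
`regularAt z₀` recovers the entries. -/
theorem not_isPole_of_im_nonneg (hIm : ∀ z : ℂ, 0 < z.im → ¬ IsPole φ z →
      (imPart (evalAt φ z)).PosSemidef) {z₀ : ℂ} (hz₀ : 0 < z₀.im) : ¬ IsPole φ z₀ := by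
  have hreg : ∀ i j, φ i j ∈ regularAt z₀ ↔ (φ i j).denom.eval z₀ ≠ 0 := fun _ _ => Iff.rfl
  have hev : ∀ᶠ z in 𝓝[≠] z₀, 0 < z.im ∧ ∀ i j, (φ i j).denom.eval z ≠ 0 := by
    refine Filter.Eventually.and ?_ ?_
    · exact nhdsWithin_le_nhds ((isOpen_lt continuous_const Complex.continuous_im).mem_nhds hz₀)
    · exact eventually_all.2 fun i => eventually_all.2 fun j =>
        eval_ne_zero_nhdsNE (φ i j).denom_ne_zero z₀
  have hq : ∀ i j (c : ℂ), φ i i + RatFunc.C c * φ i j + RatFunc.C (star c) * φ j i +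
      RatFunc.C (c * star c) * φ j j ∈ regularAt z₀ := by
    intro i j c
    refine denom_eval_ne_zero ?_
    filter_upwards [hev] with z ⟨hz, hd⟩
    have hP : ∀ i j, φ i j ∈ regularAt z := fun i j => hd i j
    have hmul : ∀ (c : ℂ) i j, RatFunc.C c * φ i j ∈ regularAt z := fun c i j =>
      (regularAt z).mul_mem (C_mem_regularAt z c) (hP i j)
    have e1 : ∀ {f g : RatFunc ℂ}, f ∈ regularAt z → g ∈ regularAt z →
        (f + g).eval (RingHom.id ℂ) z = f.eval (RingHom.id ℂ) z + g.eval (RingHom.id ℂ) z :=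
      fun hf hg => RatFunc.eval_add _ _ (by rw [eval₂_id]; exact hf) (by rw [eval₂_id]; exact hg)
    have e2 : ∀ (c : ℂ) {f : RatFunc ℂ}, f ∈ regularAt z →
        (RatFunc.C c * f).eval (RingHom.id ℂ) z = c * f.eval (RingHom.id ℂ) z := by
      intro c f hf
      rw [RatFunc.eval_mul _ _ (by simp) (by rw [eval₂_id]; exact hf), RatFunc.eval_C]
      rfl
    have h2 := (regularAt z).add_mem (hP i i) (hmul c i j)
    have h3 := (regularAt z).add_mem h2 (hmul (star c) j i)
    rw [e1 h3 (hmul _ _ _), e1 h2 (hmul _ _ _), e1 (hP i i) (hmul _ _ _), e2 _ (hP _ _),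
      e2 _ (hP _ _), e2 _ (hP _ _)]
    have h4 := hIm z hz (by rintro ⟨i, j, h⟩; exact hd i j h)
    rw [posSemidef_iff_dotProduct_mulVec] at h4
    have h5 := (Complex.le_def.1 (h4.2 (Pi.single i 1 + c • Pi.single j 1))).1
    rw [re_quadForm_imPart, quadForm_single_add] at h5
    exact h5
  rintro ⟨i, j, hij⟩
  have hdiag : ∀ i, φ i i ∈ regularAt z₀ := by
    intro i
    simpa using hq i i 0
  have hpol : ∀ c : ℂ, RatFunc.C c * φ i j + RatFunc.C (star c) * φ j i ∈ regularAt z₀ := by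
    intro c
    have h1 := (regularAt z₀).sub_mem ((regularAt z₀).sub_mem (hq i j c) (hdiag i))
      ((regularAt z₀).mul_mem (C_mem_regularAt z₀ (c * star c)) (hdiag j))
    convert h1 using 1
    ring
  -- Half of the value at c = 1 plus -i times the value at c = i isolates the entry (i, j).
  have h1 := hpol 1
  have h2 := (regularAt z₀).mul_mem (C_mem_regularAt z₀ (-Complex.I)) (hpol Complex.I)
  have h3 := (regularAt z₀).mul_mem (C_mem_regularAt z₀ (1 / 2)) ((regularAt z₀).add_mem h1 h2)
  have h4 : RatFunc.C (1 / 2) * (RatFunc.C 1 * φ i j + RatFunc.C (star 1) * φ j i +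
      RatFunc.C (-Complex.I) * (RatFunc.C Complex.I * φ i j +
        RatFunc.C (star Complex.I) * φ j i)) = φ i j := by
    have a1 : RatFunc.C (-Complex.I) * RatFunc.C Complex.I = 1 := by
      rw [← map_mul]; simp
    have a2 : RatFunc.C (-Complex.I) * RatFunc.C (star Complex.I) = -1 := by
      rw [← map_mul]; simp
    have a3 : RatFunc.C (1 / 2 : ℂ) * 2 = 1 := by
      have : (2 : RatFunc ℂ) = RatFunc.C 2 := (map_ofNat RatFunc.C 2).symm
      rw [this, ← map_mul]; simp
    rw [star_one, map_one]
    linear_combination (φ i j) * a3 + RatFunc.C (1 / 2) * φ i j * a1 +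
      RatFunc.C (1 / 2) * φ j i * a2
  rw [h4] at h3
  exact h3 hij

/-- Equality in the upper half-plane extends to all points outside the spectrum of `γ`. -/
theorem realization_of_upperHalfPlane {n : ℕ} {L : Matrix (Fin p) (Fin p) ℂ}
    {Ψ₁ Ψ₂ : Matrix (Fin n) (Fin p) ℂ} {γ : Matrix (Fin n) (Fin n) ℂ}
    (hp : ∀ z : ℂ, 0 < z.im → ¬ IsPole φ z)
    (h : ∀ z : ℂ, 0 < z.im → (γ - z • (1 : Matrix (Fin n) (Fin n) ℂ)).det ≠ 0 ∧
      evalAt φ z = L + Ψ₁ᴴ * (γ - z • (1 : Matrix (Fin n) (Fin n) ℂ))⁻¹ * Ψ₂) :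
    ∀ z : ℂ, (γ - z • (1 : Matrix (Fin n) (Fin n) ℂ)).det ≠ 0 → ¬ IsPole φ z ∧
      evalAt φ z = L + Ψ₁ᴴ * (γ - z • (1 : Matrix (Fin n) (Fin n) ℂ))⁻¹ * Ψ₂ := by
  let M : Matrix (Fin n) (Fin n) ℂ[X] := γ.map C - scalar (Fin n) X
  have hM : ∀ z, (evalRingHom z).mapMatrix M = γ - z • (1 : Matrix (Fin n) (Fin n) ℂ) := by
    intro z
    ext a b
    by_cases hab : a = b <;> simp [M, hab]
  have hdet : ∀ z, M.det.eval z = (γ - z • (1 : Matrix (Fin n) (Fin n) ℂ)).det := by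
    intro z
    rw [← hM, ← RingHom.map_det]; rfl
  have hadj : ∀ z, (evalRingHom z).mapMatrix M.adjugate =
      (γ - z • (1 : Matrix (Fin n) (Fin n) ℂ)).adjugate := by
    intro z
    rw [← hM, RingHom.map_adjugate]
  let N : Fin p → Fin p → ℂ[X] := fun i j =>
    (Ψ₁ᴴ.map C * M.adjugate * Ψ₂.map C) i j + C (L i j) * M.det
  have hN : ∀ z i j, (N i j).eval z =
      (Ψ₁ᴴ * (γ - z • (1 : Matrix (Fin n) (Fin n) ℂ)).adjugate * Ψ₂) i j +
        L i j * (γ - z • (1 : Matrix (Fin n) (Fin n) ℂ)).det := by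
    intro z i j
    simp only [N]
    rw [eval_add, eval_mul, eval_C, hdet, ← hadj]
    congr 1
    simp [mul_apply, eval_finsetSum]
  have hR : ∀ z, (γ - z • (1 : Matrix (Fin n) (Fin n) ℂ)).det ≠ 0 → ∀ i j,
      (L + Ψ₁ᴴ * (γ - z • (1 : Matrix (Fin n) (Fin n) ℂ))⁻¹ * Ψ₂) i j =
      (N i j).eval z / M.det.eval z := by
    intro z hz i j
    rw [hN, hdet, inv_def, Ring.inverse_eq_inv', Matrix.mul_smul, Matrix.smul_mul]
    simp only [Matrix.add_apply, Matrix.smul_apply, smul_eq_mul]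
    field_simp
    ring
  -- Cramer's rule makes the right-hand side of the realization a quotient of polynomials; agreement
  -- at the infinitely many points k + i gives a polynomial identity.
  have hpoly : ∀ i j, (φ i j).num * M.det = N i j * (φ i j).denom := by
    intro i j
    apply eq_of_infinite_eval_eq
    refine Set.Infinite.mono (s := Set.range fun k : ℕ => (k : ℂ) + Complex.I) ?_ ?_
    · rintro _ ⟨k, rfl⟩
      have him : 0 < ((k : ℂ) + Complex.I).im := by simp
      obtain ⟨h1, h2⟩ := h _ him
      have h3 : (φ i j).denom.eval ((k : ℂ) + Complex.I) ≠ 0 := fun h0 => hp _ him ⟨i, j, h0⟩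
      have h4 := congrFun (congrFun h2 i) j
      rw [hR _ h1] at h4
      simp only [evalAt, of_apply, RatFunc.eval, eval₂_id] at h4
      rw [← hdet] at h1
      rw [div_eq_div_iff h3 h1] at h4
      simpa using h4
    · refine Set.infinite_range_of_injective fun a b hab => ?_
      simpa using hab
  intro z hz
  have hz' : M.det.eval z ≠ 0 := by rwa [hdet]
  -- At a zero of the denominator the identity would make numerator times determinant vanish, but
  -- the numerator is coprime to the denominator and the determinant is nonzero.
  have hpole : ∀ i j, (φ i j).denom.eval z ≠ 0 := by
    intro i j h0
    have := congrArg (eval z) (hpoly i j)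
    rw [eval_mul, eval_mul, h0, mul_zero] at this
    exact (mul_ne_zero (num_eval_ne_zero h0) hz') this
  refine ⟨by rintro ⟨i, j, h0⟩; exact hpole i j h0, ?_⟩
  ext i j
  rw [hR z hz]
  simp only [evalAt, of_apply, RatFunc.eval, eval₂_id]
  rw [div_eq_div_iff (hpole i j) hz', ← eval_mul, ← eval_mul, hpoly]

end Poles

/-! ### Existence of the realization -/

section Existence

variable {p : ℕ} {d : Fin p → ℝ}

theorem D_inv (hd : ∀ i, d i < 0) : (D d)⁻¹ = diagonal fun i => ((d i : ℂ))⁻¹ := by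
  apply inv_eq_left_inv
  rw [D, diagonal_mul_diagonal, ← diagonal_one]
  congr 1
  ext i
  exact inv_mul_cancel₀ (by exact_mod_cast (hd i).ne)

theorem absD_eq_neg (hd : ∀ i, d i < 0) : absD d = -D d := by
  rw [absD, D, diagonal_neg]
  congr 1
  ext i
  simp [abs_of_neg (hd i)]

theorem im_quadForm_sub {n : Type*} [Fintype n] (γ : Matrix n n ℂ) (v : n → ℂ) :
    2 * (star v ⬝ᵥ γ *ᵥ v).im * Complex.I = star v ⬝ᵥ (γ - γᴴ) *ᵥ v := by
  rw [sub_mulVec, dotProduct_sub, ← star_quadForm, Complex.star_def, Complex.sub_conj,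
    Complex.ofReal_mul, Complex.ofReal_ofNat]

/-- The spectrum of a dissipative matrix avoids the open upper half-plane. -/
theorem det_sub_ne_zero {n : Type*} [Fintype n] [DecidableEq n] {γ : Matrix n n ℂ}
    {Ψ : Matrix n (Fin p) ℂ} (hd : ∀ i, d i < 0) (hγ : γ - γᴴ = Complex.I • (Ψ * (D d)⁻¹ * Ψᴴ))
    {z : ℂ} (hz : 0 < z.im) : (γ - z • (1 : Matrix n n ℂ)).det ≠ 0 := by
  intro hdet
  obtain ⟨v, hv0, hv⟩ := exists_mulVec_eq_zero_iff.2 hdet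
  rw [sub_mulVec, smul_mulVec, one_mulVec, sub_eq_zero] at hv
  have h1 := im_quadForm_sub γ v
  have h2 := quadForm_conjTranspose_mul_mul Ψᴴ Ψᴴ (D d)⁻¹ v
  rw [conjTranspose_conjTranspose, D_inv hd] at h2
  have h3 : star (Ψᴴ *ᵥ v) ⬝ᵥ (diagonal fun i => ((d i : ℂ))⁻¹) *ᵥ Ψᴴ *ᵥ v =
      ((∑ i, (d i)⁻¹ * ‖(Ψᴴ *ᵥ v) i‖ ^ 2 : ℝ) : ℂ) := by
    push_cast
    refine Finset.sum_congr rfl fun i _ => ?_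
    rw [mulVec_diagonal, Pi.star_apply, mul_left_comm, Complex.star_def, Complex.conj_mul']
  rw [hγ, D_inv hd, smul_mulVec, dotProduct_smul, h2, h3, hv, dotProduct_smul, smul_eq_mul,
    smul_eq_mul, mul_comm Complex.I] at h1
  have h4 : star v ⬝ᵥ v = ((∑ i, ‖v i‖ ^ 2 : ℝ) : ℂ) := by
    push_cast
    exact Finset.sum_congr rfl fun i _ => by
      rw [Pi.star_apply, Complex.star_def, Complex.conj_mul']
  rw [h4, Complex.im_mul_ofReal] at h1
  have h5 := mul_right_cancel₀ Complex.I_ne_zero h1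
  -- An eigenvector v turns the form of γ - γ* into 2i·Im z·|v|²; negativity of d makes the right
  -- side nonpositive, against Im z > 0.
  have h6 : 2 * (z.im * ∑ i, ‖v i‖ ^ 2) = ∑ i, (d i)⁻¹ * ‖(Ψᴴ *ᵥ v) i‖ ^ 2 := by exact_mod_cast h5
  have h7 : ∑ i, (d i)⁻¹ * ‖(Ψᴴ *ᵥ v) i‖ ^ 2 ≤ 0 :=
    Finset.sum_nonpos fun i _ => mul_nonpos_of_nonpos_of_nonneg (inv_nonpos.2 (hd i).le)
      (by positivity)
  have h8 : 0 < ∑ i, ‖v i‖ ^ 2 := by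
    obtain ⟨i, hi⟩ := Function.ne_iff.1 hv0
    exact Finset.sum_pos' (fun _ _ => by positivity)
      ⟨i, Finset.mem_univ i, by have := norm_pos_iff.2 hi; positivity⟩
  nlinarith [mul_pos hz h8]

/-- A rational Herglotz function with the limit `(i/2)|D|` at infinity has a realization with
`γ - γ* = i (Ψ₁ - Ψ₂) D⁻¹ (Ψ₁ - Ψ₂)*`. -/
theorem exists_realization (hd : ∀ i, d i < 0) {φ : Matrix (Fin p) (Fin p) (RatFunc ℂ)}
    (hlim : Tendsto (evalAt φ) (cocompact ℂ) (𝓝 ((Complex.I / 2) • absD d)))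
    (hIm : ∀ z : ℂ, 0 < z.im → ¬ IsPole φ z → (imPart (evalAt φ z)).PosSemidef) :
    ∃ n : ℕ, 0 < n ∧ ∃ (Ψ₁ Ψ₂ : Matrix (Fin n) (Fin p) ℂ) (γ : Matrix (Fin n) (Fin n) ℂ),
      IsRealization d φ Ψ₁ Ψ₂ γ := by
  have hpole : ∀ z : ℂ, 0 < z.im → ¬ IsPole φ z := fun z hz => not_isPole_of_im_nonneg hIm hz
  have hentry : ∀ i j, ∃ h, StateRealizable h ∧ ∀ z : ℂ, 0 < z.im →
      (φ i j).eval (RingHom.id ℂ) z = ((Complex.I / 2) • absD d) i j + h z := by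
    intro i j
    apply exists_stateRealizable
    · exact tendsto_pi_nhds.1 (tendsto_pi_nhds.1 hlim i) j
    · intro a ha
      by_contra! h
      exact hpole a h ⟨i, j, ha⟩
  choose f hf hφf using hentry
  obtain ⟨ι, _, _, A₀, B₀, C₀, h₀⟩ := exists_matrix_realization (F := fun z => of fun i j => f i j z)
    (by simpa using hf)
  obtain ⟨g, A, B, C, hreach, hABC⟩ := exists_reachable_realization A₀ B₀ C₀
  have hA : ∀ z : ℂ, 0 < z.im → (A - z • (1 : Matrix (Fin g) (Fin g) ℂ)).det ≠ 0 :=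
    fun z hz => (hABC z (h₀ z hz).1).1
  have hφ : ∀ z : ℂ, 0 < z.im → evalAt φ z = (Complex.I / 2) • absD d +
      C * ((A - z • (1 : Matrix (Fin g) (Fin g) ℂ))⁻¹ * B) := by
    intro z hz
    obtain ⟨h1, Z, hZ, hCZ⟩ := h₀ z hz
    rw [(hABC z h1).2 Z _ hZ (by rw [← Matrix.mul_assoc, mul_nonsing_inv _ (hA z hz).isUnit,
      Matrix.one_mul]), ← hCZ]
    ext i j
    exact hφf i j z hz
  have hA1 : IsUnit (1 + Complex.I • A).det := by
    have h2 : 1 + Complex.I • A = Complex.I • (A - Complex.I • (1 : Matrix _ _ ℂ)) := by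
      rw [smul_sub, smul_smul, Complex.I_mul_I]; module
    rw [h2, det_smul]
    exact IsUnit.mk0 _ (mul_ne_zero (pow_ne_zero _ Complex.I_ne_zero) (hA _ (by simp)))
  have hpos := totalSupply_nonneg (C := C) (B := B) (D := (Complex.I / 2) • absD d) hA (by
    intro z hz u
    rw [add_comm, Matrix.mul_assoc, ← hφ z hz, ← re_quadForm_imPart]
    exact (Complex.le_def.1
      ((posSemidef_iff_dotProduct_mulVec.1 (hIm z hz (hpole z hz))).2 u)).1)
  obtain ⟨X, K, hX, hK⟩ := exists_storage hA1 hreach hpos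
  have hΔ : (absD d)ᴴ = absD d := by
    rw [absD, diagonal_conjTranspose]
    congr 1
    ext i
    simp
  have hΔu : IsUnit (absD d).det := by
    rw [absD, det_diagonal]
    refine IsUnit.mk0 _ (Finset.prod_ne_zero_iff.2 fun i _ => ?_)
    exact_mod_cast (abs_pos_of_neg (hd i)).ne'
  have hR := riccati_of_storage hA1 hΔ hΔu hK
  -- A square root of |D|⁻¹ = -D⁻¹; the sign accounts for the passage from |D|⁻¹ in the Riccati
  -- equation to D⁻¹ in (R).
  let E : Matrix (Fin p) (Fin p) ℂ := diagonal fun i => (((√(-d i))⁻¹ : ℝ) : ℂ)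
  have hE : IsUnit E.det := by
    rw [det_diagonal]
    refine IsUnit.mk0 _ (Finset.prod_ne_zero_iff.2 fun i _ => ?_)
    exact_mod_cast (inv_pos.2 (Real.sqrt_pos.2 (neg_pos.2 (hd i)))).ne'
  have hEE : Eᴴ * E = -(D d)⁻¹ := by
    rw [D_inv hd, diagonal_neg]
    simp only [E]
    rw [diagonal_conjTranspose, diagonal_mul_diagonal]
    congr 1
    ext i
    rw [Pi.star_apply, Complex.star_def, Complex.conj_ofReal, ← Complex.ofReal_mul, ← mul_inv,
      Real.mul_self_sqrt (neg_pos.2 (hd i)).le]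
    push_cast
    rw [inv_neg]
  have hEE' : (absD d)⁻¹ = Eᴴ * E := by
    rw [hEE, absD_eq_neg hd]
    apply inv_eq_left_inv
    rw [Matrix.neg_mul, Matrix.mul_neg, neg_neg, D_inv hd, D, diagonal_mul_diagonal,
      ← diagonal_one]
    congr 1
    ext i
    exact inv_mul_cancel₀ (by exact_mod_cast (hd i).ne)
  rw [hEE'] at hR
  obtain ⟨Ψ₁, Ψ₂, γ, hγ, hreal⟩ := exists_dissipative_realization hX hE hR
  have hγ' : γ - γᴴ = Complex.I • ((Ψ₁ - Ψ₂) * (D d)⁻¹ * (Ψ₁ - Ψ₂)ᴴ) := by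
    rw [hγ, hEE, Matrix.mul_neg, Matrix.neg_mul, smul_neg, neg_neg]
  have hγφ : ∀ z : ℂ, 0 < z.im → evalAt φ z = (Complex.I / 2) • absD d +
      Ψ₁ᴴ * (γ - z • (1 : Matrix (Fin g) (Fin g) ℂ))⁻¹ * Ψ₂ := by
    intro z hz
    obtain ⟨Z', hZ', hC⟩ := hreal z ((A - z • (1 : Matrix (Fin g) (Fin g) ℂ))⁻¹ * B)
      (by rw [← Matrix.mul_assoc, mul_nonsing_inv _ (hA z hz).isUnit, Matrix.one_mul])
    rw [hφ z hz, ← hC, ← hZ', Matrix.mul_assoc, ← Matrix.mul_assoc _⁻¹,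
      nonsing_inv_mul _ (det_sub_ne_zero hd hγ' hz).isUnit, Matrix.one_mul]
  -- An empty state space means that φ is constant; a zero state of dimension one supplies the
  -- required n ≥ 1.
  rcases Nat.eq_zero_or_pos g with rfl | hg
  · refine ⟨1, one_pos, 0, 0, 0, realization_of_upperHalfPlane hpole fun z hz => ⟨?_, ?_⟩, by simp⟩
    · rw [det_unique]
      simp
      rintro rfl
      simp at hz
    · rw [hγφ z hz]
      congr 1
      ext i j
      simp [mul_apply]
  · exact ⟨g, hg, Ψ₁, Ψ₂, γ, realization_of_upperHalfPlane hpole fun z hz =>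
      ⟨det_sub_ne_zero hd hγ' hz, hγφ z hz⟩, hγ'⟩

end Existence

/-! ### Calculus of matrix functions on the half-line -/

section Calculus

variable {l m k : Type*}

theorem HasMatDerivAt.const (M : Matrix m k ℂ) (x : ℝ) : HasMatDerivAt (fun _ => M) 0 x :=
  fun _ _ => hasDerivWithinAt_const _ _ _

theorem HasMatDerivAt.sub {F G : ℝ → Matrix m k ℂ} {F' G' : Matrix m k ℂ} {x : ℝ}
    (hF : HasMatDerivAt F F' x) (hG : HasMatDerivAt G G' x) :
    HasMatDerivAt (fun t => F t - G t) (F' - G') x := fun i j => (hF i j).sub (hG i j)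

theorem HasMatDerivAt.const_smul {F : ℝ → Matrix m k ℂ} {F' : Matrix m k ℂ} {x : ℝ}
    (hF : HasMatDerivAt F F' x) (c : ℂ) : HasMatDerivAt (fun t => c • F t) (c • F') x :=
  fun i j => (hF i j).const_mul c

theorem HasMatDerivAt.mul [Fintype m] {F : ℝ → Matrix l m ℂ} {G : ℝ → Matrix m k ℂ}
    {F' : Matrix l m ℂ} {G' : Matrix m k ℂ} {x : ℝ} (hF : HasMatDerivAt F F' x)
    (hG : HasMatDerivAt G G' x) :
    HasMatDerivAt (fun t => F t * G t) (F' * G x + F x * G') x := by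
  intro i j
  simp only [mul_apply, Matrix.add_apply, ← Finset.sum_add_distrib]
  exact HasDerivWithinAt.fun_sum fun a _ => (hF i a).mul (hG a j)

theorem HasMatDerivAt.const_mul [Fintype m] {G : ℝ → Matrix m k ℂ} {G' : Matrix m k ℂ} {x : ℝ}
    (M : Matrix l m ℂ) (hG : HasMatDerivAt G G' x) : HasMatDerivAt (fun t => M * G t) (M * G') x := by
  simpa using (HasMatDerivAt.const M x).mul hG

theorem HasMatDerivAt.mul_const [Fintype m] {F : ℝ → Matrix l m ℂ} {F' : Matrix l m ℂ} {x : ℝ}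
    (hF : HasMatDerivAt F F' x) (M : Matrix m k ℂ) : HasMatDerivAt (fun t => F t * M) (F' * M) x := by
  simpa using hF.mul (HasMatDerivAt.const M x)

theorem HasMatDerivAt.conjTranspose {F : ℝ → Matrix m k ℂ} {F' : Matrix m k ℂ} {x : ℝ}
    (hF : HasMatDerivAt F F' x) : HasMatDerivAt (fun t => (F t)ᴴ) F'ᴴ x :=
  fun i j => (hF j i).star

theorem HasMatDerivAt.congr {F G : ℝ → Matrix m k ℂ} {F' : Matrix m k ℂ} {x : ℝ} (hx : 0 ≤ x)
    (hF : HasMatDerivAt F F' x) (h : ∀ t, 0 ≤ t → G t = F t) : HasMatDerivAt G F' x :=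
  fun i j => (hF i j).congr (fun t ht => by rw [h t ht]) (by rw [h x hx])

theorem HasMatDerivAt.unique {F : ℝ → Matrix m k ℂ} {F' F'' : Matrix m k ℂ} {x : ℝ} (hx : 0 ≤ x)
    (h1 : HasMatDerivAt F F' x) (h2 : HasMatDerivAt F F'' x) : F' = F'' := by
  ext i j
  exact (uniqueDiffOn_Ici 0 x hx).eq_deriv _ (h1 i j) (h2 i j)

theorem HasMatDerivAt.continuousOn {F F' : ℝ → Matrix m k ℂ}
    (h : ∀ x, 0 ≤ x → HasMatDerivAt F (F' x) x) : ContinuousOn F (Set.Ici 0) :=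
  continuousOn_pi.2 fun i => continuousOn_pi.2 fun j => fun x hx => (h x hx i j).continuousWithinAt

/-- Freezing F at its value at 0 for negative t lets existence results on the whole line be applied
on the half-line. -/
theorem continuous_comp_max {E : Type*} [TopologicalSpace E] {F : ℝ → E}
    (hF : ContinuousOn F (Set.Ici 0)) : Continuous fun t => F (max t 0) :=
  hF.comp_continuous (by fun_prop) fun t => le_max_right t 0

theorem HasMatDerivAt.eq_initial {F : ℝ → Matrix m k ℂ} (h : ∀ x, 0 ≤ x → HasMatDerivAt F 0 x)
    {x : ℝ} (hx : 0 ≤ x) : F x = F 0 := by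
  ext i j
  refine constant_of_has_deriv_right_zero (f := fun t => F t i j) (a := 0) (b := x) ?_ ?_ x
    ⟨hx, le_rfl⟩
  · intro t ht
    exact (h t ht.1 i j).continuousWithinAt.mono Set.Icc_subset_Ici_self
  · intro t ht
    exact (h t ht.1 i j).mono (Set.Ici_subset_Ici.2 ht.1)

/-- Cramer's rule shows that the inverse is differentiable; differentiating S⁻¹S = 1 then identifies
the derivative. -/
theorem HasMatDerivAt.inv [Fintype m] [DecidableEq m] {S S' : ℝ → Matrix m m ℂ}
    (h : ∀ x, 0 ≤ x → HasMatDerivAt S (S' x) x) (hS : ∀ x, 0 ≤ x → (S x).det ≠ 0) {x : ℝ}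
    (hx : 0 ≤ x) : HasMatDerivAt (fun t => (S t)⁻¹) (-((S x)⁻¹ * S' x * (S x)⁻¹)) x := by
  have hd : ∀ i j, DifferentiableOn ℝ (fun t => (S t)⁻¹ i j) (Set.Ici 0) :=
    differentiableOn_inv_apply (fun i j t ht => (h t ht i j).differentiableWithinAt) hS
  let T : Matrix m m ℂ := of fun i j => derivWithin (fun t => (S t)⁻¹ i j) (Set.Ici 0) x
  have hT : HasMatDerivAt (fun t => (S t)⁻¹) T x := fun i j => (hd i j x hx).hasDerivWithinAt
  have h1 := hT.mul (h x hx)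
  have h2 := HasMatDerivAt.unique hx h1 ((HasMatDerivAt.const 1 x).congr hx fun t ht =>
    nonsing_inv_mul _ (hS t ht).isUnit)
  have h3 : T = -((S x)⁻¹ * S' x * (S x)⁻¹) := by
    have h4 := congrArg (· * (S x)⁻¹) h2
    simp only [Matrix.add_mul, Matrix.zero_mul, Matrix.mul_assoc T,
      mul_nonsing_inv _ (hS x hx).isUnit, Matrix.mul_one] at h4
    exact eq_neg_of_add_eq_zero_left h4
  rwa [h3] at hT

end Calculus

/-! ### Linear differential equations -/

section ODE

/-- Iterated integrals in the Picard series of `y' = A y`. -/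
noncomputable def picardTerm {E : Type*} [NormedAddCommGroup E] [NormedSpace ℝ E]
    (A : ℝ → E →L[ℝ] E) (y₀ : E) : ℕ → ℝ → E
  | 0 => fun _ => y₀
  | n + 1 => fun t => ∫ s in (0 : ℝ)..t, A s (picardTerm A y₀ n s)

variable {E : Type*} [NormedAddCommGroup E] [NormedSpace ℝ E] {A : ℝ → E →L[ℝ] E}

theorem continuous_picardTerm (hA : Continuous A) (y₀ : E) (n : ℕ) :
    Continuous (picardTerm A y₀ n) := by
  induction n with
  | zero => exact continuous_const
  | succ n ih =>
    have : Continuous fun s => A s (picardTerm A y₀ n s) := hA.clm_apply ih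
    exact intervalIntegral.continuous_primitive (fun a b => this.intervalIntegrable a b) 0

theorem hasDerivAt_picardTerm [CompleteSpace E] (hA : Continuous A) (y₀ : E) (n : ℕ) (t : ℝ) :
    HasDerivAt (picardTerm A y₀ (n + 1)) (A t (picardTerm A y₀ n t)) t := by
  have : Continuous fun s => A s (picardTerm A y₀ n s) :=
    hA.clm_apply (continuous_picardTerm hA y₀ n)
  exact this.integral_hasStrictDerivAt 0 t |>.hasDerivAt

theorem norm_picardTerm_le (y₀ : E) {M R : ℝ}
    (hM : ∀ s ∈ Set.Icc (-R) R, ‖A s‖ ≤ M) (hM0 : 0 ≤ M) (n : ℕ) :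
    ∀ t ∈ Set.Icc (-R) R, ‖picardTerm A y₀ n t‖ ≤ ‖y₀‖ * (M * |t|) ^ n / n.factorial := by
  induction n with
  | zero => intro t _; simp [picardTerm]
  | succ n ih =>
    intro t ht
    have hint : ∫ s in (0 : ℝ)..|t|, M * (‖y₀‖ * (M * s) ^ n / n.factorial) =
        ‖y₀‖ * (M * |t|) ^ (n + 1) / (n + 1).factorial := by
      have : ∀ s : ℝ, M * (‖y₀‖ * (M * s) ^ n / n.factorial) =
          (M ^ (n + 1) * ‖y₀‖ / n.factorial) * s ^ n := by
        intro s; rw [mul_pow]; ring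
      simp only [this]
      rw [intervalIntegral.integral_const_mul, integral_pow, Nat.factorial_succ]
      push_cast
      field_simp
      simp [mul_pow]
      ring
    have hbound : ∀ s, s ∈ Set.uIcc 0 t → ‖A s (picardTerm A y₀ n s)‖ ≤
        M * (‖y₀‖ * (M * |s|) ^ n / n.factorial) := by
      intro s hs
      have hs' : s ∈ Set.Icc (-R) R := by
        have h0 : (0 : ℝ) ∈ Set.Icc (-R) R := by
          constructor <;> linarith [ht.1, ht.2]
        exact Set.uIcc_subset_Icc h0 ht hs
      calc ‖A s (picardTerm A y₀ n s)‖ ≤ ‖A s‖ * ‖picardTerm A y₀ n s‖ := (A s).le_opNorm _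
        _ ≤ _ := mul_le_mul (hM s hs') (ih s hs') (norm_nonneg _) hM0
    have hc : Continuous fun s : ℝ => M * (‖y₀‖ * (M * |s|) ^ n / n.factorial) := by fun_prop
    rcases le_total 0 t with h0 | h0
    · rw [← hint, abs_of_nonneg h0]
      refine (intervalIntegral.norm_integral_le_of_norm_le h0 ?_
        (hc.intervalIntegrable 0 t)).trans_eq ?_
      · filter_upwards with s hs
        exact hbound s (by rw [Set.uIcc_of_le h0]; exact Set.Ioc_subset_Icc_self hs)
      · refine intervalIntegral.integral_congr fun s hs => ?_
        rw [Set.uIcc_of_le h0] at hs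
        simp only [abs_of_nonneg hs.1]
    · rw [← hint, abs_of_nonpos h0]
      simp only [picardTerm]
      rw [intervalIntegral.integral_symm, norm_neg]
      refine (intervalIntegral.norm_integral_le_of_norm_le h0 ?_
        (hc.intervalIntegrable t 0)).trans_eq ?_
      · filter_upwards with s hs
        exact hbound s (by rw [Set.uIcc_of_ge h0]; exact Set.Ioc_subset_Icc_self hs)
      · rw [← neg_zero, ← intervalIntegral.integral_comp_neg, neg_zero]
        refine intervalIntegral.integral_congr fun s hs => ?_
        rw [Set.uIcc_of_le h0] at hs
        simp only [abs_of_nonpos hs.2]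

/-- Global existence for linear differential equations with continuous coefficients. -/
theorem exists_linear_ode [CompleteSpace E] (hA : Continuous A) (y₀ : E) :
    ∃ y : ℝ → E, y 0 = y₀ ∧ ∀ t, HasDerivAt y (A t (y t)) t := by
  have hsum : ∀ R : ℝ, ∃ u : ℕ → ℝ, Summable u ∧
      ∀ n, ∀ t ∈ Set.Icc (-R) R, ‖picardTerm A y₀ n t‖ ≤ u n := by
    intro R
    obtain ⟨M, hM⟩ := (isCompact_Icc (a := -R) (b := R)).exists_bound_of_continuousOn
      hA.continuousOn
    refine ⟨fun n => ‖y₀‖ * ((max M 0 * |R|) ^ n / n.factorial),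
      (Real.summable_pow_div_factorial _).mul_left _, fun n t ht => ?_⟩
    have h1 := norm_picardTerm_le (A := A) y₀ (M := max M 0)
      (fun s hs => (hM s hs).trans (le_max_left _ _)) (le_max_right _ _) n t ht
    refine h1.trans ?_
    simp only [mul_div_assoc]
    have : |t| ≤ |R| := by
      rw [abs_le]
      exact ⟨by linarith [ht.1, neg_abs_le R, le_abs_self R], ht.2.trans (le_abs_self R)⟩
    have h0 : 0 ≤ max M 0 := le_max_right _ _
    have h2 : max M 0 * |t| ≤ max M 0 * |R| := mul_le_mul_of_nonneg_left this h0
    gcongr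
  have hs : ∀ t, Summable fun n => picardTerm A y₀ n t := by
    intro t
    obtain ⟨u, hu, h⟩ := hsum |t|
    exact Summable.of_norm_bounded hu fun n => h n t ⟨neg_abs_le t, le_abs_self t⟩
  refine ⟨fun t => ∑' n, picardTerm A y₀ n t, ?_, fun t => ?_⟩
  · change ∑' n, picardTerm A y₀ n 0 = y₀
    rw [tsum_eq_single 0]
    · rfl
    · intro n hn
      obtain ⟨m, rfl⟩ := Nat.exists_eq_succ_of_ne_zero hn
      simp [picardTerm]
  -- A bounded open interval around t on which the differentiated Picard series is dominated by a
  -- summable sequence, so it may be differentiated termwise.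
  · obtain ⟨u, hu, h⟩ := hsum (|t| + 1)
    obtain ⟨M, hM⟩ := (isCompact_Icc (a := -(|t| + 1)) (b := |t| + 1)).exists_bound_of_continuousOn
      hA.continuousOn
    have ht : t ∈ Set.Ioo (-(|t| + 1)) (|t| + 1) :=
      ⟨by linarith [neg_abs_le t], by linarith [le_abs_self t]⟩
    have hd := hasDerivAt_tsum_of_isPreconnected (g := fun n => picardTerm A y₀ (n + 1))
      (g' := fun n t => A t (picardTerm A y₀ n t)) (u := fun n => M * u n) (hu.mul_left M)
      isOpen_Ioo isPreconnected_Ioo (fun n y _ => hasDerivAt_picardTerm hA y₀ n y)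
      (fun n y hy => ?_) ht ((summable_nat_add_iff 1).2 (hs t)) ht
    · have he : (fun t => ∑' n, picardTerm A y₀ n t) =
          fun t => y₀ + ∑' n, picardTerm A y₀ (n + 1) t := by
        ext s
        rw [(hs s).tsum_eq_zero_add]
        rfl
      rw [he]
      have h2 := hd.const_add y₀
      rw [← (A t).map_tsum (hs t)] at h2
      convert h2 using 2
      exact (hs t).tsum_eq_zero_add.symm
    · have hy' := Set.Ioo_subset_Icc_self hy
      calc ‖A y (picardTerm A y₀ n y)‖ ≤ ‖A y‖ * ‖picardTerm A y₀ n y‖ := (A y).le_opNorm _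
        _ ≤ _ := mul_le_mul (hM y hy') (h n y hy') (norm_nonneg _)
          ((norm_nonneg _).trans (hM y hy'))

/-- Global existence on the half-line for `Y' = a Y b`. -/
theorem exists_matrix_ode {m k : Type*} [Fintype m] [Fintype k] {a : ℝ → Matrix m m ℂ}
    {b : ℝ → Matrix k k ℂ} (ha : ContinuousOn a (Set.Ici 0)) (hb : ContinuousOn b (Set.Ici 0))
    (Y₀ : Matrix m k ℂ) :
    ∃ Y : ℝ → Matrix m k ℂ, Y 0 = Y₀ ∧ ∀ x, 0 ≤ x → HasMatDerivAt Y (a x * Y x * b x) x := by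
  let Lin : ℝ → (m → k → ℂ) →ₗ[ℝ] (m → k → ℂ) := fun t =>
    { toFun := fun Y => a (max t 0) * (of Y) * b (max t 0)
      map_add' := fun Y Z => by
        change a (max t 0) * (of Y + of Z) * b (max t 0) = _
        rw [Matrix.mul_add, Matrix.add_mul]; rfl
      map_smul' := fun c Y => by
        change a (max t 0) * (c • of Y) * b (max t 0) = _
        rw [Matrix.mul_smul, Matrix.smul_mul]; rfl }
  have hcont : Continuous fun t => (Lin t).toContinuousLinearMap := by
    refine continuous_clm_apply.2 fun Y => ?_
    have h1 := continuous_comp_max ha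
    have h2 := continuous_comp_max hb
    exact (h1.matrix_mul continuous_const).matrix_mul h2
  obtain ⟨Y, hY0, hY⟩ := exists_linear_ode hcont Y₀
  refine ⟨Y, hY0, fun x hx i j => ?_⟩
  have h1 := hasDerivAt_pi.1 (hasDerivAt_pi.1 (hY x) i) j
  have h2 : (Lin x).toContinuousLinearMap (Y x) = a x * of (Y x) * b x := by
    change a (max x 0) * (of (Y x)) * b (max x 0) = _
    rw [max_eq_left hx]
  rw [h2] at h1
  exact h1.hasDerivWithinAt

end ODE

/-! ### The transformed system -/

section Constants

variable {p : ℕ} (d : Fin p → ℝ)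

/-- The column `[D/2; I]`, so that `H₀ = e e*`. -/
noncomputable def colE : Matrix (Fin p ⊕ Fin p) (Fin p) ℂ := fromRows ((1 / 2 : ℂ) • D d) 1

/-- The column `[I; -D/2]`, which spans the kernel of `H₀`. -/
noncomputable def colN : Matrix (Fin p ⊕ Fin p) (Fin p) ℂ := fromRows 1 (-((1 / 2 : ℂ) • D d))

theorem sigJ_conjTranspose : (sigJ p)ᴴ = sigJ p := by
  simp [sigJ, fromBlocks_conjTranspose]

theorem sigJ_mul_self : sigJ p * sigJ p = 1 := by
  simp [sigJ, fromBlocks_multiply]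

theorem sigJ_mul_sigJ_mul {k : Type*} (M : Matrix (Fin p ⊕ Fin p) k ℂ) :
    sigJ p * (sigJ p * M) = M := by
  rw [← Matrix.mul_assoc, sigJ_mul_self, Matrix.one_mul]

theorem D_conjTranspose : (D d)ᴴ = D d := by
  rw [D, diagonal_conjTranspose]
  congr 1
  ext i
  simp

theorem colE_conjTranspose : (colE d)ᴴ = fromCols ((1 / 2 : ℂ) • D d) 1 := by
  rw [colE, conjTranspose_fromRows_eq_fromCols_conjTranspose, conjTranspose_smul, D_conjTranspose,
    conjTranspose_one]
  simp

theorem H₀_eq : H₀ d = colE d * (colE d)ᴴ := by rw [colE_conjTranspose]; rfl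

theorem H₀_conjTranspose : (H₀ d)ᴴ = H₀ d := by
  rw [H₀_eq, conjTranspose_mul, conjTranspose_conjTranspose]

theorem sigJ_mul_colE : sigJ p * colE d = fromRows 1 ((1 / 2 : ℂ) • D d) := by
  rw [sigJ, colE, fromBlocks_mul_fromRows]
  simp

theorem colE_mul_colN : (colE d)ᴴ * colN d = 0 := by
  rw [colE_conjTranspose, colN, fromCols_mul_fromRows]
  simp

theorem H₀_mul_colN : H₀ d * colN d = 0 := by
  rw [H₀_eq, Matrix.mul_assoc, colE_mul_colN, Matrix.mul_zero]

/-- J q₀ is skew-Hermitian, the two terms of q₀ being exchanged by the adjoint. This is what makes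
v₀ J-unitary. -/
theorem sigJ_mul_q₀_conjTranspose {n : ℕ} (Λ : Matrix (Fin n) (Fin p ⊕ Fin p) ℂ)
    {S : Matrix (Fin n) (Fin n) ℂ} (hS : Sᴴ = S) :
    (q₀ d Λ S)ᴴ * sigJ p = -(sigJ p * q₀ d Λ S) := by
  rw [q₀, conjTranspose_sub]
  simp only [conjTranspose_mul, conjTranspose_conjTranspose, sigJ_conjTranspose, H₀_conjTranspose,
    conjTranspose_nonsing_inv, hS, Matrix.sub_mul, Matrix.mul_sub, Matrix.mul_assoc,
    sigJ_mul_sigJ_mul, sigJ_mul_self, Matrix.mul_one]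
  abel

end Constants

/-- The matrix functions which determine the transformed canonical system. -/
structure TransformData {p n : ℕ} (d : Fin p → ℝ) (α : Matrix (Fin n) (Fin n) ℂ)
    (Λ : ℝ → Matrix (Fin n) (Fin p ⊕ Fin p) ℂ) (S : ℝ → Matrix (Fin n) (Fin n) ℂ)
    (v : ℝ → Matrix (Fin p ⊕ Fin p) (Fin p ⊕ Fin p) ℂ) : Prop where
  init : α - αᴴ = Complex.I • (Λ 0 * sigJ p * (Λ 0)ᴴ)
  deriv_Λ : ∀ x, 0 ≤ x → HasMatDerivAt Λ (-Complex.I • (α * Λ x * sigJ p * H₀ d)) x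
  S_zero : S 0 = 1
  deriv_S : ∀ x, 0 ≤ x → HasMatDerivAt S
    ((Λ x * (sigJ p * colE d)) * (Λ x * (sigJ p * colE d))ᴴ) x
  v_zero : v 0 = 1
  deriv_v : ∀ x, 0 ≤ x → HasMatDerivAt v (-(q₀ d (Λ x) (S x) * v x)) x

/-! ### Identities along the half-line and explicit solutions -/

section Transform

variable {p n : ℕ} {d : Fin p → ℝ} {α : Matrix (Fin n) (Fin n) ℂ}
  {Λ : ℝ → Matrix (Fin n) (Fin p ⊕ Fin p) ℂ} {S : ℝ → Matrix (Fin n) (Fin n) ℂ}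
  {v : ℝ → Matrix (Fin p ⊕ Fin p) (Fin p ⊕ Fin p) ℂ}

theorem output_mul_self (L : Matrix (Fin n) (Fin p ⊕ Fin p) ℂ) :
    (L * (sigJ p * colE d)) * (L * (sigJ p * colE d))ᴴ = L * sigJ p * H₀ d * sigJ p * Lᴴ := by
  rw [H₀_eq]
  simp only [conjTranspose_mul, sigJ_conjTranspose, Matrix.mul_assoc]

/-- A matrix function whose derivative has a nonnegative form is monotone as a form. -/
theorem re_quadForm_mono {S F : ℝ → Matrix (Fin n) (Fin n) ℂ}
    (hS : ∀ x, 0 ≤ x → HasMatDerivAt S (F x) x)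
    (hF : ∀ x, 0 ≤ x → ∀ c, 0 ≤ (star c ⬝ᵥ F x *ᵥ c).re) (c : Fin n → ℂ) :
    MonotoneOn (fun x => (star c ⬝ᵥ S x *ᵥ c).re) (Set.Ici 0) := by
  have hd : ∀ x, 0 ≤ x → HasDerivWithinAt (fun x => (star c ⬝ᵥ S x *ᵥ c).re)
      (star c ⬝ᵥ F x *ᵥ c).re (Set.Ici 0) x := by
    intro x hx
    have h1 : HasDerivWithinAt (fun x => star c ⬝ᵥ S x *ᵥ c) (star c ⬝ᵥ F x *ᵥ c) (Set.Ici 0) x :=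
      HasDerivWithinAt.fun_sum fun i _ =>
        (HasDerivWithinAt.fun_sum fun j _ => (hS x hx i j).mul_const (c j)).const_mul _
    exact Complex.reCLM.hasFDerivAt.comp_hasDerivWithinAt x h1
  refine monotoneOn_of_hasDerivWithinAt_nonneg (convex_Ici 0)
    (fun x hx => (hd x hx).continuousWithinAt)
    (f' := fun x => (star c ⬝ᵥ F x *ᵥ c).re) ?_ ?_
  · intro x hx
    rw [interior_Ici] at hx ⊢
    exact (hd x (le_of_lt hx)).mono Set.Ioi_subset_Ici_self
  · intro x hx
    rw [interior_Ici] at hx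
    exact hF x (le_of_lt hx) c

/-- The derivative GG* is nonnegative, so S stays above its initial value I; invertibility of S
follows. -/
theorem re_quadForm_ge {S : ℝ → Matrix (Fin n) (Fin n) ℂ} {G : ℝ → Matrix (Fin n) (Fin p) ℂ}
    (hS0 : S 0 = 1) (hS : ∀ x, 0 ≤ x → HasMatDerivAt S (G x * (G x)ᴴ) x) {x : ℝ} (hx : 0 ≤ x)
    (c : Fin n → ℂ) : (star c ⬝ᵥ c).re ≤ (star c ⬝ᵥ S x *ᵥ c).re := by
  have h1 := re_quadForm_mono hS (fun x _ c => by
    have := quadForm_conjTranspose_mul_self (G x)ᴴ c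
    rw [conjTranspose_conjTranspose] at this
    rw [this, Complex.ofReal_re]
    positivity) c (Set.self_mem_Ici) (Set.mem_Ici.2 hx) hx
  simpa [hS0] using h1

theorem det_ne_zero_of_gram {S : ℝ → Matrix (Fin n) (Fin n) ℂ}
    {G : ℝ → Matrix (Fin n) (Fin p) ℂ} (hS0 : S 0 = 1)
    (hS : ∀ x, 0 ≤ x → HasMatDerivAt S (G x * (G x)ᴴ) x) {x : ℝ} (hx : 0 ≤ x) :
    (S x).det ≠ 0 := by
  intro hdet
  obtain ⟨c, hc0, hc⟩ := exists_mulVec_eq_zero_iff.2 hdet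
  have h1 := re_quadForm_ge hS0 hS hx c
  rw [hc, dotProduct_zero, Complex.zero_re] at h1
  have h3 := (Complex.lt_def.1 (dotProduct_star_self_pos_iff.2 hc0)).1
  rw [Complex.zero_re] at h3
  linarith

namespace TransformData

variable (h : TransformData d α Λ S v)
include h

theorem S_hermitian {x : ℝ} (hx : 0 ≤ x) : (S x)ᴴ = S x := by
  have h1 : ∀ x, 0 ≤ x → HasMatDerivAt (fun t => (S t)ᴴ - S t) 0 x := by
    intro x hx
    have := (h.deriv_S x hx).conjTranspose.sub (h.deriv_S x hx)
    rwa [conjTranspose_mul, conjTranspose_conjTranspose, sub_self] at this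
  have h2 := HasMatDerivAt.eq_initial h1 hx
  simp only [h.S_zero, conjTranspose_one, sub_self] at h2
  exact sub_eq_zero.1 h2

theorem re_quadForm_S_ge {x : ℝ} (hx : 0 ≤ x) (c : Fin n → ℂ) :
    (star c ⬝ᵥ c).re ≤ (star c ⬝ᵥ S x *ᵥ c).re := re_quadForm_ge h.S_zero h.deriv_S hx c

theorem det_S_ne_zero {x : ℝ} (hx : 0 ≤ x) : (S x).det ≠ 0 :=
  det_ne_zero_of_gram h.S_zero h.deriv_S hx

theorem re_quadForm_S_inv_nonneg {x : ℝ} (hx : 0 ≤ x) (c : Fin n → ℂ) :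
    0 ≤ (star c ⬝ᵥ (S x)⁻¹ *ᵥ c).re := by
  have h1 := h.re_quadForm_S_ge hx ((S x)⁻¹ *ᵥ c)
  rw [mulVec_mulVec, mul_nonsing_inv _ (h.det_S_ne_zero hx).isUnit, one_mulVec] at h1
  have h2 : star ((S x)⁻¹ *ᵥ c) ⬝ᵥ c = star c ⬝ᵥ (S x)⁻¹ *ᵥ c := by
    rw [star_mulVec, conjTranspose_nonsing_inv, h.S_hermitian hx, ← dotProduct_mulVec]
  rw [h2] at h1
  have h3 : 0 ≤ (star ((S x)⁻¹ *ᵥ c) ⬝ᵥ ((S x)⁻¹ *ᵥ c)).re :=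
    (Complex.le_def.1 (dotProduct_star_self_nonneg _)).1
  linarith

/-- The operator identity `α S - S α* = i Λ J Λ*`. -/
theorem identity {x : ℝ} (hx : 0 ≤ x) :
    α * S x - S x * αᴴ = Complex.I • (Λ x * sigJ p * (Λ x)ᴴ) := by
  have h1 : ∀ x, 0 ≤ x → HasMatDerivAt
      (fun t => (α * S t - S t * αᴴ) - Complex.I • (Λ t * sigJ p * (Λ t)ᴴ)) 0 x := by
    intro x hx
    have hΛ := h.deriv_Λ x hx
    have := (((h.deriv_S x hx).const_mul α).sub ((h.deriv_S x hx).mul_const αᴴ)).sub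
      (((hΛ.mul_const (sigJ p)).mul hΛ.conjTranspose).const_smul Complex.I)
    convert this using 1
    rw [output_mul_self]
    simp only [conjTranspose_smul, conjTranspose_mul, H₀_conjTranspose, sigJ_conjTranspose,
      Matrix.smul_mul, Matrix.mul_smul, Matrix.mul_assoc, smul_add, smul_smul,
      star_neg, Complex.star_def, Complex.conj_I, neg_neg, mul_neg, Complex.I_mul_I]
    module
  have h2 := HasMatDerivAt.eq_initial h1 hx
  simp only [h.S_zero, Matrix.mul_one, Matrix.one_mul, ← h.init, sub_self] at h2
  exact sub_eq_zero.1 h2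

/-- The operator identity multiplied by S⁻¹ on both sides; it moves α* past S⁻¹ when Λ*S⁻¹Q is
differentiated. -/
theorem star_mul_inv {x : ℝ} (hx : 0 ≤ x) :
    αᴴ * (S x)⁻¹ = (S x)⁻¹ * α -
      Complex.I • ((S x)⁻¹ * (Λ x * (sigJ p * ((Λ x)ᴴ * (S x)⁻¹)))) := by
  have hu := (h.det_S_ne_zero hx).isUnit
  have h1 := congrArg (fun M => (S x)⁻¹ * M * (S x)⁻¹) (h.identity hx)
  simp only [Matrix.mul_sub, Matrix.sub_mul, Matrix.mul_smul, Matrix.smul_mul] at h1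
  have e1 : (S x)⁻¹ * (α * S x) * (S x)⁻¹ = (S x)⁻¹ * α := by
    rw [Matrix.mul_assoc, Matrix.mul_assoc, mul_nonsing_inv _ hu, Matrix.mul_one]
  have e2 : (S x)⁻¹ * (S x * αᴴ) * (S x)⁻¹ = αᴴ * (S x)⁻¹ := by
    rw [← Matrix.mul_assoc, nonsing_inv_mul _ hu, Matrix.one_mul]
  rw [e1, e2] at h1
  simp only [Matrix.mul_assoc] at h1
  rw [← h1, sub_sub_cancel]

/-- Since J q₀ is skew-Hermitian, the derivative vanishes. Consequently v₀⁻¹ = J v₀* J. -/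
theorem v_sigJ {x : ℝ} (hx : 0 ≤ x) : (v x)ᴴ * sigJ p * v x = sigJ p := by
  have h1 : ∀ x, 0 ≤ x → HasMatDerivAt (fun t => (v t)ᴴ * sigJ p * v t) 0 x := by
    intro x hx
    have := ((h.deriv_v x hx).conjTranspose.mul_const (sigJ p)).mul (h.deriv_v x hx)
    convert this using 1
    rw [conjTranspose_neg, conjTranspose_mul, Matrix.neg_mul, Matrix.mul_assoc,
      sigJ_mul_q₀_conjTranspose d (Λ x) (h.S_hermitian hx)]
    simp only [Matrix.mul_neg, neg_neg, Matrix.mul_assoc]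
    abel
  have h2 := HasMatDerivAt.eq_initial h1 hx
  simpa [h.v_zero] using h2

theorem v_mul_inverse {x : ℝ} (hx : 0 ≤ x) : v x * (sigJ p * (v x)ᴴ * sigJ p) = 1 := by
  apply mul_eq_one_comm.1
  rw [Matrix.mul_assoc, Matrix.mul_assoc, ← Matrix.mul_assoc (v x)ᴴ, h.v_sigJ hx, sigJ_mul_self]

/-- Λ' ends in the factor H₀, which annihilates `colN`. -/
theorem Λ_mul_colN {x : ℝ} (hx : 0 ≤ x) : Λ x * colN d = Λ 0 * colN d := by
  refine HasMatDerivAt.eq_initial (F := fun t => Λ t * colN d) (fun x hx => ?_) hx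
  have := (h.deriv_Λ x hx).mul_const (colN d)
  rwa [Matrix.smul_mul, Matrix.mul_assoc _ (H₀ d), H₀_mul_colN, Matrix.mul_zero, smul_zero] at this

variable {z : ℂ} {Q : Matrix (Fin n) (Fin p) ℂ} {C : Matrix (Fin p) (Fin p) ℂ}

/-- The transform of the constant solutions `N C` of the initial system. -/
theorem deriv_transform (hQ : α * Q = z • Q + Λ 0 * colN d * C) {x : ℝ} (hx : 0 ≤ x) :
    HasMatDerivAt (fun t => colN d * C - Complex.I • (sigJ p * (Λ t)ᴴ * (S t)⁻¹ * Q))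
      ((Complex.I * z) • (sigJ p * H₀ d *
          (colN d * C - Complex.I • (sigJ p * (Λ x)ᴴ * (S x)⁻¹ * Q))) -
        q₀ d (Λ x) (S x) * (colN d * C - Complex.I • (sigJ p * (Λ x)ᴴ * (S x)⁻¹ * Q))) x := by
  have hT := HasMatDerivAt.inv h.deriv_S (fun x hx => h.det_S_ne_zero hx) hx
  have h1 := (HasMatDerivAt.const (colN d * C) x).sub
    (((((h.deriv_Λ x hx).conjTranspose.const_mul (sigJ p)).mul hT).mul_const Q).const_smul
      Complex.I)
  convert h1 using 1
  have hN : ∀ M : Matrix (Fin p) (Fin p) ℂ, H₀ d * (colN d * M) = 0 := by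
    intro M; rw [← Matrix.mul_assoc, H₀_mul_colN, Matrix.zero_mul]
  have hΛN : Λ x * (colN d * C) = Λ 0 * (colN d * C) := by
    rw [← Matrix.mul_assoc, h.Λ_mul_colN hx, Matrix.mul_assoc]
  -- The equation for Q is used here: it makes z appear in place of α*, and its inhomogeneous term
  -- cancels against the part of q₀ acting on `colN d * C`.
  have hα : αᴴ * ((S x)⁻¹ * Q) = z • ((S x)⁻¹ * Q) + (S x)⁻¹ * (Λ 0 * (colN d * C)) -
      Complex.I • ((S x)⁻¹ * (Λ x * (sigJ p * ((Λ x)ᴴ * ((S x)⁻¹ * Q))))) := by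
    rw [← Matrix.mul_assoc, h.star_mul_inv hx, Matrix.sub_mul, Matrix.mul_assoc, hQ]
    simp only [Matrix.mul_add, Matrix.mul_smul, Matrix.smul_mul, Matrix.mul_assoc]
  rw [output_mul_self, q₀]
  simp only [conjTranspose_smul, conjTranspose_mul, H₀_conjTranspose, sigJ_conjTranspose,
      Matrix.smul_mul, Matrix.mul_smul, Matrix.mul_assoc, smul_add, smul_smul,
      star_neg, Complex.star_def, Complex.conj_I, neg_neg, Matrix.mul_sub,
      Matrix.mul_add, Matrix.sub_mul, Matrix.add_mul, Matrix.mul_neg, Matrix.neg_mul,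
      hα, hN, hΛN, Matrix.mul_zero]
  have e1 : Complex.I * z * Complex.I = -z := by
    linear_combination z * Complex.I_mul_I
  simp only [smul_sub, smul_add, smul_smul, e1, Complex.I_mul_I, smul_neg]
  module

/-- A solution of the transformed system. -/
theorem deriv_solution {H : ℝ → Matrix (Fin p ⊕ Fin p) (Fin p ⊕ Fin p) ℂ}
    (hH : ∀ x, 0 ≤ x → H x = (v x)ᴴ * H₀ d * v x)
    (hQ : α * Q = z • Q + Λ 0 * colN d * C) {x : ℝ} (hx : 0 ≤ x) :
    HasMatDerivAt (fun t => sigJ p * (v t)ᴴ * sigJ p *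
        (colN d * C - Complex.I • (sigJ p * (Λ t)ᴴ * (S t)⁻¹ * Q)))
      ((Complex.I * z) • (sigJ p * H x * (sigJ p * (v x)ᴴ * sigJ p *
        (colN d * C - Complex.I • (sigJ p * (Λ x)ᴴ * (S x)⁻¹ * Q))))) x := by
  have h1 := (((h.deriv_v x hx).conjTranspose.const_mul (sigJ p)).mul_const (sigJ p)).mul
    (h.deriv_transform hQ hx)
  convert h1 using 1
  obtain ⟨y, hy⟩ : ∃ y, y = colN d * C - Complex.I • (sigJ p * (Λ x)ᴴ * (S x)⁻¹ * Q) := ⟨_, rfl⟩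
  rw [← hy, hH x hx]
  have e1 : (v x)ᴴ * H₀ d * v x * (sigJ p * (v x)ᴴ * sigJ p * y) = (v x)ᴴ * H₀ d * y := by
    rw [Matrix.mul_assoc _ (v x), ← Matrix.mul_assoc (v x), h.v_mul_inverse hx, Matrix.one_mul]
  have e2 : (q₀ d (Λ x) (S x))ᴴ * (sigJ p * y) = -(sigJ p * (q₀ d (Λ x) (S x) * y)) := by
    rw [← Matrix.mul_assoc, sigJ_mul_q₀_conjTranspose d (Λ x) (h.S_hermitian hx), Matrix.neg_mul,
      Matrix.mul_assoc]
  rw [Matrix.mul_assoc (sigJ p) _ (sigJ p * _ * _ * y), e1, conjTranspose_neg, conjTranspose_mul]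
  simp only [Matrix.mul_sub, Matrix.mul_smul, Matrix.mul_assoc, Matrix.neg_mul, Matrix.mul_neg, e2,
    neg_neg, sigJ_mul_sigJ_mul]
  abel

end TransformData

end Transform

theorem continuousOn_matrix_mul {X l m k : Type*} [TopologicalSpace X] [Fintype m]
    {A : X → Matrix l m ℂ} {B : X → Matrix m k ℂ} {s : Set X} (hA : ContinuousOn A s)
    (hB : ContinuousOn B s) : ContinuousOn (fun x => A x * B x) s :=
  continuousOn_iff_continuous_domRestrict.2 <|
    (continuousOn_iff_continuous_domRestrict.1 hA).matrix_mul
      (continuousOn_iff_continuous_domRestrict.1 hB)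

theorem continuousOn_conjTranspose {X m k : Type*} [TopologicalSpace X]
    {A : X → Matrix m k ℂ} {s : Set X} (hA : ContinuousOn A s) :
    ContinuousOn (fun x => (A x)ᴴ) s :=
  continuousOn_iff_continuous_domRestrict.2 <|
    (continuousOn_iff_continuous_domRestrict.1 hA).matrix_conjTranspose

/-! ### Fundamental solutions -/

section Fundamental

variable {p : ℕ} {H : ℝ → Matrix (Fin p ⊕ Fin p) (Fin p ⊕ Fin p) ℂ}

/-- The Lagrange identity for solutions of the canonical system. -/
theorem deriv_pairing {k l : Type*} {f : ℝ → Matrix (Fin p ⊕ Fin p) k ℂ}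
    {g : ℝ → Matrix (Fin p ⊕ Fin p) l ℂ} {z ζ : ℂ} {x : ℝ} (hH : (H x)ᴴ = H x)
    (hf : HasMatDerivAt f ((Complex.I * z) • (sigJ p * H x * f x)) x)
    (hg : HasMatDerivAt g ((Complex.I * ζ) • (sigJ p * H x * g x)) x) :
    HasMatDerivAt (fun t => (g t)ᴴ * sigJ p * f t)
      ((Complex.I * (z - star ζ)) • ((g x)ᴴ * H x * f x)) x := by
  have h1 := (hg.conjTranspose.mul_const (sigJ p)).mul hf
  convert h1 using 1
  simp only [conjTranspose_smul, conjTranspose_mul, sigJ_conjTranspose, hH, Matrix.smul_mul,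
    Matrix.mul_smul, Matrix.mul_assoc, sigJ_mul_sigJ_mul, sigJ_mul_self, Matrix.one_mul, star_mul', Complex.star_def,
    Complex.conj_I]
  rw [← add_smul]
  congr 1
  ring

/-- At conjugate spectral parameters the factor in the Lagrange identity is zero, so the J-pairing
is conserved. -/
theorem star_mul_solution {w : ℝ → ℂ → Matrix (Fin p ⊕ Fin p) (Fin p ⊕ Fin p) ℂ}
    (hH : ∀ x, 0 ≤ x → (H x)ᴴ = H x) (hw : IsFundamentalSolution H w) {k : Type*}
    {f : ℝ → Matrix (Fin p ⊕ Fin p) k ℂ} {z : ℂ}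
    (hf : ∀ x, 0 ≤ x → HasMatDerivAt f ((Complex.I * z) • (sigJ p * H x * f x)) x) {x : ℝ}
    (hx : 0 ≤ x) : (w x (star z))ᴴ * sigJ p * f x = sigJ p * f 0 := by
  have h1 := HasMatDerivAt.eq_initial (F := fun t => (w t (star z))ᴴ * sigJ p * f t)
    (fun x hx => by
      have := deriv_pairing (hH x hx) (hf x hx) ((hw (star z)).2 x hx)
      simpa using this) hx
  simpa only [(hw (star z)).1, conjTranspose_one, Matrix.one_mul] using h1

/-- Every solution of the canonical system is `w(x, z)` times its initial value. -/
theorem solution_eq {w : ℝ → ℂ → Matrix (Fin p ⊕ Fin p) (Fin p ⊕ Fin p) ℂ}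
    (hH : ∀ x, 0 ≤ x → (H x)ᴴ = H x) (hw : IsFundamentalSolution H w) {k : Type*}
    {f : ℝ → Matrix (Fin p ⊕ Fin p) k ℂ} {z : ℂ}
    (hf : ∀ x, 0 ≤ x → HasMatDerivAt f ((Complex.I * z) • (sigJ p * H x * f x)) x) {x : ℝ}
    (hx : 0 ≤ x) : f x = w x z * f 0 := by
  have h1 := star_mul_solution hH hw hf hx
  have h2 := star_mul_solution hH hw (hw z).2 hx
  rw [(hw z).1, Matrix.mul_one] at h2
  have h3 : (sigJ p * (w x (star z))ᴴ * sigJ p) * w x z = 1 := by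
    rw [Matrix.mul_assoc, Matrix.mul_assoc, ← Matrix.mul_assoc _ (sigJ p), h2, sigJ_mul_self]
  have h4 := mul_eq_one_comm.1 h3
  have h5 := congrArg (fun M => w x z * (sigJ p * M)) h1
  simp only [sigJ_mul_sigJ_mul] at h5
  calc f x = (w x z * (sigJ p * (w x (star z))ᴴ * sigJ p)) * f x := by rw [h4, Matrix.one_mul]
    _ = w x z * (sigJ p * ((w x (star z))ᴴ * sigJ p * f x)) := by simp only [Matrix.mul_assoc]
    _ = w x z * f 0 := h5

theorem exists_isFundamentalSolution (hH : ContinuousOn H (Set.Ici 0)) :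
    ∃ w, IsFundamentalSolution H w := by
  have : ∀ z : ℂ, ∃ w : ℝ → Matrix (Fin p ⊕ Fin p) (Fin p ⊕ Fin p) ℂ, w 0 = 1 ∧
      ∀ x, 0 ≤ x → HasMatDerivAt w ((Complex.I * z) • (sigJ p * H x * w x)) x := by
    intro z
    obtain ⟨w, hw0, hw⟩ := exists_matrix_ode (a := fun x => (Complex.I * z) • (sigJ p * H x))
      (b := fun _ => (1 : Matrix (Fin p ⊕ Fin p) (Fin p ⊕ Fin p) ℂ))
      (ContinuousOn.const_smul (continuousOn_matrix_mul continuousOn_const hH) (Complex.I * z)) continuousOn_const 1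
    refine ⟨w, hw0, fun x hx => ?_⟩
    have := hw x hx
    rwa [Matrix.mul_one, Matrix.smul_mul] at this
  choose w hw0 hw using this
  exact ⟨fun x z => w z x, fun z => ⟨hw0 z, hw z⟩⟩

end Fundamental

/-! ### Existence of the Hamiltonian -/

section Existence

variable {p n : ℕ} {d : Fin p → ℝ}

theorem exists_primitive {m k : Type*} {F : ℝ → Matrix m k ℂ} (hF : ContinuousOn F (Set.Ici 0))
    (Y₀ : Matrix m k ℂ) :
    ∃ Y : ℝ → Matrix m k ℂ, Y 0 = Y₀ ∧ ∀ x, 0 ≤ x → HasMatDerivAt Y (F x) x := by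
  refine ⟨fun x => of fun i j => Y₀ i j + ∫ t in (0 : ℝ)..x, F (max t 0) i j, ?_, ?_⟩
  · ext i j; simp
  · intro x hx i j
    have hc : Continuous fun t => F (max t 0) i j :=
      (continuous_apply_apply i j).comp (continuous_comp_max hF)
    have h1 := (hc.integral_hasStrictDerivAt 0 x).hasDerivAt.const_add (Y₀ i j)
    simp only [max_eq_left hx] at h1
    exact h1.hasDerivWithinAt

theorem transformData_of_isDeterminedBy {α : Matrix (Fin n) (Fin n) ℂ}
    {Λ₁ Λ₂ : Matrix (Fin n) (Fin p) ℂ} {H : ℝ → Matrix (Fin p ⊕ Fin p) (Fin p ⊕ Fin p) ℂ}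
    (h : IsDeterminedBy d α Λ₁ Λ₂ H) :
    ∃ (Λ : ℝ → Matrix (Fin n) (Fin p ⊕ Fin p) ℂ) (S : ℝ → Matrix (Fin n) (Fin n) ℂ)
      (v : ℝ → Matrix (Fin p ⊕ Fin p) (Fin p ⊕ Fin p) ℂ),
      TransformData d α Λ S v ∧ Λ 0 = fromCols Λ₁ Λ₂ ∧
      ∀ x, 0 ≤ x → H x = (v x)ᴴ * H₀ d * v x := by
  obtain ⟨hα, Λ, Ψ, S, v, hΛ0, hΛ, hΨ, hS0, hS, hv0, hv, hH⟩ := h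
  refine ⟨Λ, S, v, ⟨by rw [hΛ0]; exact hα, hΛ, hS0, fun x hx => ?_, hv0, hv⟩, hΛ0, hH⟩
  have := hS x hx
  rwa [hΨ x hx, ← sigJ_mul_colE] at this

/-- The equations are triangular: a linear equation for Λ, a quadrature for S, which stays
invertible, and then a linear equation for v₀ with continuous coefficient. -/
theorem exists_isDeterminedBy {α : Matrix (Fin n) (Fin n) ℂ} {Λ₁ Λ₂ : Matrix (Fin n) (Fin p) ℂ}
    (hα : α - αᴴ = Complex.I • (fromCols Λ₁ Λ₂ * sigJ p * (fromCols Λ₁ Λ₂)ᴴ)) :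
    ∃ H, IsDeterminedBy d α Λ₁ Λ₂ H := by
  obtain ⟨Λ, hΛ0, hΛ⟩ := exists_matrix_ode (a := fun _ => -Complex.I • α)
    (b := fun _ => sigJ p * H₀ d) continuousOn_const continuousOn_const (fromCols Λ₁ Λ₂)
  have hΛ' : ∀ x, 0 ≤ x → HasMatDerivAt Λ (-Complex.I • (α * Λ x * sigJ p * H₀ d)) x := by
    intro x hx
    have := hΛ x hx
    rwa [Matrix.smul_mul, Matrix.smul_mul, ← Matrix.mul_assoc] at this
  have hΛc := HasMatDerivAt.continuousOn hΛ'
  have hΨc : ContinuousOn (fun x => Λ x * (sigJ p * colE d)) (Set.Ici 0) :=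
    continuousOn_matrix_mul hΛc continuousOn_const
  obtain ⟨S, hS0, hS⟩ := exists_primitive
    (F := fun x => (Λ x * (sigJ p * colE d)) * (Λ x * (sigJ p * colE d))ᴴ)
    (continuousOn_matrix_mul hΨc (continuousOn_conjTranspose hΨc)) 1
  have hSc := HasMatDerivAt.continuousOn fun x hx =>
    HasMatDerivAt.inv hS (fun x hx => det_ne_zero_of_gram hS0 hS hx) hx
  have hq : ContinuousOn (fun x => -q₀ d (Λ x) (S x)) (Set.Ici 0) := by
    have hΛs := continuousOn_conjTranspose hΛc
    unfold q₀
    refine ((continuousOn_matrix_mul (continuousOn_matrix_mul (continuousOn_matrix_mul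
      (continuousOn_matrix_mul (continuousOn_matrix_mul continuousOn_const hΛs) hSc) hΛc)
      continuousOn_const) continuousOn_const).sub
      (continuousOn_matrix_mul (continuousOn_matrix_mul (continuousOn_matrix_mul
      continuousOn_const hΛs) hSc) hΛc)).neg
  obtain ⟨v, hv0, hv⟩ := exists_matrix_ode hq
    (b := fun _ => (1 : Matrix (Fin p ⊕ Fin p) (Fin p ⊕ Fin p) ℂ)) continuousOn_const 1
  refine ⟨fun x => (v x)ᴴ * H₀ d * v x, hα, Λ, fun x => Λ x * fromRows 1 ((1 / 2 : ℂ) • D d), S, v,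
    hΛ0, hΛ', fun _ _ => rfl, hS0, fun x hx => ?_, hv0, fun x hx => ?_, fun _ _ => rfl⟩
  · rw [← sigJ_mul_colE]
    exact hS x hx
  · have := hv x hx
    rwa [Matrix.mul_one, Matrix.neg_mul] at this

end Existence

/-! ### The Weyl function -/

section Integrability

theorem conjTranspose_mul_self_diag {m k : Type*} [Fintype m] (a : Matrix m k ℂ) (i : k) :
    (aᴴ * a) i i = ((∑ r, ‖a r i‖ ^ 2 : ℝ) : ℂ) := by
  rw [mul_apply]
  push_cast
  refine Finset.sum_congr rfl fun r _ => ?_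
  rw [conjTranspose_apply, Complex.star_def, Complex.conj_mul']

theorem memLp_of_integrable_diag {m k : Type*} [Fintype m] {a : ℝ → Matrix m k ℂ}
    (ha : ContinuousOn a (Set.Ici 0)) {i : k}
    (hi : IntegrableOn (fun x => ((a x)ᴴ * a x) i i) (Set.Ioi 0)) (r : m) :
    MemLp (fun x => a x r i) 2 (volume.restrict (Set.Ioi 0)) := by
  have hc : ∀ s, ContinuousOn (fun x => a x s i) (Set.Ioi 0) := fun s =>
    (continuous_apply_apply s i).comp_continuousOn (ha.mono Set.Ioi_subset_Ici_self)
  have hm := (hc r).aestronglyMeasurable (μ := volume) measurableSet_Ioi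
  rw [memLp_two_iff_integrable_sq_norm hm]
  refine Integrable.mono hi (hm.norm.pow 2) (ae_of_all _ fun x => ?_)
  rw [conjTranspose_mul_self_diag, Complex.norm_real, Real.norm_of_nonneg (by positivity),
    Real.norm_of_nonneg (by positivity)]
  exact Finset.single_le_sum (f := fun r => ‖a x r i‖ ^ 2) (fun _ _ => by positivity)
    (Finset.mem_univ r)

/-- Diagonal entries integrate to at most G 0 i i because G stays nonnegative there; off-diagonal
entries are sums of products of two square integrable functions. -/
theorem integrable_of_dissipation {m k : Type*} [Fintype m] {a : ℝ → Matrix m k ℂ}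
    {G : ℝ → Matrix k k ℂ} (ha : ContinuousOn a (Set.Ici 0))
    (hG : ∀ x, 0 ≤ x → HasMatDerivAt G (-((a x)ᴴ * a x)) x)
    (hpos : ∀ x, 0 ≤ x → ∀ i, 0 ≤ (G x i i).re) (i j : k) :
    IntegrableOn (fun x => ((a x)ᴴ * a x) i j) (Set.Ioi 0) := by
  have hc : ∀ i j, ContinuousOn (fun x => ((a x)ᴴ * a x) i j) (Set.Ici 0) := fun i j =>
    (continuous_apply_apply i j).comp_continuousOn
      (continuousOn_matrix_mul (continuousOn_conjTranspose ha) ha)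
  have hdiag : ∀ i, IntegrableOn (fun x => ((a x)ᴴ * a x) i i) (Set.Ioi 0) := by
    intro i
    refine integrableOn_Ioi_of_intervalIntegral_norm_bounded (G 0 i i).re 0
      (fun b : ℝ => ((hc i i).mono Set.Icc_subset_Ici_self).integrableOn_Icc.mono_set
        Set.Ioc_subset_Icc_self) tendsto_id ?_
    filter_upwards [eventually_ge_atTop 0] with b hb
    have hnorm : ∀ x, ‖((a x)ᴴ * a x) i i‖ = ∑ r, ‖a x r i‖ ^ 2 := by
      intro x
      rw [conjTranspose_mul_self_diag, Complex.norm_real, Real.norm_of_nonneg (by positivity)]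
    have hd : ∀ x, 0 ≤ x → HasDerivWithinAt (fun x => -(G x i i).re) ‖((a x)ᴴ * a x) i i‖
        (Set.Ici 0) x := by
      intro x hx
      have h1 := (Complex.reCLM.hasFDerivAt.comp_hasDerivWithinAt x (hG x hx i i)).neg
      have h2 : -Complex.reCLM ((-((a x)ᴴ * a x)) i i) = ‖((a x)ᴴ * a x) i i‖ := by
        rw [hnorm, Matrix.neg_apply, conjTranspose_mul_self_diag, Complex.reCLM_apply,
          Complex.neg_re, Complex.ofReal_re, neg_neg]
      rwa [h2] at h1
    have h2 := intervalIntegral.integral_eq_sub_of_hasDeriv_right_of_le hb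
      (f := fun x => -(G x i i).re) (f' := fun x => ‖((a x)ᴴ * a x) i i‖)
      (fun x hx => (hd x hx.1).continuousWithinAt.mono Set.Icc_subset_Ici_self)
      (fun x hx => (hd x hx.1.le).mono fun y hy => hx.1.le.trans (le_of_lt hy))
      (((hc i i).norm.mono (by rw [Set.uIcc_of_le hb]; exact Set.Icc_subset_Ici_self)).intervalIntegrable)
    rw [id, h2]
    linarith [hpos b hb i]
  have hm : ∀ i r, MemLp (fun x => a x r i) 2 (volume.restrict (Set.Ioi 0)) := fun i r =>
    memLp_of_integrable_diag ha (hdiag i) r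
  simp only [mul_apply, conjTranspose_apply]
  exact integrable_finsetSum _ fun r _ => (hm i r).star.integrable_mul (hm j r)

end Integrability

section Weyl

variable {p n : ℕ} {d : Fin p → ℝ} {α : Matrix (Fin n) (Fin n) ℂ}
  {Λ : ℝ → Matrix (Fin n) (Fin p ⊕ Fin p) ℂ} {S : ℝ → Matrix (Fin n) (Fin n) ℂ}
  {v : ℝ → Matrix (Fin p ⊕ Fin p) (Fin p ⊕ Fin p) ℂ}
  {H : ℝ → Matrix (Fin p ⊕ Fin p) (Fin p ⊕ Fin p) ℂ}
  {w : ℝ → ℂ → Matrix (Fin p ⊕ Fin p) (Fin p ⊕ Fin p) ℂ}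

theorem hamiltonian_hermitian (hH : ∀ x, 0 ≤ x → H x = (v x)ᴴ * H₀ d * v x) {x : ℝ}
    (hx : 0 ≤ x) : (H x)ᴴ = H x := by
  rw [hH x hx]
  simp only [conjTranspose_mul, conjTranspose_conjTranspose, H₀_conjTranspose, Matrix.mul_assoc]

theorem hamiltonian_form (hH : ∀ x, 0 ≤ x → H x = (v x)ᴴ * H₀ d * v x) {x : ℝ} (hx : 0 ≤ x)
    {k : Type*} (f : Matrix (Fin p ⊕ Fin p) k ℂ) :
    fᴴ * H x * f = ((colE d)ᴴ * v x * f)ᴴ * ((colE d)ᴴ * v x * f) := by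
  rw [hH x hx, H₀_eq]
  simp only [conjTranspose_mul, conjTranspose_conjTranspose, Matrix.mul_assoc]

/-- The initial value `[I; -iΦ]` in the definition of Weyl functions. -/
noncomputable def weylColumn (Φ : Matrix (Fin p) (Fin p) ℂ) : Matrix (Fin p ⊕ Fin p) (Fin p) ℂ :=
  fromRows 1 (-Complex.I • Φ)

theorem conjTranspose_weylColumn (Φ : Matrix (Fin p) (Fin p) ℂ) :
    (weylColumn Φ)ᴴ =
      fromCols (1 : Matrix (Fin p) (Fin p) ℂ) (Complex.I • Φᴴ) := by
  rw [weylColumn, conjTranspose_fromRows_eq_fromCols_conjTranspose, conjTranspose_smul, conjTranspose_one]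
  simp

theorem weyl_integrand (A : Matrix (Fin p ⊕ Fin p) (Fin p ⊕ Fin p) ℂ)
    (B : Matrix (Fin p ⊕ Fin p) (Fin p ⊕ Fin p) ℂ) (Φ : Matrix (Fin p) (Fin p) ℂ) :
    fromCols (1 : Matrix (Fin p) (Fin p) ℂ) (Complex.I • Φᴴ) * Aᴴ * B * A *
      fromRows (1 : Matrix (Fin p) (Fin p) ℂ) (-Complex.I • Φ) =
    (A * weylColumn Φ)ᴴ * B * (A * weylColumn Φ) := by
  rw [conjTranspose_mul, conjTranspose_weylColumn, weylColumn]
  simp only [Matrix.mul_assoc]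

/-- The explicit solution starts at the Weyl column, so it equals w times that column. Since [D/2;
I]* annihilates `colN`, the integrand is a*a with a = [D/2; I]*JΛ*S⁻¹Q, and the formula for S' gives
(Q*S⁻¹Q)' = -a*a. -/
theorem TransformData.integrable_weyl (h : TransformData d α Λ S v)
    (hH : ∀ x, 0 ≤ x → H x = (v x)ᴴ * H₀ d * v x) (hw : IsFundamentalSolution H w) {z : ℂ}
    {Q : Matrix (Fin n) (Fin p) ℂ} {C Φ : Matrix (Fin p) (Fin p) ℂ}
    (hQ : α * Q = z • Q + Λ 0 * colN d * C)
    (hΦ : colN d * C - Complex.I • (sigJ p * (Λ 0)ᴴ * Q) = weylColumn Φ)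
    (i j : Fin p) :
    IntegrableOn (fun x : ℝ =>
      (fromCols (1 : Matrix (Fin p) (Fin p) ℂ) (Complex.I • Φᴴ) * (w x z)ᴴ * H x * w x z *
        fromRows (1 : Matrix (Fin p) (Fin p) ℂ) (-Complex.I • Φ)) i j) (Set.Ioi 0) := by
  have hsol : ∀ x, 0 ≤ x → sigJ p * (v x)ᴴ * sigJ p *
      (colN d * C - Complex.I • (sigJ p * (Λ x)ᴴ * (S x)⁻¹ * Q)) =
      w x z * weylColumn Φ := by
    intro x hx
    rw [solution_eq (fun x hx => hamiltonian_hermitian hH hx) hw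
      (fun x hx => h.deriv_solution hH hQ hx) hx, h.v_zero, h.S_zero, inv_one, Matrix.mul_one,
      hΦ, conjTranspose_one, Matrix.mul_one, sigJ_mul_self, Matrix.one_mul]
  obtain ⟨a, ha⟩ : ∃ a : ℝ → Matrix (Fin p) (Fin p) ℂ,
    a = fun x => (colE d)ᴴ * (sigJ p * (Λ x)ᴴ * (S x)⁻¹ * Q) := ⟨_, rfl⟩
  have hva : ∀ x, 0 ≤ x → (colE d)ᴴ * v x * (w x z * weylColumn Φ) =
      -Complex.I • a x := by
    intro x hx
    rw [← hsol x hx, ← Matrix.mul_assoc, Matrix.mul_assoc _ (v x), h.v_mul_inverse hx,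
      Matrix.mul_one, Matrix.mul_sub, ← Matrix.mul_assoc, colE_mul_colN, Matrix.zero_mul, zero_sub,
      Matrix.mul_smul, neg_smul, ha]
  have hSi : ∀ x, 0 ≤ x → ((S x)⁻¹)ᴴ = (S x)⁻¹ := fun x hx => by
    rw [conjTranspose_nonsing_inv, h.S_hermitian hx]
  have hG : ∀ x, 0 ≤ x → HasMatDerivAt (fun t => Qᴴ * (S t)⁻¹ * Q) (-((a x)ᴴ * a x)) x := by
    intro x hx
    have h1 := ((HasMatDerivAt.inv h.deriv_S (fun x hx => h.det_S_ne_zero hx) hx).const_mul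
      Qᴴ).mul_const Q
    convert h1 using 1
    rw [ha]
    simp only [conjTranspose_mul, conjTranspose_conjTranspose, sigJ_conjTranspose, hSi x hx,
      Matrix.mul_assoc, Matrix.mul_neg, Matrix.neg_mul]
  have hac : ContinuousOn a (Set.Ici 0) := by
    rw [ha]
    exact continuousOn_matrix_mul continuousOn_const (continuousOn_matrix_mul
      (continuousOn_matrix_mul (continuousOn_matrix_mul continuousOn_const
      (continuousOn_conjTranspose (HasMatDerivAt.continuousOn h.deriv_Λ)))
      (HasMatDerivAt.continuousOn fun x hx =>
        HasMatDerivAt.inv h.deriv_S (fun x hx => h.det_S_ne_zero hx) hx)) continuousOn_const)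
  have hpos : ∀ x, 0 ≤ x → ∀ i, 0 ≤ ((Qᴴ * (S x)⁻¹ * Q) i i).re := by
    intro x hx i
    have h1 := h.re_quadForm_S_inv_nonneg hx (fun r => Q r i)
    convert h1 using 2
    rw [Matrix.mul_assoc, mul_apply]
    simp only [dotProduct, mulVec, conjTranspose_apply, mul_apply, Pi.star_apply]
  refine (integrable_of_dissipation hac hG hpos i j).congr_fun (fun x hx => ?_) measurableSet_Ioi
  have hx' : (0 : ℝ) ≤ x := le_of_lt hx
  simp only
  rw [weyl_integrand, hamiltonian_form hH hx', hva x hx', conjTranspose_smul, Matrix.smul_mul,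
    Matrix.mul_smul, smul_smul]
  simp

end Weyl

/-! ### Uniqueness of the Weyl function -/

section Uniqueness

variable {p n : ℕ} {d : Fin p → ℝ} {α : Matrix (Fin n) (Fin n) ℂ}
  {Λ : ℝ → Matrix (Fin n) (Fin p ⊕ Fin p) ℂ} {S : ℝ → Matrix (Fin n) (Fin n) ℂ}
  {v : ℝ → Matrix (Fin p ⊕ Fin p) (Fin p ⊕ Fin p) ℂ}
  {H : ℝ → Matrix (Fin p ⊕ Fin p) (Fin p ⊕ Fin p) ℂ}
  {w : ℝ → ℂ → Matrix (Fin p ⊕ Fin p) (Fin p ⊕ Fin p) ℂ}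

/-- One has |δa/2 + b|² - |δa/2 - b|² = 2δ Re(āb). Division by δ < 0 gives the dropped square the
favourable sign; this is how D < 0 enters uniqueness. -/
theorem norm_add_sq_div_le {δ : ℝ} (hδ : δ < 0) (a b : ℂ) :
    ‖(1 / 2 : ℂ) * (δ * a) + b‖ ^ 2 / δ ≤ (star a * b + star b * a).re := by
  rw [div_le_iff_of_neg hδ, ← Complex.normSq_eq_norm_sq, Complex.normSq_apply]
  have e1 : (star a * b + star b * a).re = 2 * (a.re * b.re + a.im * b.im) := by
    simp [Complex.mul_re]; ring
  have e2 : ((1 / 2 : ℂ) * (δ * a) + b).re = δ * a.re / 2 + b.re := by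
    simp [Complex.mul_re]; ring
  have e3 : ((1 / 2 : ℂ) * (δ * a) + b).im = δ * a.im / 2 + b.im := by
    simp [Complex.mul_im]; ring
  rw [e1, e2, e3]
  nlinarith [sq_nonneg (δ * a.re / 2 - b.re), sq_nonneg (δ * a.im / 2 - b.im)]

theorem sum_div_le_form (hd : ∀ i, d i < 0) (y : Matrix (Fin p ⊕ Fin p) Unit ℂ) :
    ∑ r, ‖((colE d)ᴴ * y) r ()‖ ^ 2 / d r ≤ ((yᴴ * sigJ p * y) () ()).re := by
  obtain ⟨a, b, rfl⟩ : ∃ a b : Matrix (Fin p) Unit ℂ, y = fromRows a b :=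
    ⟨_, _, (fromRows_toRows y).symm⟩
  have h1 : (fromRows a b)ᴴ * sigJ p * fromRows a b = aᴴ * b + bᴴ * a := by
    rw [Matrix.mul_assoc, sigJ, fromBlocks_mul_fromRows,
      conjTranspose_fromRows_eq_fromCols_conjTranspose, fromCols_mul_fromRows]
    simp
  rw [h1, colE_conjTranspose, fromCols_mul_fromRows, Matrix.add_apply, mul_apply, mul_apply,
    ← Finset.sum_add_distrib, Complex.re_sum]
  refine Finset.sum_le_sum fun r _ => ?_
  have h2 : ((1 / 2 : ℂ) • D d * a + (1 : Matrix (Fin p) (Fin p) ℂ) * b) r () = (1 / 2 : ℂ) * (d r * a r ()) + b r () := by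
    rw [Matrix.one_mul, D, Matrix.smul_mul, Matrix.add_apply, Matrix.smul_apply, diagonal_mul,
      smul_eq_mul]
  rw [h2]
  exact norm_add_sq_div_le (hd r) (a r ()) (b r ())

theorem TransformData.memLp_weyl (h : TransformData d α Λ S v)
    (hH : ∀ x, 0 ≤ x → H x = (v x)ᴴ * H₀ d * v x) (hw : IsFundamentalSolution H w) {z : ℂ}
    {Φ : Matrix (Fin p) (Fin p) ℂ}
    (hΦ : ∀ i j, IntegrableOn (fun x : ℝ =>
      (fromCols (1 : Matrix (Fin p) (Fin p) ℂ) (Complex.I • Φᴴ) * (w x z)ᴴ * H x * w x z *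
        fromRows (1 : Matrix (Fin p) (Fin p) ℂ) (-Complex.I • Φ)) i j) (Set.Ioi 0))
    (i r : Fin p) :
    MemLp (fun x => ((colE d)ᴴ * v x * (w x z * weylColumn Φ)) r i) 2
      (volume.restrict (Set.Ioi 0)) := by
  refine memLp_of_integrable_diag ?_ ?_ r
  · exact continuousOn_matrix_mul (continuousOn_matrix_mul continuousOn_const
      (HasMatDerivAt.continuousOn h.deriv_v)) (continuousOn_matrix_mul
      (HasMatDerivAt.continuousOn (hw z).2) continuousOn_const)
  · refine (hΦ i i).congr_fun (fun x hx => ?_) measurableSet_Ioi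
    simp only
    rw [weyl_integrand, hamiltonian_form hH (le_of_lt hx)]

/-- If E 0 were negative, the lower bound would stay below E 0 on the whole half-line, and an
integrable function cannot do that. -/
theorem nonneg_of_antitone_of_integrable {E : ℝ → ℝ}
    (hE : AntitoneOn E (Set.Ici 0)) {a : ℝ → Fin p → ℂ}
    (ha : ∀ r, MemLp (fun x => a x r) 2 (volume.restrict (Set.Ioi 0)))
    (hle : ∀ x, 0 ≤ x → ∑ r, ‖a x r‖ ^ 2 / d r ≤ E x) : 0 ≤ E 0 := by
  by_contra hneg
  push Not at hneg
  have h1 : Integrable (fun x => ∑ r, ‖a x r‖ ^ 2 / d r) (volume.restrict (Set.Ioi 0)) :=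
    integrable_finsetSum _ fun r _ =>
      ((memLp_two_iff_integrable_sq_norm (ha r).1).1 (ha r)).div_const _
  have h2 : Integrable (fun _ : ℝ => E 0) (volume.restrict (Set.Ioi 0)) := by
    refine h1.mono aestronglyMeasurable_const ?_
    filter_upwards [ae_restrict_mem measurableSet_Ioi] with x hx
    have hx' : (0 : ℝ) ≤ x := le_of_lt hx
    have h3 := hE Set.self_mem_Ici (Set.mem_Ici.2 hx') hx'
    have h4 := hle x hx'
    rw [Real.norm_of_nonpos hneg.le, Real.norm_of_nonpos (by linarith)]
    linarith
  rw [integrable_const_iff] at h2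
  rcases h2 with h2 | h2
  · exact hneg.ne h2
  · have := h2.measure_univ_lt_top
    simp at this

/-- The form f*Jf decreases at the rate 2 Im z times the H-norm density. J-unitarity of v₀ lets it
be computed for v₀f, where D < 0 bounds it below by a function that is integrable by hypothesis. -/
theorem TransformData.pairing_nonneg (h : TransformData d α Λ S v) (hd : ∀ i, d i < 0)
    (hH : ∀ x, 0 ≤ x → H x = (v x)ᴴ * H₀ d * v x) (hw : IsFundamentalSolution H w) {z : ℂ}
    (hz : 0 < z.im) {f₀ : Matrix (Fin p ⊕ Fin p) Unit ℂ}
    (hf : ∀ r, MemLp (fun x => ((colE d)ᴴ * v x * (w x z * f₀)) r ()) 2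
      (volume.restrict (Set.Ioi 0))) :
    0 ≤ ((f₀ᴴ * sigJ p * f₀) () ()).re := by
  have hsol : ∀ x, 0 ≤ x → HasMatDerivAt (fun t => w t z * f₀)
      ((Complex.I * z) • (sigJ p * H x * (w x z * f₀))) x := by
    intro x hx
    have := ((hw z).2 x hx).mul_const f₀
    rwa [Matrix.smul_mul, Matrix.mul_assoc (_ * _) _ f₀] at this
  have hder : ∀ x, 0 ≤ x → HasDerivWithinAt
      (fun t => (((w t z * f₀)ᴴ * sigJ p * (w t z * f₀)) () ()).re)
      (-(2 * z.im) * ∑ r, ‖((colE d)ᴴ * v x * (w x z * f₀)) r ()‖ ^ 2) (Set.Ici 0) x := by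
    intro x hx
    have h1 := deriv_pairing (hamiltonian_hermitian hH hx) (hsol x hx) (hsol x hx) () ()
    have h2 := Complex.reCLM.hasFDerivAt.comp_hasDerivWithinAt x h1
    have h3 : Complex.I * (z - star z) = ((-(2 * z.im) : ℝ) : ℂ) := by
      apply Complex.ext
      · simp
        ring
      · simp
    rw [hamiltonian_form hH hx, Matrix.smul_apply, conjTranspose_mul_self_diag, h3, smul_eq_mul,
      ← Complex.ofReal_mul, Complex.reCLM_apply, Complex.ofReal_re] at h2
    exact h2
  have hanti : AntitoneOn (fun t => (((w t z * f₀)ᴴ * sigJ p * (w t z * f₀)) () ()).re)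
      (Set.Ici 0) := by
    refine antitoneOn_of_hasDerivWithinAt_nonpos (convex_Ici 0)
      (fun x hx => (hder x hx).continuousWithinAt)
      (f' := fun x => -(2 * z.im) * ∑ r, ‖((colE d)ᴴ * v x * (w x z * f₀)) r ()‖ ^ 2) ?_ ?_
    · intro x hx
      rw [interior_Ici] at hx ⊢
      exact (hder x (le_of_lt hx)).mono Set.Ioi_subset_Ici_self
    · intro x _
      exact mul_nonpos_of_nonpos_of_nonneg (by linarith) (Finset.sum_nonneg fun _ _ => by positivity)
  have key := nonneg_of_antitone_of_integrable hanti hf fun x hx => by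
    have h1 := sum_div_le_form hd (v x * (w x z * f₀))
    rw [← Matrix.mul_assoc (colE d)ᴴ] at h1
    refine h1.trans_eq ?_
    have h2 : (v x * (w x z * f₀))ᴴ * sigJ p * (v x * (w x z * f₀)) =
        (w x z * f₀)ᴴ * ((v x)ᴴ * sigJ p * v x) * (w x z * f₀) := by
      simp only [conjTranspose_mul, Matrix.mul_assoc]
    rw [h2, h.v_sigJ hx]
  simpa only [(hw z).1, Matrix.one_mul] using key

/-- If Φ ≠ Ψ, the two columns together contain vectors [A; X] with fixed A and arbitrarily large X
in some direction. The form is linear in X, so it cannot stay nonnegative. -/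
theorem eq_of_forall_pairing_nonneg {Φ Ψ : Matrix (Fin p) (Fin p) ℂ}
    (h : ∀ A B : Matrix (Fin p) Unit ℂ,
      0 ≤ (((weylColumn Φ * A + weylColumn Ψ * B)ᴴ * sigJ p *
        (weylColumn Φ * A + weylColumn Ψ * B)) () ()).re) : Ψ = Φ := by
  have h0 : ∀ A K : Matrix (Fin p) Unit ℂ, ((Aᴴ * ((Φ - Ψ) * K)) () ()).im = 0 := by
    intro A K
    have h1 : ∀ t : ℝ, -(2 * ((Aᴴ * (Φ * A)) () ()).im) ≤
        t * (2 * ((Aᴴ * ((Φ - Ψ) * K)) () ()).im) := by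
      intro t
      -- The coefficients are chosen so that t cancels in the upper component and enters the lower
      -- one only through (Φ - Ψ)K.
      have h2 := h (A + (t : ℂ) • K) (-((t : ℂ) • K))
      obtain ⟨X, hX⟩ : ∃ X : Matrix (Fin p) Unit ℂ,
        X = -Complex.I • (Φ * A + (t : ℂ) • ((Φ - Ψ) * K)) := ⟨_, rfl⟩
      have e1 : weylColumn Φ * (A + (t : ℂ) • K) + weylColumn Ψ * (-((t : ℂ) • K)) =
          fromRows A X := by
        rw [weylColumn, weylColumn, fromRows_mul, fromRows_mul, hX]
        ext i j
        rcases i with i | i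
        · simp
        · simp only [Matrix.add_apply, fromRows_apply_inr, Matrix.smul_mul, Matrix.mul_add,
            Matrix.mul_neg, Matrix.mul_smul, Matrix.sub_mul, Matrix.smul_apply, Matrix.neg_apply,
            Matrix.sub_apply, smul_eq_mul]
          ring
      have e2 : (fromRows A X)ᴴ * sigJ p * fromRows A X = (Aᴴ * X) + (Aᴴ * X)ᴴ := by
        rw [Matrix.mul_assoc, sigJ, fromBlocks_mul_fromRows,
          conjTranspose_fromRows_eq_fromCols_conjTranspose, fromCols_mul_fromRows]
        simp
      have e3 : (Aᴴ * X) () () = -Complex.I * ((Aᴴ * (Φ * A)) () () +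
          (t : ℂ) * (Aᴴ * ((Φ - Ψ) * K)) () ()) := by
        rw [hX, Matrix.mul_smul, Matrix.mul_add, Matrix.mul_smul]
        rfl
      rw [e1, e2, Matrix.add_apply, conjTranspose_apply, e3] at h2
      simp at h2
      linarith
    have := eq_zero_of_linear_bounded h1
    linarith
  have h1 : ∀ (c : ℂ) (i j : Fin p), (star c * (Φ - Ψ) i j).im = 0 := by
    intro c i j
    have := h0 (replicateCol Unit (Pi.single i c)) (replicateCol Unit (Pi.single j 1))
    simpa [mul_apply, Pi.single_apply, apply_ite] using this
  ext i j
  have h2 := h1 1 i j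
  have h3 := h1 Complex.I i j
  apply Complex.ext
  · simp at h3
    linarith
  · simp at h2
    linarith

theorem TransformData.weyl_unique (h : TransformData d α Λ S v) (hd : ∀ i, d i < 0)
    (hH : ∀ x, 0 ≤ x → H x = (v x)ᴴ * H₀ d * v x) {φ ψ : ℂ → Matrix (Fin p) (Fin p) ℂ}
    (hφ : IsWeylFunction H φ) (hψ : IsWeylFunction H ψ) {z : ℂ} (hz : 0 < z.im) : ψ z = φ z := by
  obtain ⟨-, w, hw, hφ⟩ := hφ
  obtain ⟨-, w', hw', hψ⟩ := hψ
  -- Each Weyl function comes with its own fundamental solution; these agree on the half-line, so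
  -- both integrals can be compared.
  have hww : ∀ x, 0 ≤ x → w' x z = w x z := fun x hx => by
    rw [solution_eq (fun x hx => hamiltonian_hermitian hH hx) hw (hw' z).2 hx, (hw' z).1,
      Matrix.mul_one]
  have hψ' : ∀ i j, IntegrableOn (fun x : ℝ =>
      (fromCols (1 : Matrix (Fin p) (Fin p) ℂ) (Complex.I • (ψ z)ᴴ) * (w x z)ᴴ * H x * w x z *
        fromRows (1 : Matrix (Fin p) (Fin p) ℂ) (-Complex.I • ψ z)) i j) (Set.Ioi 0) := by
    intro i j
    refine (hψ z hz i j).congr_fun (fun x hx => ?_) measurableSet_Ioi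
    simp only [hww x (le_of_lt hx)]
  refine eq_of_forall_pairing_nonneg fun A B => h.pairing_nonneg hd hH hw hz fun r => ?_
  have e : (fun x => ((colE d)ᴴ * v x *
      (w x z * (weylColumn (φ z) * A + weylColumn (ψ z) * B))) r ()) = fun x =>
      (∑ i, ((colE d)ᴴ * v x * (w x z * weylColumn (φ z))) r i * A i ()) +
      ∑ i, ((colE d)ᴴ * v x * (w x z * weylColumn (ψ z))) r i * B i () := by
    ext x
    rw [Matrix.mul_add, ← Matrix.mul_assoc (w x z), ← Matrix.mul_assoc (w x z), Matrix.mul_add,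
      ← Matrix.mul_assoc _ _ A, ← Matrix.mul_assoc _ _ B, Matrix.add_apply, mul_apply,
      mul_apply (N := B)]
  rw [e]
  exact (memLp_finsetSum _ fun i _ => (h.memLp_weyl hH hw (hφ z hz) i r).mul_const _).add
    (memLp_finsetSum _ fun i _ => (h.memLp_weyl hH hw hψ' i r).mul_const _)

end Uniqueness

/-! ### Recovery of the system from a realization -/

section Recovery

variable {p n : ℕ} {d : Fin p → ℝ} {φ : Matrix (Fin p) (Fin p) (RatFunc ℂ)}
  {Ψ₁ Ψ₂ : Matrix (Fin n) (Fin p) ℂ} {γ : Matrix (Fin n) (Fin n) ℂ}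

theorem D_mul_inv (hd : ∀ i, d i < 0) : D d * (D d)⁻¹ = 1 := by
  rw [D_inv hd, D, diagonal_mul_diagonal, ← diagonal_one]
  congr 1
  ext i
  exact mul_inv_cancel₀ (by exact_mod_cast (hd i).ne)

theorem parameter_identity {Λ₂ : Matrix (Fin n) (Fin p) ℂ}
    (hγ : γ - γᴴ = Complex.I • ((Ψ₁ - Ψ₂) * (D d)⁻¹ * (Ψ₁ - Ψ₂)ᴴ))
    (hΛ : Λ₂ = (Ψ₁ - Ψ₂) * (D d)⁻¹) :
    (γ + Complex.I • (Ψ₂ * Λ₂ᴴ)) - (γ + Complex.I • (Ψ₂ * Λ₂ᴴ))ᴴ =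
      Complex.I • (fromCols ((1 / 2 : ℂ) • (Ψ₁ + Ψ₂)) Λ₂ * sigJ p *
        (fromCols ((1 / 2 : ℂ) • (Ψ₁ + Ψ₂)) Λ₂)ᴴ) := by
  have h1 : γᴴ = γ - Complex.I • (Λ₂ * (Ψ₁ - Ψ₂)ᴴ) := by rw [hΛ, ← hγ, sub_sub_cancel]
  have h2 : (Ψ₁ - Ψ₂) * Λ₂ᴴ = Λ₂ * (Ψ₁ - Ψ₂)ᴴ := by
    rw [hΛ, conjTranspose_mul, conjTranspose_nonsing_inv, D_conjTranspose, Matrix.mul_assoc]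
  rw [sigJ, fromCols_mul_fromBlocks, conjTranspose_fromCols_eq_fromRows_conjTranspose,
    fromCols_mul_fromRows, conjTranspose_add, h1]
  rw [Matrix.sub_mul, conjTranspose_sub, Matrix.mul_sub] at h2
  have h3 : Ψ₁ * Λ₂ᴴ = Λ₂ * Ψ₁ᴴ - Λ₂ * Ψ₂ᴴ + Ψ₂ * Λ₂ᴴ := by rw [← h2]; abel
  simp only [Matrix.mul_zero, Matrix.mul_one, zero_add, add_zero, conjTranspose_smul,
    conjTranspose_mul, conjTranspose_conjTranspose, conjTranspose_add, conjTranspose_sub,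
    Complex.star_def, Complex.conj_I, Matrix.mul_sub, Matrix.mul_add, Matrix.add_mul,
    Matrix.smul_mul, Matrix.mul_smul, h3, map_div₀, map_one, map_ofNat]
  module

/-- The parameters are chosen so that Λ(0)[I; -D/2] = Ψ₂, and C so that the upper component of the
initial value is I. In the lower component the terms Ψ₂*Q cancel and leave -D/2 - iΨ₁*Q, which is -i
times the realization formula because |D| = -D. -/
theorem realization_solution (hd : ∀ i, d i < 0) {z : ℂ} {Λ₂ : Matrix (Fin n) (Fin p) ℂ}
    (hΛ : Λ₂ = (Ψ₁ - Ψ₂) * (D d)⁻¹) (hdet : (γ - z • (1 : Matrix (Fin n) (Fin n) ℂ)).det ≠ 0)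
    {Q : Matrix (Fin n) (Fin p) ℂ} {C : Matrix (Fin p) (Fin p) ℂ}
    {Λ : Matrix (Fin n) (Fin p ⊕ Fin p) ℂ}
    (hQ : Q = (γ - z • (1 : Matrix (Fin n) (Fin n) ℂ))⁻¹ * Ψ₂)
    (hC : C = 1 + Complex.I • (Λ₂ᴴ * Q))
    (hΛ0 : Λ = fromCols ((1 / 2 : ℂ) • (Ψ₁ + Ψ₂)) Λ₂) :
    (γ + Complex.I • (Ψ₂ * Λ₂ᴴ)) * Q = z • Q + Λ * colN d * C ∧
    colN d * C - Complex.I • (sigJ p * Λᴴ * Q) =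
      weylColumn ((Complex.I / 2) • absD d + Ψ₁ᴴ * Q) := by
  have hΛD : Λ₂ * D d = Ψ₁ - Ψ₂ := by
    rw [hΛ, Matrix.mul_assoc, mul_eq_one_comm.1 (D_mul_inv hd), Matrix.mul_one]
  have hDΛ : D d * (Λ₂ᴴ * Q) = Ψ₁ᴴ * Q - Ψ₂ᴴ * Q := by
    rw [← Matrix.mul_assoc, ← Matrix.sub_mul, ← conjTranspose_sub, ← hΛD, conjTranspose_mul,
      D_conjTranspose]
  have hγQ : γ * Q = z • Q + Ψ₂ := by
    have h1 : (γ - z • (1 : Matrix (Fin n) (Fin n) ℂ)) * Q = Ψ₂ := by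
      rw [hQ, ← Matrix.mul_assoc, mul_nonsing_inv _ hdet.isUnit, Matrix.one_mul]
    rw [Matrix.sub_mul, Matrix.smul_mul, Matrix.one_mul] at h1
    rw [← h1]; abel
  constructor
  · have hN : Λ * colN d = Ψ₂ := by
      rw [hΛ0, colN, fromCols_mul_fromRows, Matrix.mul_neg, Matrix.mul_smul, hΛD, Matrix.mul_one]
      module
    rw [hN, hC, Matrix.add_mul, hγQ, Matrix.mul_add, Matrix.mul_one, Matrix.smul_mul,
      Matrix.mul_smul, Matrix.mul_assoc]
    abel
  · have e1 : sigJ p * Λᴴ * Q = fromRows (Λ₂ᴴ * Q) ((1 / 2 : ℂ) • (Ψ₁ᴴ * Q + Ψ₂ᴴ * Q)) := by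
      rw [hΛ0, conjTranspose_fromCols_eq_fromRows_conjTranspose, sigJ, fromBlocks_mul_fromRows,
        fromRows_mul, conjTranspose_smul, conjTranspose_add]
      simp [Matrix.add_mul]
    have e2 : colN d * C = fromRows C (-((1 / 2 : ℂ) • D d) * C) := by
      rw [colN, fromRows_mul, Matrix.one_mul]
    have e3 : -((1 / 2 : ℂ) • D d) * C = -((1 / 2 : ℂ) • D d) -
        (1 / 2 * Complex.I : ℂ) • (Ψ₁ᴴ * Q - Ψ₂ᴴ * Q) := by
      rw [hC, Matrix.mul_add, Matrix.mul_one, Matrix.mul_smul, Matrix.neg_mul, Matrix.smul_mul, hDΛ]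
      module
    rw [e1, e2, e3, hC, weylColumn, absD_eq_neg hd]
    generalize Ψ₁ᴴ * Q = U
    generalize Ψ₂ᴴ * Q = V
    ext i j
    rcases i with i | i
    · simp
    · simp only [Matrix.sub_apply, fromRows_apply_inr, Matrix.smul_apply, Matrix.add_apply,
        Matrix.neg_apply, smul_eq_mul]
      linear_combination (-(1 / 2 : ℂ) * D d i j) * Complex.I_mul_I

theorem isWeylFunction_evalAt (hd : ∀ i, d i < 0) (hR : IsRealization d φ Ψ₁ Ψ₂ γ)
    {H : ℝ → Matrix (Fin p ⊕ Fin p) (Fin p ⊕ Fin p) ℂ} {Λ₂ : Matrix (Fin n) (Fin p) ℂ}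
    (hΛ : Λ₂ = (Ψ₁ - Ψ₂) * (D d)⁻¹)
    {Λ : ℝ → Matrix (Fin n) (Fin p ⊕ Fin p) ℂ} {S : ℝ → Matrix (Fin n) (Fin n) ℂ}
    {v : ℝ → Matrix (Fin p ⊕ Fin p) (Fin p ⊕ Fin p) ℂ}
    (h : TransformData d (γ + Complex.I • (Ψ₂ * Λ₂ᴴ)) Λ S v)
    (hΛ0 : Λ 0 = fromCols ((1 / 2 : ℂ) • (Ψ₁ + Ψ₂)) Λ₂)
    (hH : ∀ x, 0 ≤ x → H x = (v x)ᴴ * H₀ d * v x) : IsWeylFunction H (evalAt φ) := by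
  have hdet : ∀ z : ℂ, 0 < z.im → (γ - z • (1 : Matrix (Fin n) (Fin n) ℂ)).det ≠ 0 :=
    fun z hz => det_sub_ne_zero hd hR.2 hz
  have hφ : ∀ z : ℂ, 0 < z.im → evalAt φ z = (Complex.I / 2) • absD d +
      Ψ₁ᴴ * ((γ - z • (1 : Matrix (Fin n) (Fin n) ℂ))⁻¹ * Ψ₂) := fun z hz => by
    rw [(hR.1 z (hdet z hz)).2, Matrix.mul_assoc]
  refine ⟨fun i j => ?_, ?_⟩
  · have hinv : ∀ a b, DifferentiableOn ℂ
        (fun z => (γ - z • (1 : Matrix (Fin n) (Fin n) ℂ))⁻¹ a b) {z : ℂ | 0 < z.im} :=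
      differentiableOn_inv_apply (fun a b => by
        simp only [Matrix.sub_apply, Matrix.smul_apply, smul_eq_mul]
        fun_prop) hdet
    have : DifferentiableOn ℂ (fun z => ((Complex.I / 2) • absD d) i j +
        ∑ a, Ψ₁ᴴ i a * ∑ b, (γ - z • (1 : Matrix (Fin n) (Fin n) ℂ))⁻¹ a b * Ψ₂ b j)
        {z : ℂ | 0 < z.im} := by
      refine (differentiableOn_const _).add (DifferentiableOn.fun_sum fun a _ => ?_)
      refine (differentiableOn_const _).mul (DifferentiableOn.fun_sum fun b _ => ?_)
      exact (hinv a b).mul (differentiableOn_const _)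
    refine this.congr fun z hz => ?_
    rw [hφ z hz]
    simp only [Matrix.add_apply, mul_apply]
  · have hHc : ContinuousOn H (Set.Ici 0) := by
      have hv := HasMatDerivAt.continuousOn h.deriv_v
      exact (continuousOn_matrix_mul (continuousOn_matrix_mul (continuousOn_conjTranspose hv)
        continuousOn_const) hv).congr hH
    obtain ⟨w, hw⟩ := exists_isFundamentalSolution hHc
    refine ⟨w, hw, fun z hz i j => ?_⟩
    obtain ⟨h1, h2⟩ := realization_solution hd hΛ (hdet z hz) rfl rfl hΛ0
    rw [← hφ z hz] at h2
    exact h.integrable_weyl hH hw h1 h2 i j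

end Recovery

end CanonicalSystem

theorem mainTheorem6 {p : ℕ} (d : Fin p → ℝ) (hd : ∀ i, d i < 0)
    (φ : Matrix (Fin p) (Fin p) (RatFunc ℂ))
    (hlim : Tendsto (CanonicalSystem.evalAt φ) (cocompact ℂ)
      (𝓝 ((Complex.I / 2) • CanonicalSystem.absD d)))
    (hIm : ∀ z : ℂ, 0 < z.im → ¬ CanonicalSystem.IsPole φ z →
      (CanonicalSystem.imPart (CanonicalSystem.evalAt φ z)).PosSemidef) :
    (∃ n : ℕ, 0 < n ∧ ∃ (Ψ₁ Ψ₂ : Matrix (Fin n) (Fin p) ℂ) (γ : Matrix (Fin n) (Fin n) ℂ),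
      CanonicalSystem.IsRealization d φ Ψ₁ Ψ₂ γ) ∧
    ∀ (n : ℕ) (Ψ₁ Ψ₂ : Matrix (Fin n) (Fin p) ℂ) (γ : Matrix (Fin n) (Fin n) ℂ),
      CanonicalSystem.IsRealization d φ Ψ₁ Ψ₂ γ →
      ∀ (α : Matrix (Fin n) (Fin n) ℂ) (Λ₁ Λ₂ : Matrix (Fin n) (Fin p) ℂ),
        Λ₁ = (1 / 2 : ℂ) • (Ψ₁ + Ψ₂) →
        Λ₂ = (Ψ₁ - Ψ₂) * (CanonicalSystem.D d)⁻¹ →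
        α = γ + Complex.I • (Ψ₂ * Λ₂ᴴ) →
        (∃ H, CanonicalSystem.IsDeterminedBy d α Λ₁ Λ₂ H) ∧
        ∀ H, CanonicalSystem.IsDeterminedBy d α Λ₁ Λ₂ H →
          CanonicalSystem.IsWeylFunction H (CanonicalSystem.evalAt φ) ∧
          ∀ ψ, CanonicalSystem.IsWeylFunction H ψ →
            ∀ z : ℂ, 0 < z.im → ψ z = CanonicalSystem.evalAt φ z := by
  refine ⟨CanonicalSystem.exists_realization hd hlim hIm, ?_⟩
  rintro n Ψ₁ Ψ₂ γ hR α Λ₁ Λ₂ rfl hΛ₂ rfl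
  refine ⟨CanonicalSystem.exists_isDeterminedBy (CanonicalSystem.parameter_identity hR.2 hΛ₂),
    fun H hdet => ?_⟩
  obtain ⟨Λ, S, v, h, hΛ0, hH⟩ := CanonicalSystem.transformData_of_isDeterminedBy hdet
  have hW := CanonicalSystem.isWeylFunction_evalAt hd hR hΛ₂ h hΛ0 hH
  exact ⟨hW, fun ψ hψ z hz => h.weyl_unique hd hH hW hψ hz⟩
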